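/- Let $d\ge 1$ and let $\mathbb H^{d+1}$ be hyperbolic space of curvature $-1$, in the upper half-space model $\{(x,t): x\in\mathbb R^d,\ t>0\}$. The \emph{Böröczky prototile} is $$B=\{(x,t): |x_i|\le 1\ (1\le i\le d),\ 1\le t\le 2\}.$$ It lies between the concentric horospheres $\{t=2\}$ and $\{t=1\}$, which have distance $\ln 2$. Its \emph{facets} are: one $a$-facet $B\cap\{t=2\}$ (a unit cube of the horosphere $\{t=2\}$); the $2^d$ $b$-facets $B\cap\{t=1,\ \sigma_ix_i\ge 0\ (1\le i\le d)\}$ with $\sigma\in\{-1,1\}^d$ (unit cubes of the horosphere $\{t=1\}$); and the $2d$ $c$-facets $B\cap\{x_i=\varepsilon\}$ with $1\le i\le d$, $\varepsilon=\pm1$. The proper faces of $B$ are the non-empty intersections of one or more facets. The facets and faces of a congruent copy of $B$ are the corresponding images. The $a$- and $b$-facets are called \emph{horospheric}. A \emph{B-tiling} of $\mathbb H^{d+1}$ is a set of congruent copies of $B$ (images of $B$ under isometries of $\mathbb H^{d+1}$), called tiles, that cover $\mathbb H^{d+1}$, have pairwise disjoint interiors, and are face-to-face: any two different tiles are disjoint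 or meet in a common proper face. If $d=1$, it is moreover required that the tiling respects the orientation of the $c$-edges from the $a$-edge to a $b$-edge, i.e. whenever two tiles have a $c$-edge in common, the endpoint of this edge that lies on the $a$-edge is the same for both tiles. A \emph{horospheric path} is a finite sequence of pairwise different tiles in which any two consecutive tiles share a horospheric facet. A \emph{pool} is the set of all tiles that can be linked with some given tile by a horospheric path. The \emph{support} $\operatorname{supp}P$ of a pool $P$ is the union of its tiles. \textbf{Theorem.} Let $d\ge1$. \begin{enumerate} \item In every B-tiling of $\mathbb H^{d+1}$ the number of pools is $2^k$ for some $0\le k\le d$. \item For every $0\le k\le d$ there is a B-tiling of $\mathbb H^{d+1}$ with exactly $2^k$ pools. \item Let $0\le k\le d$. The supports of all pools in all B-tilings of $\mathbb H^{d+1}$ with $2^k$ pools are pairwise congruent: if $\mathcal T$ and $\mathcal T'$ (possibly equal) are B-tilings with $2^k$ pools each, $P$ is a pool of $\mathcal T$ and $P'$ is a pool of $\mathcal T'$, then some isometry of $\mathbb H^{d+1}$ maps $\operatorname{supp}P$ onto $\operatorname{supp}P'$. \item In every B-tiling any two pools $P,P'$ are congruent as tilings: some isometry of $\mathbb H^{d+1}$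 maps the set of tiles of $P$ onto the set of tiles of $P'$. \item In every B-tiling of $\mathbb H^{d+1}$ with $2^k$ pools, $0\le k\le d$, all pools share a common $(d-k+1)$-plane: the intersection of the supports of all pools is a $(d-k+1)$-dimensional hyperbolic plane $L$. Moreover there are $k$ pairwise orthogonal hyperbolic hyperplanes $h_1,\dots,h_k$ with $L=\bigcap_{j=1}^k h_j$ (where the empty intersection is $\mathbb H^{d+1}$), such that the support of every pool lies in one of the two closed half-spaces bounded by $h_j$, for each $j$, and any two different pools have supports in opposite closed half-spaces bounded by some $h_j$. \end{enumerate} -/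

import Mathlib

noncomputable section

namespace Boroczky

/-- Hyperbolic space `ℍ^{d+1}` in the upper half-space model: points `(x, t)` with `x ∈ ℝ^d` and
`t > 0`. Its metric is defined below. -/
@[ext]
structure HSpace (d : ℕ) where
  x : EuclideanSpace ℝ (Fin d)
  t : ℝ
  pos : 0 < t

variable {d : ℕ}

namespace HSpace

/-- The Euclidean distance of two points of the half-space. -/
def eucl (p q : HSpace d) : ℝ := √(‖p.x - q.x‖ ^ 2 + (p.t - q.t) ^ 2)

/-- The Euclidean distance of `p` from the mirror image of `q` in the boundary. -/
def euclConj (p q : HSpace d) : ℝ := √(‖p.x - q.x‖ ^ 2 + (p.t + q.t) ^ 2)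

/-- The hyperbolic distance (curvature `-1`), by the formula that Mathlib uses for the upper
half-plane. -/
instance : Dist (HSpace d) := ⟨fun p q => 2 * Real.arsinh (eucl p q / (2 * √(p.t * q.t)))⟩

theorem dist_def (p q : HSpace d) :
    dist p q = 2 * Real.arsinh (eucl p q / (2 * √(p.t * q.t))) := rfl

theorem sinh_half_dist (p q : HSpace d) :
    Real.sinh (dist p q / 2) = eucl p q / (2 * √(p.t * q.t)) := by
  rw [dist_def, mul_div_cancel_left₀ (Real.arsinh _) two_ne_zero, Real.sinh_arsinh]

theorem cosh_half_dist (p q : HSpace d) :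
    Real.cosh (dist p q / 2) = euclConj p q / (2 * √(p.t * q.t)) := by
  have hp := p.pos
  have hq := q.pos
  have h1 : 0 ≤ euclConj p q := Real.sqrt_nonneg _
  rw [← sq_eq_sq₀ (Real.cosh_pos _).le (by positivity), Real.cosh_sq', sinh_half_dist, div_pow,
    div_pow, mul_pow, Real.sq_sqrt (by positivity), eucl, euclConj, Real.sq_sqrt (by positivity),
    Real.sq_sqrt (by positivity)]
  field_simp
  ring

theorem cosh_dist (p q : HSpace d) :
    Real.cosh (dist p q) = 1 + (‖p.x - q.x‖ ^ 2 + (p.t - q.t) ^ 2) / (2 * p.t * q.t) := by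
  have hp := p.pos
  have hq := q.pos
  have h : Real.cosh (2 * (dist p q / 2)) = 1 + 2 * Real.sinh (dist p q / 2) ^ 2 := by
    rw [Real.cosh_two_mul, Real.cosh_sq']; ring
  rw [mul_div_cancel₀ _ two_ne_zero, sinh_half_dist, div_pow, mul_pow,
    Real.sq_sqrt (by positivity), eucl, Real.sq_sqrt (by positivity)] at h
  rw [h]
  field_simp

/-- Ptolemy's inequality for `a`, `b`, `c` and the mirror image of `b`. -/
theorem ptolemy (a b c : HSpace d) :
    eucl a c * (2 * b.t) ≤ eucl a b * euclConj c b + eucl b c * euclConj a b := by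
  have h := EuclideanGeometry.mul_dist_le_mul_dist_add_mul_dist
    (WithLp.toLp 2 (a.x, a.t) : WithLp 2 (EuclideanSpace ℝ (Fin d) × ℝ))
    (WithLp.toLp 2 (b.x, b.t)) (WithLp.toLp 2 (c.x, c.t)) (WithLp.toLp 2 (b.x, -b.t))
  simp only [dist_eq_norm, WithLp.prod_norm_eq_of_L2, WithLp.sub_fst, WithLp.sub_snd,
    WithLp.toLp_fst, WithLp.toLp_snd, sub_self, norm_zero, Real.norm_eq_abs, sq_abs,
    sub_neg_eq_add] at h
  have hb : √((0 : ℝ) ^ 2 + (b.t + b.t) ^ 2) = 2 * b.t := by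
    have := b.pos
    rw [zero_pow two_ne_zero, zero_add, Real.sqrt_sq (by positivity)]; ring
  rw [hb] at h
  exact h

protected theorem dist_triangle (a b c : HSpace d) : dist a c ≤ dist a b + dist b c := by
  have ha := a.pos
  have hb := b.pos
  have hc := c.pos
  have h : Real.sinh (dist a c / 2) ≤ Real.sinh (dist a b / 2 + dist b c / 2) := by
    have hconj : euclConj b c = euclConj c b := by
      unfold euclConj; rw [norm_sub_rev, add_comm c.t]
    rw [Real.sinh_add, sinh_half_dist, sinh_half_dist, sinh_half_dist, cosh_half_dist,
      cosh_half_dist, hconj, Real.sqrt_mul ha.le, Real.sqrt_mul ha.le, Real.sqrt_mul hb.le]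
    have key := ptolemy a b c
    have hA := Real.sqrt_pos.2 ha
    have hB := Real.sqrt_pos.2 hb
    have hC := Real.sqrt_pos.2 hc
    have hB2 : √b.t * √b.t = b.t := Real.mul_self_sqrt hb.le
    have e : eucl a b / (2 * (√a.t * √b.t)) * (euclConj c b / (2 * (√b.t * √c.t))) +
        euclConj a b / (2 * (√a.t * √b.t)) * (eucl b c / (2 * (√b.t * √c.t))) =
        (eucl a b * euclConj c b + eucl b c * euclConj a b) /
          (4 * (√a.t * √c.t) * (√b.t * √b.t)) := by
      field_simp
      ring
    rw [e, hB2, div_le_div_iff₀ (by positivity) (by positivity)]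
    have hpos : 0 ≤ 2 * (√a.t * √c.t) := by positivity
    nlinarith [mul_le_mul_of_nonneg_right key hpos]
  have := Real.sinh_le_sinh.1 h
  linarith

instance : MetricSpace (HSpace d) where
  dist_self p := by simp [dist_def, eucl]
  dist_comm p q := by
    have h : eucl p q = eucl q p := by
      unfold eucl; rw [norm_sub_rev, ← neg_sub q.t, neg_sq]
    rw [dist_def, dist_def, h, mul_comm p.t]
  dist_triangle := HSpace.dist_triangle
  eq_of_dist_eq_zero {p q} h := by
    have hp := p.pos
    have hq := q.pos
    have h1 := cosh_dist p q
    rw [h, Real.cosh_zero, left_eq_add, div_eq_zero_iff,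
      or_iff_left (by positivity : 2 * p.t * q.t ≠ 0)] at h1
    have h2 : ‖p.x - q.x‖ ^ 2 = 0 := by nlinarith [sq_nonneg ‖p.x - q.x‖, sq_nonneg (p.t - q.t)]
    have h3 : (p.t - q.t) ^ 2 = 0 := by nlinarith [sq_nonneg ‖p.x - q.x‖, sq_nonneg (p.t - q.t)]
    exact HSpace.ext (sub_eq_zero.1 (norm_eq_zero.1 (pow_eq_zero_iff two_ne_zero |>.1 h2)))
      (sub_eq_zero.1 (pow_eq_zero_iff two_ne_zero |>.1 h3))

end HSpace

/-- Two subsets of hyperbolic space are congruent if an isometry of the whole space maps one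
onto the other. -/
def Congruent (A B : Set (HSpace d)) : Prop := ∃ φ : HSpace d ≃ᵢ HSpace d, φ '' A = B

/-- The Böröczky prototile `B`. The concentric horospheres are `E₀ = {t = 2}` and `E₁ = {t = 1}`,
centred at the ideal point `∞` and at distance `log 2`; the vertical hyperplanes `x i = ± 1` cut a
cube of edge length `1` out of `E₀` and a cube of edge length `2` out of `E₁`. -/
def prototile (d : ℕ) : Set (HSpace d) := {p | (∀ i, |p.x i| ≤ 1) ∧ 1 ≤ p.t ∧ p.t ≤ 2}

/-- The lower facet: the unit cube in `E₀`. -/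
def facetA (d : ℕ) : Set (HSpace d) := {p ∈ prototile d | p.t = 2}

/-- The `2 ^ d` upper facets: the unit cubes into which the cube in `E₁` is divided. -/
def facetB (σ : Fin d → ℤˣ) : Set (HSpace d) :=
  {p ∈ prototile d | p.t = 1 ∧ ∀ i, 0 ≤ p.x i * ((σ i : ℤ) : ℝ)}

/-- The `2 * d` aside facets, in the hyperplanes `x i = ± 1`. -/
def facetC (i : Fin d) (ε : ℤˣ) : Set (HSpace d) := {p ∈ prototile d | p.x i = ((ε : ℤ) : ℝ)}

/-- `F` is one of the `2 ^ d + 2 * d + 1` facets of the prototile. -/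
def IsProtoFacet (F : Set (HSpace d)) : Prop :=
  F = facetA d ∨ (∃ σ, F = facetB σ) ∨ ∃ i ε, F = facetC i ε

/-- `F` is a proper face of the prototile: a nonempty intersection of facets. -/
def IsProtoFace (F : Set (HSpace d)) : Prop :=
  F.Nonempty ∧ ∃ S : Set (Set (HSpace d)), S.Nonempty ∧ (∀ G ∈ S, IsProtoFacet G) ∧ F = ⋂₀ S

/-- `F` is a proper face of the copy `T` of the prototile. -/
def IsFace (T F : Set (HSpace d)) : Prop :=
  ∃ φ : HSpace d ≃ᵢ HSpace d, φ '' prototile d = T ∧ ∃ G, IsProtoFace G ∧ φ '' G = F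

/-- `F` is a horospheric facet (the `a`-facet or a `b`-facet) of the copy `T` of the prototile. -/
def IsHorosphericFacet (T F : Set (HSpace d)) : Prop :=
  ∃ φ : HSpace d ≃ᵢ HSpace d, φ '' prototile d = T ∧
    (φ '' facetA d = F ∨ ∃ σ, φ '' facetB σ = F)

/-- A B-tiling of `ℍ^{d+1}`: a face-to-face tiling by congruent copies of the prototile. In the
hyperbolic plane (`d = 1`), where the two ends of a `c`-edge cannot be told apart by their shape,
the tiling must also respect the orientations of the `c`-edges from the `a`-edge to a `b`-edge:
if two tiles have a `c`-edge in common, its ends on the two `a`-edges coincide. -/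
structure IsBTiling (𝒯 : Set (Set (HSpace d))) : Prop where
  congruent : ∀ T ∈ 𝒯, Congruent (prototile d) T
  cover : ⋃₀ 𝒯 = Set.univ
  nonoverlap : 𝒯.Pairwise fun T T' => Disjoint (interior T) (interior T')
  faceToFace : 𝒯.Pairwise fun T T' =>
    (T ∩ T').Nonempty → IsFace T (T ∩ T') ∧ IsFace T' (T ∩ T')
  oriented : d = 1 → ∀ φ ψ : HSpace d ≃ᵢ HSpace d, φ '' prototile d ∈ 𝒯 → ψ '' prototile d ∈ 𝒯 →
    ∀ i ε j δ, φ '' facetC i ε = ψ '' facetC j δ →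
      φ '' (facetC i ε ∩ facetA d) = ψ '' (facetC j δ ∩ facetA d)

/-- Two different tiles are adjacent if they share a horospheric facet. -/
def horosphericGraph (𝒯 : Set (Set (HSpace d))) : SimpleGraph (Set (HSpace d)) where
  Adj T T' := T ∈ 𝒯 ∧ T' ∈ 𝒯 ∧ T ≠ T' ∧ ∃ F, IsHorosphericFacet T F ∧ IsHorosphericFacet T' F
  symm := ⟨fun _ _ ⟨h, h', hne, F, hF, hF'⟩ => ⟨h', h, hne.symm, F, hF', hF⟩⟩
  loopless := ⟨fun _ h => h.2.2.1 rfl⟩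

/-- The pool of `T`: all tiles that can be linked with `T` by a horospheric path, that is, a
sequence of pairwise different tiles in which any two consecutive ones share a horospheric
facet. -/
def pool (𝒯 : Set (Set (HSpace d))) (T : Set (HSpace d)) : Set (Set (HSpace d)) :=
  {T' | ∃ w : (horosphericGraph 𝒯).Walk T T', w.IsPath}

/-- The set of all pools of a tiling. -/
def pools (𝒯 : Set (Set (HSpace d))) : Set (Set (Set (HSpace d))) :=
  {P | ∃ T ∈ 𝒯, P = pool 𝒯 T}

/-- The support of a set of tiles: the union of the tiles. -/
def support (P : Set (Set (HSpace d))) : Set (HSpace d) := ⋃₀ P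

/-- Two sets of tiles are congruent as tilings if an isometry of the whole space maps the tiles of
one onto the tiles of the other. -/
def TilewiseCongruent (P P' : Set (Set (HSpace d))) : Prop :=
  ∃ φ : HSpace d ≃ᵢ HSpace d, (fun T => φ '' T) '' P = P'

/-- `L` is an `m`-plane of `ℍ^{d+1}`, for `1 ≤ m ≤ d + 1`: the image under an isometry of a
vertical coordinate plane of codimension `d + 1 - m`. -/
def IsPlane (m : ℕ) (L : Set (HSpace d)) : Prop :=
  ∃ (S : Finset (Fin d)) (φ : HSpace d ≃ᵢ HSpace d),
    S.card + m = d + 1 ∧ φ '' {p | ∀ i ∈ S, p.x i = 0} = L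

/-- The closed half-space of the points at least as near to `a` as to `b`; it is bounded by the
hyperplane that bisects the segment from `a` to `b` orthogonally. -/
def halfSpace (a b : HSpace d) : Set (HSpace d) := {p | dist p a ≤ dist p b}

/-- A hyperbolic hyperplane, given as the perpendicular bisector of two different points. -/
def IsHyperplane (h : Set (HSpace d)) : Prop :=
  ∃ a b : HSpace d, a ≠ b ∧ h = {p | dist p a = dist p b}

/-- `A` lies in one of the two closed half-spaces bounded by the hyperplane `h`. -/
def OnOneSide (h A : Set (HSpace d)) : Prop :=
  ∃ a b : HSpace d, a ≠ b ∧ h = {p | dist p a = dist p b} ∧ A ⊆ halfSpace a b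

/-- `A` and `A'` lie in opposite closed half-spaces bounded by the hyperplane `h`. -/
def Separates (h A A' : Set (HSpace d)) : Prop :=
  ∃ a b : HSpace d, a ≠ b ∧ h = {p | dist p a = dist p b} ∧ A ⊆ halfSpace a b ∧ A' ⊆ halfSpace b a

/-- Two hyperplanes are orthogonal if they are different and the reflection in one of them (the
isometry whose fixed points are exactly the points of that hyperplane) maps the other one onto
itself. -/
def Orthogonal (h h' : Set (HSpace d)) : Prop :=
  h ≠ h' ∧ ∃ ρ : HSpace d ≃ᵢ HSpace d, (∀ p, ρ p = p ↔ p ∈ h) ∧ ρ '' h' = h'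

end Boroczky

end

/-! The proof reduces every tiling to a sequence of nested cubic grids and reads the pools off these
grids.

Rigidity. In the prototile the pairs of points at maximal distance are the antipodal vertices at
height 1, so a distance-preserving self-map of the prototile is a signed permutation of the
horizontal coordinates (`stabilizer_prototile`). The horospheric facets are the faces that no
isometry except the identity fixes pointwise (`Rigid.horospheric`). The c-facets are told apart by
the reflections that fix them (`eq_facetC_of_image`). Hence the neighbour of a tile across a given
facet is almost forced: across a b-facet it is unique, across a c-facet it is the mirror image, and
across the a-facet there is one candidate for each sign vector. In dimension one the orientation
condition excludes the reversal of a c-edge.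

Grids. After one tile has been moved to the prototile, the tiles are exactly the cells of cubic
grids of mesh `2 ^ (n + 1)` in the layers `2 ^ n ≤ t ≤ 2 ^ (n + 1)`, each grid being a coarsening of
the next lower one (`IsBTiling.eq_gridTiling`). Conversely every such sequence of grids gives a
B-tiling (`isBTiling_gridTiling`).

Pools. Horospheric adjacency leads from a cell to the cell above it, so two tiles with a common
ancestor in some high layer are in one pool. In a single coordinate, the grid intervals that contain
two given numbers eventually coincide, unless these numbers are separated by a wall, a number that
is a grid point on all levels (`eventually_floorIdx_eq`). The mesh is unbounded, so a coordinate has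
at most one wall. No horospheric path crosses a wall, since no horospheric facet lies in a vertical
hyperplane. Thus, if `k` coordinates have a wall, the pools are the sets of tiles in the `2 ^ k`
orthants cut out by the walls (`pool_gridTiling`, `encard_pools_gridTiling`).

Consequences. The supports are these orthants (`support_tilesIn`), and `k` determines them up to
isometry (`congruent_orthant`). Reflection in a wall preserves every grid, hence permutes the tiles
and carries one pool to another (`tilewiseCongruent_tilesIn`). The walls are the orthogonal
hyperplanes, and their intersection is the common plane (`poolsShareAxis_gridTiling`). For
existence, coordinates with a constant grid vertex have a wall, and coordinates in which the grid
vertex stays a third of the mesh away from `0` have none (`isWall_exampleGrid_iff`). -/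

noncomputable section

namespace Boroczky

open Filter Topology

variable {d : ℕ}

/-! ### Metric and topology of the half-space in coordinates -/

namespace HSpace

theorem ext' {p q : HSpace d} (h : ∀ i, p.x i = q.x i) (ht : p.t = q.t) : p = q :=
  HSpace.ext (by ext i; exact h i) ht

/-- The point of the half-space with given coordinates. -/
def pt (x : Fin d → ℝ) (t : ℝ) (ht : 0 < t) : HSpace d := ⟨WithLp.toLp 2 x, t, ht⟩

@[simp] theorem pt_x (x : Fin d → ℝ) (t : ℝ) (ht : 0 < t) (i : Fin d) : (pt x t ht).x i = x i := rfl
@[simp] theorem pt_t (x : Fin d → ℝ) (t : ℝ) (ht : 0 < t) : (pt x t ht).t = t := rfl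

/-- The quantity `2 * (cosh (dist p q) - 1)`. -/
def dsq (p q : HSpace d) : ℝ := (∑ i, (p.x i - q.x i) ^ 2 + (p.t - q.t) ^ 2) / (p.t * q.t)

theorem norm_sub_sq (p q : HSpace d) : ‖p.x - q.x‖ ^ 2 = ∑ i, (p.x i - q.x i) ^ 2 := by
  simp [EuclideanSpace.real_norm_sq_eq]

theorem cosh_dist_eq_dsq (p q : HSpace d) : Real.cosh (dist p q) = 1 + dsq p q / 2 := by
  have hp := p.pos
  have hq := q.pos
  rw [cosh_dist, norm_sub_sq, dsq]
  field_simp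

theorem dist_eq_dist_iff {e : ℕ} {p q : HSpace d} {p' q' : HSpace e} :
    dist p q = dist p' q' ↔ dsq p q = dsq p' q' := by
  constructor
  · intro h
    have h1 := cosh_dist_eq_dsq p q
    have h2 := cosh_dist_eq_dsq p' q'
    rw [h] at h1
    linarith
  · intro h
    have h1 : Real.cosh (dist p q) = Real.cosh (dist p' q') := by
      rw [cosh_dist_eq_dsq, cosh_dist_eq_dsq, h]
    have h2 := Real.cosh_le_cosh.1 h1.le
    have h3 := Real.cosh_le_cosh.1 h1.ge
    rw [abs_of_nonneg dist_nonneg, abs_of_nonneg dist_nonneg] at h2 h3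
    exact le_antisymm h2 h3

theorem dist_le_dist_iff {e : ℕ} {p q : HSpace d} {p' q' : HSpace e} :
    dist p q ≤ dist p' q' ↔ dsq p q ≤ dsq p' q' := by
  have : dist p q ≤ dist p' q' ↔ Real.cosh (dist p q) ≤ Real.cosh (dist p' q') := by
    rw [Real.cosh_le_cosh, abs_of_nonneg dist_nonneg, abs_of_nonneg dist_nonneg]
  rw [this, cosh_dist_eq_dsq, cosh_dist_eq_dsq]
  constructor <;> intro h <;> linarith

theorem dsq_isometry {φ : HSpace d → HSpace d} (hφ : Isometry φ) (p q : HSpace d) :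
    dsq (φ p) (φ q) = dsq p q := dist_eq_dist_iff.1 (hφ.dist_eq p q)

/-- Dropping the horizontal part from the formula for `cosh (dist p q)` leaves the hyperbolic cosine
of the difference of the logarithms. The topology is the one of the hyperbolic metric, so this bound
is what makes the height continuous. -/
theorem abs_log_sub_log_le (p q : HSpace d) : |Real.log p.t - Real.log q.t| ≤ dist p q := by
  have hp := p.pos
  have hq := q.pos
  rw [← Real.log_div hp.ne' hq.ne', ← abs_of_nonneg (dist_nonneg (x := p) (y := q)),
    ← Real.cosh_le_cosh, Real.cosh_log (by positivity), cosh_dist_eq_dsq, dsq]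
  have h : 0 ≤ ∑ i, (p.x i - q.x i) ^ 2 := Finset.sum_nonneg fun i _ => sq_nonneg _
  have : 1 + (∑ i, (p.x i - q.x i) ^ 2 + (p.t - q.t) ^ 2) / (p.t * q.t) / 2
      - (p.t / q.t + (p.t / q.t)⁻¹) / 2 = (∑ i, (p.x i - q.x i) ^ 2) / (p.t * q.t) / 2 := by
    field_simp
    ring
  have : 0 ≤ (∑ i, (p.x i - q.x i) ^ 2) / (p.t * q.t) / 2 := by positivity
  linarith

theorem continuous_log_t : Continuous fun p : HSpace d => Real.log p.t := by
  refine LipschitzWith.continuous (K := 1) (LipschitzWith.of_dist_le_mul fun p q => ?_)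
  simpa [Real.dist_eq] using abs_log_sub_log_le p q

theorem continuous_t : Continuous fun p : HSpace d => p.t := by
  have : (fun p : HSpace d => p.t) = fun p => Real.exp (Real.log p.t) := by
    funext p; rw [Real.exp_log p.pos]
  rw [this]
  exact Real.continuous_exp.comp continuous_log_t

theorem norm_sq_eq (p q : HSpace d) :
    ‖p.x - q.x‖ ^ 2 = 2 * p.t * q.t * (Real.cosh (dist p q) - 1) - (p.t - q.t) ^ 2 := by
  have hp := p.pos
  have hq := q.pos
  rw [cosh_dist]
  field_simp
  ring

theorem continuous_x : Continuous fun p : HSpace d => p.x := by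
  rw [continuous_iff_continuousAt]
  intro q
  rw [ContinuousAt, tendsto_iff_norm_sub_tendsto_zero]
  have h : Tendsto (fun p : HSpace d => ‖p.x - q.x‖ ^ 2) (𝓝 q) (𝓝 0) := by
    simp only [norm_sq_eq]
    have : Continuous fun p : HSpace d =>
        2 * p.t * q.t * (Real.cosh (dist p q) - 1) - (p.t - q.t) ^ 2 := by
      have := continuous_t (d := d)
      fun_prop
    have h2 := this.tendsto q
    simpa using h2
  have h3 := h.sqrt
  simpa [Real.sqrt_sq (norm_nonneg _)] using h3

theorem continuous_coord (i : Fin d) : Continuous fun p : HSpace d => p.x i := by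
  have := continuous_x (d := d)
  fun_prop

/-- Horizontal coordinates and the logarithm of the height as coordinates. -/
def logHomeo (d : ℕ) : (EuclideanSpace ℝ (Fin d) × ℝ) ≃ₜ HSpace d where
  toFun q := ⟨q.1, Real.exp q.2, Real.exp_pos _⟩
  invFun p := (p.x, Real.log p.t)
  left_inv q := by simp
  right_inv p := by
    ext1
    · rfl
    · exact Real.exp_log p.pos
  continuous_invFun := continuous_x.prodMk continuous_log_t
  continuous_toFun := by
    rw [continuous_iff_continuousAt]
    intro q
    rw [ContinuousAt, tendsto_iff_dist_tendsto_zero]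
    simp only [dist_def, eucl]
    have : Continuous fun r : EuclideanSpace ℝ (Fin d) × ℝ =>
        2 * Real.arsinh (√(‖r.1 - q.1‖ ^ 2 + (Real.exp r.2 - Real.exp q.2) ^ 2) /
          (2 * √(Real.exp r.2 * Real.exp q.2))) := by
      refine continuous_const.mul (Real.continuous_arsinh.comp (Continuous.div ?_ ?_ ?_))
      · fun_prop
      · fun_prop
      · intro r
        positivity
    simpa using this.tendsto q

/-- Compact closed balls are needed for the local finiteness of tilings. A ball lies in the image of
a compact product under `logHomeo`: the logarithm of the height varies by at most `r`, and then
`norm_sq_eq` bounds the horizontal displacement. -/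
instance : ProperSpace (HSpace d) where
  isCompact_closedBall p r := by
    have hK : IsCompact (logHomeo d '' (Metric.closedBall (logHomeo d |>.symm p).1
        (√(2 * p.t * (p.t * Real.exp r) * Real.cosh r)) ×ˢ
        Set.Icc (Real.log p.t - r) (Real.log p.t + r))) :=
      ((isCompact_closedBall _ _).prod isCompact_Icc).image (logHomeo d).continuous
    refine hK.of_isClosed_subset Metric.isClosed_closedBall fun q hq => ?_
    rw [Metric.mem_closedBall] at hq
    have hp := p.pos
    have hq' := q.pos
    have h1 := (abs_le.1 ((abs_log_sub_log_le q p).trans hq))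
    refine ⟨(logHomeo d).symm q, ⟨?_, ?_, ?_⟩, by simp⟩
    · rw [Metric.mem_closedBall, dist_eq_norm]
      refine Real.le_sqrt_of_sq_le ?_
      change ‖q.x - p.x‖ ^ 2 ≤ _
      have h2 : q.t ≤ p.t * Real.exp r := by
        rw [← Real.exp_log hq', ← Real.exp_log hp, ← Real.exp_add]
        exact Real.exp_le_exp.2 (by linarith)
      have h3 : Real.cosh (dist q p) ≤ Real.cosh r :=
        Real.cosh_le_cosh.2 (abs_le_abs_of_nonneg dist_nonneg hq)
      have h4 := Real.one_le_cosh (dist q p)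
      rw [norm_sq_eq]
      have h5 : q.t * Real.cosh (dist q p) ≤ p.t * Real.exp r * Real.cosh r := by gcongr
      nlinarith [mul_pos hp hq', mul_le_mul_of_nonneg_left h5 hp.le, sq_nonneg (q.t - p.t)]
    · change _ ≤ Real.log q.t
      linarith [h1.1]
    · change Real.log q.t ≤ _
      linarith [h1.2]

end HSpace

/-! ### Signed permutations, dilations and translations as isometries -/

open _root_.Boroczky.HSpace

theorem unit_mul_self (s : ℤˣ) : ((s : ℤ) : ℝ) * ((s : ℤ) : ℝ) = 1 := by
  rcases Int.units_eq_one_or s with h | h <;> simp [h]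

theorem unit_sq (s : ℤˣ) : ((s : ℤ) : ℝ) ^ 2 = 1 := by
  rw [sq, unit_mul_self]

theorem abs_unit (s : ℤˣ) : |((s : ℤ) : ℝ)| = 1 := by
  rcases Int.units_eq_one_or s with h | h <;> simp [h]

theorem unit_cast_injective {s s' : ℤˣ} (h : ((s : ℤ) : ℝ) = ((s' : ℤ) : ℝ)) : s = s' := by
  exact Units.ext (by exact_mod_cast h)

/-- The isometry `(x, t) ↦ (2 ^ n • (s i * x (π i))ᵢ + c, 2 ^ n * t)`. -/
def stdIso (π : Equiv.Perm (Fin d)) (s : Fin d → ℤˣ) (c : Fin d → ℝ) (n : ℤ) :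
    HSpace d ≃ᵢ HSpace d :=
  IsometryEquiv.mk'
    (fun p => pt (fun i => 2 ^ n * (((s i : ℤ) : ℝ) * p.x (π i)) + c i) (2 ^ n * p.t)
      (mul_pos (by positivity) p.pos))
    (fun p => pt (fun i => (2 ^ n)⁻¹ * (((s (π.symm i) : ℤ) : ℝ) *
      (p.x (π.symm i) - c (π.symm i)))) ((2 ^ n)⁻¹ * p.t) (mul_pos (by positivity) p.pos))
    (fun p => by
      refine ext' (fun i => ?_) ?_
      · simp only [pt_x, Equiv.symm_apply_apply]
        have := unit_mul_self (s i)
        field_simp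
        linear_combination (p.x i - c i) * unit_mul_self (s i)
      · simp only [pt_t]
        field_simp)
    (by
      refine Isometry.of_dist_eq fun p q => dist_eq_dist_iff.2 ?_
      have hp := p.pos
      have hq := q.pos
      have h : ∀ i, (2 ^ n * (((s i : ℤ) : ℝ) * p.x (π i)) + c i -
          (2 ^ n * (((s i : ℤ) : ℝ) * q.x (π i)) + c i)) ^ 2 =
          ((2 : ℝ) ^ n) ^ 2 * (p.x (π i) - q.x (π i)) ^ 2 := fun i => by
        linear_combination ((2 : ℝ) ^ n) ^ 2 * (p.x (π i) - q.x (π i)) ^ 2 * unit_sq (s i)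
      simp only [dsq, pt_x, pt_t, h]
      rw [← Finset.mul_sum, Equiv.sum_comp π (fun i => (p.x i - q.x i) ^ 2)]
      field_simp)

section
variable (π : Equiv.Perm (Fin d)) (s : Fin d → ℤˣ) (c : Fin d → ℝ) (n : ℤ)

@[simp] theorem stdIso_x (p : HSpace d) (i : Fin d) :
    (stdIso π s c n p).x i = 2 ^ n * (((s i : ℤ) : ℝ) * p.x (π i)) + c i := rfl

@[simp] theorem stdIso_t (p : HSpace d) : (stdIso π s c n p).t = 2 ^ n * p.t := rfl

theorem stdIso_symm_x (p : HSpace d) (i : Fin d) :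
    ((stdIso π s c n).symm p).x i =
      (2 ^ n)⁻¹ * (((s (π.symm i) : ℤ) : ℝ) * (p.x (π.symm i) - c (π.symm i))) := rfl

theorem stdIso_symm_t (p : HSpace d) : ((stdIso π s c n).symm p).t = (2 ^ n)⁻¹ * p.t := rfl

theorem mem_image_iso {φ : HSpace d ≃ᵢ HSpace d} {A : Set (HSpace d)} {p : HSpace d} :
    p ∈ φ '' A ↔ φ.symm p ∈ A := by
  constructor
  · rintro ⟨q, hq, rfl⟩
    simpa using hq
  · intro h
    exact ⟨_, h, by simp⟩

end

theorem closed_prototile : IsClosed (prototile d) := by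
  have h1 := continuous_t (d := d)
  have h : prototile d = (⋂ i, {p : HSpace d | |p.x i| ≤ 1}) ∩ ({p | 1 ≤ p.t} ∩ {p | p.t ≤ 2}) := by
    ext p; simp [prototile]
  rw [h]
  refine (isClosed_iInter fun i => ?_).inter (IsClosed.inter ?_ ?_)
  · exact isClosed_le (continuous_coord i).abs continuous_const
  · exact isClosed_le continuous_const h1
  · exact isClosed_le h1 continuous_const

theorem mem_interior_prototile {p : HSpace d} (hx : ∀ i, |p.x i| < 1) (h1 : 1 < p.t) (h2 : p.t < 2)
    :
    p ∈ interior (prototile d) := by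
  have hc := continuous_t (d := d)
  have ho : IsOpen ((⋂ i, {p : HSpace d | |p.x i| < 1}) ∩ ({p | 1 < p.t} ∩ {p | p.t < 2})) := by
    refine (isOpen_iInter_of_finite fun i => ?_).inter (IsOpen.inter ?_ ?_)
    · exact isOpen_lt (continuous_coord i).abs continuous_const
    · exact isOpen_lt continuous_const hc
    · exact isOpen_lt hc continuous_const
  refine mem_interior.2 ⟨_, ?_, ho, ?_⟩
  · rintro q ⟨h, h1, h2⟩
    exact ⟨fun i => (Set.mem_iInter.1 h i).le, le_of_lt h1, le_of_lt h2⟩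
  · exact ⟨Set.mem_iInter.2 hx, h1, h2⟩

/-- The curves `δ ↦ (x + δ w, t exp (a δ))` are continuous, so that an open set contains both
sides of them. -/
theorem exists_pos_of_isOpen {U : Set (HSpace d)} (hU : IsOpen U) {p : HSpace d} (hp : p ∈ U)
    (w : Fin d → ℝ) (a : ℝ) :
    ∃ ε > 0, ∀ δ, |δ| < ε →
      pt (fun i => p.x i + δ * w i) (p.t * Real.exp (a * δ)) (mul_pos p.pos (Real.exp_pos _)) ∈ U
          := by
  have hc : Continuous fun δ : ℝ => logHomeo d (p.x + δ • WithLp.toLp 2 w, Real.log p.t + a * δ) :=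
      by
    have := (logHomeo d).continuous
    fun_prop
  have he : ∀ δ : ℝ, logHomeo d (p.x + δ • WithLp.toLp 2 w, Real.log p.t + a * δ) =
      pt (fun i => p.x i + δ * w i) (p.t * Real.exp (a * δ)) (mul_pos p.pos (Real.exp_pos _)) := by
    intro δ
    refine ext' (fun i => ?_) ?_
    · simp [logHomeo]
    · simp [logHomeo, Real.exp_add, Real.exp_log p.pos]
  have h0 : (fun δ : ℝ => logHomeo d (p.x + δ • WithLp.toLp 2 w, Real.log p.t + a * δ)) 0 = p := by
    refine ext' (fun i => ?_) ?_ <;> simp [logHomeo, Real.exp_log p.pos]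
  have hm : (fun δ : ℝ => logHomeo d (p.x + δ • WithLp.toLp 2 w, Real.log p.t + a * δ)) ⁻¹' U ∈
      𝓝 (0 : ℝ) := hc.continuousAt.preimage_mem_nhds (by
    have := hU.mem_nhds hp
    rwa [← h0] at this)
  obtain ⟨ε, hε, h⟩ := Metric.mem_nhds_iff.1 hm
  refine ⟨ε, hε, fun δ hδ => ?_⟩
  rw [← he]
  exact h (by simpa using hδ)

/-! ### Isometries that preserve the a-facet or the prototile -/

theorem sum_sub_single_sq (x : Fin d → ℝ) (i : Fin d) (a : ℝ) :
    ∑ j, (x j - (Pi.single i a : Fin d → ℝ) j) ^ 2 = ∑ j, x j ^ 2 - 2 * a * x i + a ^ 2 := by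
  have h : ∀ j, (x j - (Pi.single i a : Fin d → ℝ) j) ^ 2 =
      x j ^ 2 + (Pi.single i (a ^ 2 - 2 * a * x i) : Fin d → ℝ) j := by
    intro j
    by_cases hj : j = i
    · subst hj; simp; ring
    · simp [hj]
  simp only [h]
  rw [Finset.sum_add_distrib, Finset.sum_pi_single']
  simp; ring

theorem mem_facetA {p : HSpace d} : p ∈ facetA d ↔ (∀ i, |p.x i| ≤ 1) ∧ p.t = 2 := by
  constructor
  · rintro ⟨⟨h, _⟩, h2⟩; exact ⟨h, h2⟩
  · rintro ⟨h, h2⟩; exact ⟨⟨h, by rw [h2]; norm_num, h2.le⟩, h2⟩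

theorem abs_single_le {i j : Fin d} {a : ℝ} (ha : |a| ≤ 1) : |(Pi.single i a : Fin d → ℝ) j| ≤ 1 :=
    by
  by_cases h : j = i
  · subst h; simpa using ha
  · simp [h]

/-- A point is determined by its distances to the points of the lower facet. -/
theorem eq_of_dsq_facetA (hd : 0 < d) {p p' : HSpace d}
    (h : ∀ q ∈ facetA d, dsq p q = dsq p' q) : p = p' := by
  have ht := p.pos
  have ht' := p'.pos
  have key : ∀ i a, |a| ≤ 1 →
      (∑ j, p.x j ^ 2 - 2 * a * p.x i + a ^ 2 + (p.t - 2) ^ 2) * p'.t =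
      (∑ j, p'.x j ^ 2 - 2 * a * p'.x i + a ^ 2 + (p'.t - 2) ^ 2) * p.t := by
    intro i a ha
    have := h (pt (Pi.single i a) 2 two_pos) (mem_facetA.2 ⟨fun j => abs_single_le ha, rfl⟩)
    simp only [dsq, pt_x, pt_t, sum_sub_single_sq] at this
    rw [div_eq_div_iff (by positivity) (by positivity)] at this
    linarith
  -- The second difference of `key` in `a` isolates the heights; the first difference below then
  -- isolates the coordinate `i`.
  have ht2 : p.t = p'.t := by
    have h0 := key ⟨0, hd⟩ 0 (by simp)
    have h1 := key ⟨0, hd⟩ 1 (by simp)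
    have h2 := key ⟨0, hd⟩ (-1) (by simp)
    linarith
  refine ext' (fun i => ?_) ht2
  have h1 := key i 1 (by simp)
  have h2 := key i (-1) (by simp)
  rw [ht2] at h1 h2
  have : (p.x i - p'.x i) * p'.t = 0 := by linarith
  rcases mul_eq_zero.1 this with h | h
  · linarith
  · exact absurd h ht'.ne'

/-- The composition of `φ` with the inverse of `ψ` fixes the a-facet pointwise, hence preserves the
distances to its points, and these determine a point. -/
theorem iso_eq_of_facetA (hd : 0 < d) {φ ψ : HSpace d ≃ᵢ HSpace d}
    (h : ∀ q ∈ facetA d, φ q = ψ q) : φ = ψ := by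
  ext1 p
  refine ψ.symm.injective (eq_of_dsq_facetA hd fun q hq => ?_)
  have h1 : ψ.symm (φ q) = q := by rw [h q hq]; simp
  have h2 := dsq_isometry (ψ.symm.isometry.comp φ.isometry) p q
  simp only [Function.comp_apply, h1] at h2
  rw [h2]; simp

theorem sub_unit_sq (s s' : ℤˣ) :
    (((s : ℤ) : ℝ) - ((s' : ℤ) : ℝ)) ^ 2 = if s = s' then 0 else 4 := by
  rcases Int.units_eq_one_or s with h | h <;> rcases Int.units_eq_one_or s' with h' | h' <;>
    simp [h, h'] <;> norm_num

theorem unit_eq_neg_of_ne {s s' : ℤˣ} (h : s ≠ s') : s' = -s := by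
  rcases Int.units_eq_one_or s with h1 | h1 <;> rcases Int.units_eq_one_or s' with h' | h' <;>
    simp_all

/-- A map of the vertices of the cube that preserves distances comes from a signed permutation of
the coordinates. -/
theorem exists_signedPerm (τ : (Fin d → ℤˣ) → (Fin d → ℤˣ))
    (h : ∀ σ σ' : Fin d → ℤˣ, ∑ i, (((τ σ i : ℤ) : ℝ) - ((τ σ' i : ℤ) : ℝ)) ^ 2 =
      ∑ i, (((σ i : ℤ) : ℝ) - ((σ' i : ℤ) : ℝ)) ^ 2) :
    ∃ (π : Equiv.Perm (Fin d)) (s : Fin d → ℤˣ), ∀ u u' : Fin d → ℝ,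
      (∀ σ, ∑ i, ((τ σ i : ℤ) : ℝ) * u' i = ∑ i, ((σ i : ℤ) : ℝ) * u i) →
      ∀ i, u' i = ((s i : ℤ) : ℝ) * u (π i) := by
  classical
  -- The squared distance of two vertices is four times their Hamming distance, so `τ` preserves
  -- Hamming distances. In particular it maps the `d` neighbours `e i` of the all-one vertex to
  -- neighbours of its image.
  have hcard : ∀ σ σ' : Fin d → ℤˣ, (Finset.univ.filter fun i => τ σ i ≠ τ σ' i).card =
      (Finset.univ.filter fun i => σ i ≠ σ' i).card := by
    intro σ σ'
    have := h σ σ'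
    simp only [sub_unit_sq] at this
    rw [Finset.sum_ite, Finset.sum_ite] at this
    simp only [Finset.sum_const, nsmul_eq_mul] at this
    have h3 : ((Finset.univ.filter fun i => τ σ i ≠ τ σ' i).card : ℝ) =
      (Finset.univ.filter fun i => σ i ≠ σ' i).card := by
      simp only [ne_eq]
      linarith
    exact_mod_cast h3
  let e : Fin d → (Fin d → ℤˣ) := fun i => Function.update 1 i (-1)
  have he : ∀ i k, (1 : Fin d → ℤˣ) k ≠ e i k ↔ k = i := by
    intro i k
    by_cases hk : k = i
    · subst hk; simp [e]
    · simp [e, hk]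
  have h1 : ∀ i, ∃ j, ∀ k, τ 1 k ≠ τ (e i) k ↔ k = j := by
    intro i
    have hc := hcard 1 (e i)
    simp only [he] at hc
    rw [Finset.filter_eq' Finset.univ i, if_pos (Finset.mem_univ i), Finset.card_singleton,
      Finset.card_eq_one] at hc
    obtain ⟨j, hj⟩ := hc
    refine ⟨j, fun k => ?_⟩
    have := Finset.ext_iff.1 hj k
    simpa using this
  choose f hf using h1
  have hinj : Function.Injective f := by
    intro i i' hii
    have h2 : τ (e i) = τ (e i') := by
      funext k
      by_cases hk : k = f i
      · rw [unit_eq_neg_of_ne ((hf i k).2 hk), unit_eq_neg_of_ne ((hf i' k).2 (hii ▸ hk))]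
      · rw [← not_not.1 (mt (hf i k).1 hk), ← not_not.1 (mt (hf i' k).1 (hii ▸ hk))]
    have h3 := hcard (e i) (e i')
    rw [h2] at h3
    simp only [ne_eq, not_true_eq_false, Finset.filter_false, Finset.card_empty] at h3
    have h4 := Finset.filter_eq_empty_iff.1 (Finset.card_eq_zero.1 h3.symm) (Finset.mem_univ i)
    rw [not_not] at h4
    have h5 := (he i i).2 rfl
    rw [h4] at h5
    exact (he i' i).1 h5
  let π := Equiv.ofBijective f (Finite.injective_iff_bijective.1 hinj)
  refine ⟨π.symm, τ 1, fun u u' hu => ?_⟩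
  -- Subtracting the inner products with two neighbouring vertices isolates one coordinate. Only
  -- inner products are assumed to match, because that is what distances to antipodal vertices
  -- provide.
  have hsum : ∀ (σ σ' : Fin d → ℤˣ) (j : Fin d) (v : Fin d → ℝ), (∀ k, σ k ≠ σ' k ↔ k = j) →
      ∑ k, ((σ k : ℤ) : ℝ) * v k - ∑ k, ((σ' k : ℤ) : ℝ) * v k = 2 * ((σ j : ℤ) : ℝ) * v j := by
    intro σ σ' j v hj
    rw [← Finset.sum_sub_distrib, Finset.sum_eq_single j]
    · rw [unit_eq_neg_of_ne ((hj j).2 rfl)]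
      push_cast; ring
    · intro k _ hk
      rw [not_not.1 (mt (hj k).1 hk), sub_self]
    · simp
  have h6 : ∀ i, u' (f i) = ((τ 1 (f i) : ℤ) : ℝ) * u i := by
    intro i
    have h7 := hsum _ _ _ u' (hf i)
    have h8 := hsum _ _ _ u (he i)
    rw [hu, hu, h8] at h7
    simp only [Pi.one_apply, Units.val_one, Int.cast_one] at h7
    linear_combination (((τ 1 (f i) : ℤ) : ℝ) / 2) * (-h7) - u' (f i) * unit_sq (τ 1 (f i))
  intro i
  have := h6 (π.symm i)
  rwa [show f (π.symm i) = i from π.apply_symm_apply i] at this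

theorem sub_sq_le_four {a b : ℝ} (ha : |a| ≤ 1) (hb : |b| ≤ 1) : (a - b) ^ 2 ≤ 4 := by
  have := abs_le.1 ha
  have := abs_le.1 hb
  nlinarith

/-- Points of the cube at maximal distance are vertices. -/
theorem abs_eq_one_of_sum_sq {x y : Fin d → ℝ} (hx : ∀ i, |x i| ≤ 1) (hy : ∀ i, |y i| ≤ 1)
    (h : 4 * (d : ℝ) ≤ ∑ i, (x i - y i) ^ 2) (i : Fin d) : |x i| = 1 ∧ y i = -x i := by
  have h4 : ∑ i : Fin d, (4 - (x i - y i) ^ 2) ≤ 0 := by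
    rw [Finset.sum_sub_distrib]; simp; linarith
  have h5 : ∀ j ∈ Finset.univ, 0 ≤ 4 - (x j - y j) ^ 2 := fun j _ => by
    linarith [sub_sq_le_four (hx j) (hy j)]
  have h6 := (Finset.sum_eq_zero_iff_of_nonneg h5).1 (le_antisymm h4 (Finset.sum_nonneg h5)) i
    (Finset.mem_univ i)
  have hx' := abs_le.1 (hx i)
  have hy' := abs_le.1 (hy i)
  have h7 : (x i - y i - 2) * (x i - y i + 2) = 0 := by linarith
  rcases mul_eq_zero.1 h7 with h8 | h8
  · have e1 : x i = 1 := by linarith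
    have e2 : y i = -1 := by linarith
    simp [e1, e2]
  · have e1 : x i = -1 := by linarith
    have e2 : y i = 1 := by linarith
    simp [e1, e2]

theorem exists_unit_of_abs {x : Fin d → ℝ} (hx : ∀ i, |x i| = 1) :
    ∃ σ : Fin d → ℤˣ, ∀ i, x i = ((σ i : ℤ) : ℝ) := by
  have : ∀ i, ∃ s : ℤˣ, x i = ((s : ℤ) : ℝ) := by
    intro i
    rcases (abs_eq one_pos.le).1 (hx i) with h | h
    · exact ⟨1, by simp [h]⟩
    · exact ⟨-1, by simp [h]⟩
  exact ⟨fun i => (this i).choose, fun i => (this i).choose_spec⟩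

theorem sum_unit_sub_neg_sq (σ : Fin d → ℤˣ) :
    ∑ i, (((σ i : ℤ) : ℝ) - (((-σ) i : ℤ) : ℝ)) ^ 2 = 4 * d := by
  have : ∀ i, (((σ i : ℤ) : ℝ) - (((-σ) i : ℤ) : ℝ)) ^ 2 = 4 := fun i => by
    simp only [Pi.neg_apply, Units.val_neg, Int.cast_neg]
    linear_combination 4 * unit_sq (σ i)
  simp only [this]
  simp [mul_comm]

theorem sum_sub_unit_sq (x : Fin d → ℝ) (σ : Fin d → ℤˣ) :
    ∑ i, (x i - ((σ i : ℤ) : ℝ)) ^ 2 = ∑ i, x i ^ 2 + d - 2 * ∑ i, ((σ i : ℤ) : ℝ) * x i := by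
  have : ∀ i, (x i - ((σ i : ℤ) : ℝ)) ^ 2 = x i ^ 2 + 1 - 2 * (((σ i : ℤ) : ℝ) * x i) := fun i => by
    linear_combination unit_sq (σ i)
  simp only [this, Finset.sum_sub_distrib, Finset.sum_add_distrib, ← Finset.mul_sum]
  simp

theorem sum_neg_unit (x : Fin d → ℝ) (σ : Fin d → ℤˣ) :
    ∑ i, (((-σ) i : ℤ) : ℝ) * x i = -∑ i, ((σ i : ℤ) : ℝ) * x i := by
  simp

/-- An isometry that maps the cube `{t = 2}` of the prototile onto itself is a signed permutation
of the coordinates. -/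
theorem eq_stdIso_of_facetA (hd : 0 < d) {ψ : HSpace d ≃ᵢ HSpace d}
    (h : ψ '' facetA d = facetA d) : ∃ π s, ψ = stdIso π s 0 0 := by
  let V : (Fin d → ℤˣ) → HSpace d := fun σ => pt (fun i => ((σ i : ℤ) : ℝ)) 2 two_pos
  have hV : ∀ σ, V σ ∈ facetA d := fun σ => mem_facetA.2 ⟨fun i => (abs_unit _).le, rfl⟩
  have hm : ∀ p ∈ facetA d, ψ p ∈ facetA d := fun p hp => h ▸ Set.mem_image_of_mem ψ hp
  have hdist : ∀ p ∈ facetA d, ∀ q ∈ facetA d,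
      ∑ i, ((ψ p).x i - (ψ q).x i) ^ 2 = ∑ i, (p.x i - q.x i) ^ 2 := by
    intro p hp q hq
    have := dsq_isometry ψ.isometry p q
    simp only [dsq, (mem_facetA.1 hp).2, (mem_facetA.1 hq).2, (mem_facetA.1 (hm p hp)).2,
      (mem_facetA.1 (hm q hq)).2] at this
    linarith
  -- Antipodal vertices realise the diameter of the cube, so their images are again antipodal
  -- vertices.
  have hτ : ∀ σ, ∃ σ' : Fin d → ℤˣ, (∀ i, (ψ (V σ)).x i = ((σ' i : ℤ) : ℝ)) ∧
      ∀ i, (ψ (V (-σ))).x i = -((σ' i : ℤ) : ℝ) := by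
    intro σ
    have h1 := abs_eq_one_of_sum_sq (mem_facetA.1 (hm _ (hV σ))).1 (mem_facetA.1 (hm _ (hV (-σ)))).1
      (by rw [hdist _ (hV σ) _ (hV (-σ))]; exact (sum_unit_sub_neg_sq σ).ge)
    obtain ⟨σ', h2⟩ := exists_unit_of_abs fun i => (h1 i).1
    exact ⟨σ', h2, fun i => by rw [(h1 i).2, h2]⟩
  choose τ hτ1 hτ2 using hτ
  obtain ⟨π, s, hs⟩ := exists_signedPerm τ fun σ σ' => by
    have := hdist _ (hV σ) _ (hV σ')
    simp only [hτ1] at this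
    exact this
  refine ⟨π, s, iso_eq_of_facetA hd fun p hp => ext' ?_ ?_⟩
  · have := hs (fun i => p.x i) (fun i => (ψ p).x i) fun σ => ?_
    · intro i; simpa using this i
    · have h1 := hdist p hp _ (hV σ)
      have h2 := hdist p hp _ (hV (-σ))
      have h3 : ∀ i, (ψ (V (-σ))).x i = (((-τ σ) i : ℤ) : ℝ) := fun i => by simp [hτ2]
      simp only [hτ1, V, pt_x, sum_sub_unit_sq] at h1
      simp only [h3, V, pt_x, sum_sub_unit_sq, sum_neg_unit] at h2
      linarith
  · rw [(mem_facetA.1 (hm p hp)).2]; simp [(mem_facetA.1 hp).2]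

/-- A map of the prototile onto itself that preserves distances is a signed permutation of the
coordinates. -/
theorem stabilizer_prototile (hd : 0 < d) (f : HSpace d → HSpace d)
    (hf : ∀ p ∈ prototile d, ∀ q ∈ prototile d, dsq (f p) (f q) = dsq p q)
    (hm : ∀ p ∈ prototile d, f p ∈ prototile d) :
    ∃ (π : Equiv.Perm (Fin d)) (s : Fin d → ℤˣ), ∀ p ∈ prototile d,
      (∀ i, (f p).x i = ((s i : ℤ) : ℝ) * p.x (π i)) ∧ (f p).t = p.t := by
  have hd1 : (1 : ℝ) ≤ d := by exact_mod_cast hd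
  -- The maximum `4 * d` of `dsq` is attained only at height 1: raising the points gains at most
  -- `(p.t - 1) + (q.t - 1)` in the numerator but costs at least `4 * d` times as much through the
  -- denominator.
  have hdiam : ∀ p ∈ prototile d, ∀ q ∈ prototile d, 4 * (d : ℝ) ≤ dsq p q →
      p.t = 1 ∧ (4 * (d : ℝ) ≤ ∑ i, (p.x i - q.x i) ^ 2) := by
    intro p hp q hq h
    have h1 : ∑ i, (p.x i - q.x i) ^ 2 ≤ 4 * d := by
      calc ∑ i, (p.x i - q.x i) ^ 2 ≤ ∑ _i : Fin d, (4 : ℝ) :=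
            Finset.sum_le_sum fun i _ => sub_sq_le_four (hp.1 i) (hq.1 i)
        _ = 4 * d := by simp [mul_comm]
    obtain ⟨_, hp1, hp2⟩ := hp
    obtain ⟨_, hq1, hq2⟩ := hq
    rw [dsq, le_div_iff₀ (mul_pos p.pos q.pos)] at h
    generalize ∑ i, (p.x i - q.x i) ^ 2 = S at *
    have h3 : (p.t - q.t) ^ 2 ≤ (p.t - 1) + (q.t - 1) := by
      nlinarith [mul_nonneg (sub_nonneg.2 hp1) (sub_nonneg.2 hq1)]
    have h4 : 4 * (d : ℝ) * ((p.t - 1) + (q.t - 1)) ≤ 4 * d * (p.t * q.t - 1) := by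
      refine mul_le_mul_of_nonneg_left ?_ (by positivity)
      nlinarith [mul_nonneg (sub_nonneg.2 hp1) (sub_nonneg.2 hq1)]
    have h5 : p.t - 1 + (q.t - 1) ≤ 0 := by
      nlinarith
    have e1 : p.t = 1 := by linarith
    have e2 : q.t = 1 := by linarith
    rw [e1, e2] at h
    exact ⟨e1, by linarith⟩
  let V : (Fin d → ℤˣ) → HSpace d := fun σ => pt (fun i => ((σ i : ℤ) : ℝ)) 1 one_pos
  have hV : ∀ σ, V σ ∈ prototile d := fun σ =>
    ⟨fun i => (abs_unit _).le, le_refl (1 : ℝ), by simp [V]⟩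
  have hτ : ∀ σ, (∃ σ' : Fin d → ℤˣ, (∀ i, (f (V σ)).x i = ((σ' i : ℤ) : ℝ)) ∧
      ∀ i, (f (V (-σ))).x i = -((σ' i : ℤ) : ℝ)) ∧ (f (V σ)).t = 1 := by
    intro σ
    obtain ⟨ht, h0⟩ := hdiam _ (hm _ (hV σ)) _ (hm _ (hV (-σ))) (by
      rw [hf _ (hV σ) _ (hV (-σ)), dsq]
      simp only [V, pt_x, pt_t, sum_unit_sub_neg_sq]
      norm_num)
    have h1 := abs_eq_one_of_sum_sq (hm _ (hV σ)).1 (hm _ (hV (-σ))).1 h0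
    obtain ⟨σ', h2⟩ := exists_unit_of_abs fun i => (h1 i).1
    exact ⟨⟨σ', h2, fun i => by rw [(h1 i).2, h2]⟩, ht⟩
  choose hτ ht1 using hτ
  choose τ hτ1 hτ2 using hτ
  have hτ3 : ∀ σ i, (f (V (-σ))).x i = (((-τ σ) i : ℤ) : ℝ) := fun σ i => by simp [hτ2]
  obtain ⟨π, s, hs⟩ := exists_signedPerm τ fun σ σ' => by
    have := hf _ (hV σ) _ (hV σ')
    simp only [dsq, hτ1, ht1] at this
    simpa [V] using this
  -- the coordinates `x i / t` are permuted, and a function of the norm of `x` and `t` is invariant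
  have hinv : ∀ p ∈ prototile d,
      (∀ i, (f p).x i / (f p).t = ((s i : ℤ) : ℝ) * (p.x (π i) / p.t)) ∧
      (∑ i, (f p).x i ^ 2 + d + (f p).t ^ 2 + 1) / (f p).t =
      (∑ i, p.x i ^ 2 + d + p.t ^ 2 + 1) / p.t := by
    intro p hp
    have hp0 := p.pos
    have hfp0 := (f p).pos
    have hsum : ∀ σ, (∑ i, (f p).x i ^ 2 + d - 2 * ∑ i, ((τ σ i : ℤ) : ℝ) * (f p).x i +
          ((f p).t - 1) ^ 2) / (f p).t =
        (∑ i, p.x i ^ 2 + d - 2 * ∑ i, ((σ i : ℤ) : ℝ) * p.x i + (p.t - 1) ^ 2) / p.t ∧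
        (∑ i, (f p).x i ^ 2 + d + 2 * ∑ i, ((τ σ i : ℤ) : ℝ) * (f p).x i +
          ((f p).t - 1) ^ 2) / (f p).t =
        (∑ i, p.x i ^ 2 + d + 2 * ∑ i, ((σ i : ℤ) : ℝ) * p.x i + (p.t - 1) ^ 2) / p.t := by
      intro σ
      have h1 := hf p hp _ (hV σ)
      have h2 := hf p hp _ (hV (-σ))
      simp only [dsq, hτ1, ht1, V, pt_x, pt_t, sum_sub_unit_sq, mul_one] at h1
      simp only [dsq, hτ3, ht1, V, pt_x, pt_t, sum_sub_unit_sq, sum_neg_unit, mul_one, mul_neg,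
        sub_neg_eq_add] at h2
      constructor
      · exact h1
      · exact h2
    constructor
    · refine hs (fun i => p.x i / p.t) (fun i => (f p).x i / (f p).t) fun σ => ?_
      obtain ⟨h1, h2⟩ := hsum σ
      simp only [← mul_div_assoc, ← Finset.sum_div]
      rw [div_eq_div_iff hfp0.ne' hp0.ne'] at h1 h2 ⊢
      linarith
    · obtain ⟨h1, h2⟩ := hsum 1
      rw [div_eq_div_iff hfp0.ne' hp0.ne'] at h1 h2 ⊢
      linarith
  have hr : ∀ p ∈ prototile d, (∑ i, (f p).x i ^ 2) / (f p).t ^ 2 = (∑ i, p.x i ^ 2) / p.t ^ 2 := by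
    intro p hp
    have h1 := (hinv p hp).1
    simp only [Finset.sum_div, ← div_pow, h1, mul_pow, unit_sq, one_mul]
    exact Equiv.sum_comp π (fun i => (p.x i / p.t) ^ 2)
  -- The second alternative is the height after inversion in the sphere with centre `0` and squared
  -- radius `d + 1`, which contains all vertices at height 1; distances to these vertices cannot
  -- exclude it.
  have halt : ∀ p ∈ prototile d, (f p).t = p.t ∨
      (∑ i, p.x i ^ 2 + p.t ^ 2) * (f p).t = p.t * (d + 1) := by
    intro p hp
    have hp0 := p.pos
    have hfp0 := (f p).pos
    have h1 := (hinv p hp).2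
    have h2 := hr p hp
    rw [div_eq_div_iff (by positivity) (by positivity)] at h1 h2
    generalize ∑ i, (f p).x i ^ 2 = R' at *
    generalize ∑ i, p.x i ^ 2 = R at *
    have : ((f p).t - p.t) * ((R + p.t ^ 2) * (f p).t - p.t * (d + 1)) = 0 := by
      have h3 : R' = R * (f p).t ^ 2 / p.t ^ 2 := by
        field_simp; linarith
      rw [h3] at h1
      field_simp at h1
      linear_combination h1
    rcases mul_eq_zero.1 this with h | h
    · left; linarith
    · right; linarith
  let O : HSpace d := pt (fun _ => 0) 1 one_pos
  have hO : O ∈ prototile d := ⟨by simp [O], by simp [O], by simp [O]⟩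
  have hOx : ∀ i, (f O).x i = 0 := by
    intro i
    have h1 := (hinv O hO).1 i
    simp only [O, pt_x, zero_div, mul_zero, div_eq_zero_iff] at h1
    exact h1.resolve_right (f O).pos.ne'
  have hOt : (f O).t = 1 := by
    rcases halt O hO with h | h
    · exact h
    -- Inversion would lift `O` to height `d + 1`, which is possible only for `d = 1`. In that case
    -- the corner `Q` at height 2 cannot be inverted within the prototile, so its height is
    -- preserved, and its distance to `O` gives a contradiction.
    · simp only [O, pt_x, pt_t] at h
      have h2 := (hm O hO).2.2
      simp only [O] at h2
      have hd2 : (d : ℝ) = 1 := by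
        simp at h; linarith
      have hd3 : d = 1 := by exact_mod_cast hd2
      subst hd3
      exfalso
      simp at h
      let Q : HSpace 1 := pt (fun _ => 1) 2 two_pos
      have hQ : Q ∈ prototile 1 := ⟨by simp [Q], by simp [Q], by simp [Q]⟩
      have hQ1 := (hm Q hQ).2.1
      have hQt : (f Q).t = 2 := by
        rcases halt Q hQ with h5 | h5
        · exact h5
        · simp [Q] at h5 hQ1
          linarith
      have h6 := hf Q hQ O hO
      have h7 := hr Q hQ
      simp only [dsq, hQt, hOx] at h6 h7
      simp [Q, O] at h6 h7
      simp [Q] at hQt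
      rw [h] at h6
      have h8 : (f (pt (fun _ => 1) 2 two_pos)).x 0 ^ 2 = 1 := by
        field_simp at h7; linarith
      rw [h8] at h6
      norm_num at h6
  refine ⟨π, s, fun p hp => ?_⟩
  have hp0 := p.pos
  have hfp0 := (f p).pos
  -- The invariant in `hinv` and the distance to `O`, whose image is now `O` itself, differ by `d`
  -- divided by the height, up to a constant.
  have ht : (f p).t = p.t := by
    have h1 := hf p hp O hO
    have h2 := (hinv p hp).2
    simp only [dsq, hOx, hOt] at h1
    simp only [O, pt_x, pt_t, sub_zero, mul_one] at h1
    rw [div_eq_div_iff hfp0.ne' hp0.ne'] at h1 h2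
    have : (d : ℝ) * ((f p).t - p.t) = 0 := by linarith
    rcases mul_eq_zero.1 this with h | h
    · linarith
    · linarith
  refine ⟨fun i => ?_, ht⟩
  have h1 := (hinv p hp).1 i
  rw [ht] at h1
  field_simp at h1
  linarith

theorem facetA_subset : facetA d ⊆ prototile d := fun _ h => h.1

theorem eq_stdIso_of_prototile (hd : 0 < d) {φ : HSpace d ≃ᵢ HSpace d}
    (h : φ '' prototile d = prototile d) : ∃ π s, φ = stdIso π s 0 0 := by
  obtain ⟨π, s, hs⟩ := stabilizer_prototile hd φ (fun p _ q _ => dsq_isometry φ.isometry p q)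
    (fun p hp => h ▸ Set.mem_image_of_mem φ hp)
  refine ⟨π, s, iso_eq_of_facetA hd fun q hq => ?_⟩
  obtain ⟨h1, h2⟩ := hs q (facetA_subset hq)
  exact ext' (fun i => by simp [h1]) (by simp [h2])

/-! ### Reflections in vertical hyperplanes -/

@[simp] theorem isometryEquiv_refl_apply (p : HSpace d) :
    IsometryEquiv.refl (HSpace d) p = p := rfl

/-- The reflection in the hyperplane `x i = c`. -/
def refl (i : Fin d) (c : ℝ) : HSpace d ≃ᵢ HSpace d :=
  stdIso 1 (Function.update 1 i (-1)) (Pi.single i (2 * c)) 0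

theorem refl_x_self (i : Fin d) (c : ℝ) (p : HSpace d) : (refl i c p).x i = 2 * c - p.x i := by
  simp [refl]; ring

theorem refl_x_of_ne {i j : Fin d} (h : j ≠ i) (c : ℝ) (p : HSpace d) :
    (refl i c p).x j = p.x j := by
  simp [refl, h]

@[simp] theorem refl_t (i : Fin d) (c : ℝ) (p : HSpace d) : (refl i c p).t = p.t := by
  simp [refl]

theorem refl_eq_self_iff {i : Fin d} {c : ℝ} {p : HSpace d} : refl i c p = p ↔ p.x i = c := by
  constructor
  · intro h
    have := refl_x_self i c p
    rw [h] at this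
    linarith
  · intro h
    refine ext' (fun j => ?_) (refl_t _ _ _)
    by_cases hj : j = i
    · subst hj; rw [refl_x_self, h]; ring
    · exact refl_x_of_ne hj c p

theorem refl_ne_id (i : Fin d) (c : ℝ) : refl i c ≠ IsometryEquiv.refl _ := by
  intro h
  have h1 := refl_eq_self_iff (i := i) (c := c) (p := pt (fun _ => c + 1) 1 one_pos)
  rw [h] at h1
  have := h1.1 rfl
  simp at this

theorem sum_sub_single_add_single_sq (x : Fin d → ℝ) {i j : Fin d} (hij : j ≠ i) (c a : ℝ) :
    ∑ k, (x k - ((Pi.single i c : Fin d → ℝ) k + (Pi.single j a : Fin d → ℝ) k)) ^ 2 =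
      ∑ k, (x k - (Pi.single i c : Fin d → ℝ) k) ^ 2 - 2 * a * x j + a ^ 2 := by
  have := sum_sub_single_sq (fun k => x k - (Pi.single i c : Fin d → ℝ) k) j a
  simp only [sub_sub, Pi.single_eq_of_ne hij, sub_zero] at this
  exact this

/-- Points with the same distances to the points of an aside facet coincide or are mirror images. -/
theorem eq_or_eq_refl_of_dsq {i : Fin d} {ε : ℤˣ} {p p' : HSpace d}
    (h : ∀ q ∈ facetC i ε, dsq p q = dsq p' q) : p' = p ∨ p' = refl i ((ε : ℤ) : ℝ) p := by
  set c : ℝ := ((ε : ℤ) : ℝ) with hc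
  have hp := p.pos
  have hp' := p'.pos
  have habs : |c| = 1 := abs_unit ε
  -- Two test points on one vertical line determine the height and the distance from that line; the
  -- points of `h3`, displaced in direction `j`, then give the coordinate `j`.
  have h1 := h (pt (Pi.single i c) 1 one_pos)
      ⟨⟨fun j => abs_single_le habs.le, by simp, by simp⟩, by simp [hc]⟩
  have h2 := h (pt (Pi.single i c) 2 two_pos)
      ⟨⟨fun j => abs_single_le habs.le, by simp, by simp⟩, by simp [hc]⟩
  have h3 : ∀ j, j ≠ i → dsq p
      (pt (fun k => (Pi.single i c : Fin d → ℝ) k + (Pi.single j 1 : Fin d → ℝ) k) 1 one_pos) =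
      dsq p' (pt (fun k => (Pi.single i c : Fin d → ℝ) k + (Pi.single j 1 : Fin d → ℝ) k) 1
          one_pos) := by
    intro j hj
    refine h _ ⟨⟨fun k => ?_, by simp, by simp⟩, ?_⟩
    · by_cases hk : k = i
      · subst hk; simp [hj.symm, habs]
      · simp only [pt_x, Pi.single_eq_of_ne hk, zero_add]
        exact abs_single_le (by simp)
    · simp [hj.symm, hc]
  simp only [dsq, pt_x, pt_t] at h1 h2
  rw [div_eq_div_iff (by positivity) (by positivity)] at h1 h2
  have ht : p'.t = p.t := by linarith
  rw [ht] at h1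
  have hN := mul_right_cancel₀ (by positivity) h1
  have hx : ∀ j, j ≠ i → p'.x j = p.x j := by
    intro j hj
    have h4 := h3 j hj
    simp only [dsq, pt_x, pt_t, sum_sub_single_add_single_sq _ hj] at h4
    rw [ht, div_left_inj' (by positivity)] at h4
    linarith
  rw [← Finset.add_sum_erase _ _ (Finset.mem_univ i), ← Finset.add_sum_erase _
      (fun k => (p'.x k - _) ^ 2) (Finset.mem_univ i),
    Finset.sum_congr rfl fun k hk => by rw [← hx k (Finset.ne_of_mem_erase hk)]] at hN
  simp only [Pi.single_eq_same] at hN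
  have h5 : (p'.x i - p.x i) * (p'.x i - (2 * c - p.x i)) = 0 := by linarith
  rcases mul_eq_zero.1 h5 with h6 | h6
  · left
    refine ext' (fun j => ?_) ht
    by_cases hj : j = i
    · subst hj; linarith
    · exact hx j hj
  · right
    refine ext' (fun j => ?_) (by simp [ht])
    by_cases hj : j = i
    · subst hj; rw [refl_x_self]; linarith
    · rw [refl_x_of_ne hj, hx j hj]

/-- Each point is either fixed or mirrored, and the choice is uniform: if `p₀` is mirrored and not
fixed, then a fixed point is equidistant from `p₀` and its mirror image, hence lies in the
hyperplane, where both alternatives agree. -/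
theorem eq_id_or_eq_refl {i : Fin d} {ε : ℤˣ} {κ : HSpace d ≃ᵢ HSpace d}
    (h : ∀ q ∈ facetC i ε, κ q = q) :
    κ = IsometryEquiv.refl _ ∨ κ = refl i ((ε : ℤ) : ℝ) := by
  have h1 : ∀ p, κ p = p ∨ κ p = refl i ((ε : ℤ) : ℝ) p := fun p =>
    eq_or_eq_refl_of_dsq fun q hq => by
      conv_rhs => rw [← h q hq, dsq_isometry κ.isometry]
  by_cases hk : ∀ p, κ p = p
  · left; ext1 p; exact hk p
  · right
    push Not at hk
    obtain ⟨p₀, hp₀⟩ := hk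
    have h2 := (h1 p₀).resolve_left hp₀
    ext1 p
    rcases h1 p with h3 | h3
    · have h4 := dsq_isometry κ.isometry p p₀
      have hp := p.pos
      have hpp := p₀.pos
      rw [h3, h2, dsq, dsq, refl_t, div_left_inj' (by positivity)] at h4
      rw [← Finset.add_sum_erase _ _ (Finset.mem_univ i), ← Finset.add_sum_erase _
          (fun k => (p.x k - p₀.x k) ^ 2) (Finset.mem_univ i),
        Finset.sum_congr rfl fun k hk => by rw [refl_x_of_ne (Finset.ne_of_mem_erase hk)],
            refl_x_self] at h4
      have h5 : p₀.x i - ((ε : ℤ) : ℝ) ≠ 0 := by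
        intro h6
        exact hp₀ (h2.trans (refl_eq_self_iff.2 (by linarith)))
      have h6 : (p₀.x i - ((ε : ℤ) : ℝ)) * (p.x i - ((ε : ℤ) : ℝ)) = 0 := by linarith
      have h7 := (mul_eq_zero.1 h6).resolve_left h5
      rw [h3, refl_eq_self_iff.2 (by linarith)]
    · exact h3

/-! ### Recognising faces and the tiles across them -/

/-- The similarity that maps the prototile to its neighbour below the upper facet `facetB σ`. -/
def down (σ : Fin d → ℤˣ) : HSpace d ≃ᵢ HSpace d :=
  stdIso 1 1 (fun i => ((σ i : ℤ) : ℝ) / 2) (-1)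

theorem down_x (σ : Fin d → ℤˣ) (p : HSpace d) (i : Fin d) :
    (down σ p).x i = (p.x i + ((σ i : ℤ) : ℝ)) / 2 := by
  simp [down]; ring

theorem down_t (σ : Fin d → ℤˣ) (p : HSpace d) : (down σ p).t = p.t / 2 := by
  simp [down]; ring

theorem down_symm_x (σ : Fin d → ℤˣ) (p : HSpace d) (i : Fin d) :
    ((down σ).symm p).x i = 2 * p.x i - ((σ i : ℤ) : ℝ) := by
  rw [down, stdIso_symm_x]
  simp only [show (1 : Equiv.Perm (Fin d)).symm = 1 from rfl, Equiv.Perm.one_apply, Pi.one_apply,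
      Units.val_one, Int.cast_one,
    one_mul, zpow_neg, zpow_one, inv_inv]
  ring

theorem down_symm_t (σ : Fin d → ℤˣ) (p : HSpace d) : ((down σ).symm p).t = 2 * p.t := by
  rw [down, stdIso_symm_t]; simp

theorem mem_facetB {p : HSpace d} {σ : Fin d → ℤˣ} : p ∈ facetB σ ↔
    (∀ i, |p.x i| ≤ 1 ∧ 0 ≤ p.x i * ((σ i : ℤ) : ℝ)) ∧ p.t = 1 := by
  constructor
  · rintro ⟨⟨h, _⟩, h2, h3⟩
    exact ⟨fun i => ⟨h i, h3 i⟩, h2⟩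
  · rintro ⟨h, h2⟩
    exact ⟨⟨fun i => (h i).1, h2.ge, by rw [h2]; norm_num⟩, h2, fun i => (h i).2⟩

theorem down_facetA (σ : Fin d → ℤˣ) : down σ '' facetA d = facetB σ := by
  ext p
  rw [mem_image_iso, mem_facetA, mem_facetB, down_symm_t]
  refine and_congr (forall_congr' fun i => ?_) ⟨fun h => by linarith, fun h => by linarith⟩
  rw [down_symm_x]
  rcases Int.units_eq_one_or (σ i) with h | h <;> simp only [h, abs_le] <;> push_cast <;>
    constructor
  · rintro ⟨h1, h2⟩; exact ⟨⟨by linarith, by linarith⟩, by linarith⟩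
  · rintro ⟨⟨h1, h2⟩, h3⟩; exact ⟨by linarith, by linarith⟩
  · rintro ⟨h1, h2⟩; exact ⟨⟨by linarith, by linarith⟩, by linarith⟩
  · rintro ⟨⟨h1, h2⟩, h3⟩; exact ⟨by linarith, by linarith⟩

/-- The only isometry that fixes the set `K` pointwise is the identity. -/
def Rigid (K : Set (HSpace d)) : Prop :=
  ∀ κ : HSpace d ≃ᵢ HSpace d, (∀ q ∈ K, κ q = q) → κ = IsometryEquiv.refl _

theorem Rigid.of_image {K : Set (HSpace d)} {ψ : HSpace d ≃ᵢ HSpace d} (h : Rigid (ψ '' K)) :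
    Rigid K := by
  intro κ hκ
  have h1 := h ((ψ.symm.trans κ).trans ψ) (by rintro _ ⟨q, hq, rfl⟩; simp [hκ q hq])
  ext1 p
  have h2 := DFunLike.congr_fun h1 (ψ p)
  simpa using h2

theorem Rigid.image {K : Set (HSpace d)} (h : Rigid K) (ψ : HSpace d ≃ᵢ HSpace d) :
    Rigid (ψ '' K) := by
  refine Rigid.of_image (ψ := ψ.symm) ?_
  rwa [← Set.image_comp, show ⇑ψ.symm ∘ ⇑ψ = id from funext fun p => by simp, Set.image_id]

theorem rigid_facetA (hd : 0 < d) : Rigid (facetA d) := fun _ h => iso_eq_of_facetA hd h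

theorem rigid_facetB (hd : 0 < d) (σ : Fin d → ℤˣ) : Rigid (facetB σ) :=
  down_facetA σ ▸ (rigid_facetA hd).image _

theorem eq_of_sInter {F H : Set (HSpace d)} {S : Set (Set (HSpace d))} (hS : S.Nonempty)
    (hF : F = ⋂₀ S) (h : ∀ G ∈ S, G = H) : F = H := by
  rw [hF, (Set.eq_singleton_iff_nonempty_unique_mem.2 ⟨hS, h⟩), Set.sInter_singleton]

/-- Any other face lies in a vertical hyperplane and is therefore fixed by a reflection: either it
is contained in a c-facet, or in two b-facets whose signs differ in some coordinate `i`, which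
forces `x i = 0`. The a-facet meets no b-facet. -/
theorem Rigid.horospheric {G : Set (HSpace d)} (h : Rigid G) (hG : IsProtoFace G) :
    G = facetA d ∨ ∃ σ, G = facetB σ := by
  obtain ⟨⟨p, hp⟩, S, hS, hSf, hGS⟩ := hG
  have hsub : ∀ H ∈ S, G ⊆ H := fun H hH => hGS ▸ Set.sInter_subset_of_mem hH
  have hflat : ∀ i c, ¬ ∀ q ∈ G, q.x i = c := fun i c hq =>
    refl_ne_id i c (h _ fun q hq' => refl_eq_self_iff.2 (hq q hq'))
  have hC : ∀ i ε, facetC i ε ∉ S := fun i ε hH =>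
    hflat i _ fun q hq => (hsub _ hH hq).2
  by_cases hA : facetA d ∈ S
  · left
    refine eq_of_sInter hS hGS fun H hH => ?_
    rcases hSf H hH with rfl | ⟨σ, rfl⟩ | ⟨i, ε, rfl⟩
    · rfl
    · have h1 := (mem_facetB.1 (hsub _ hH hp)).2
      have h2 := (mem_facetA.1 (hsub _ hA hp)).2
      linarith
    · exact absurd hH (hC _ _)
  · right
    obtain ⟨H, hH⟩ := id hS
    rcases hSf H hH with rfl | ⟨σ, rfl⟩ | ⟨i, ε, rfl⟩
    · exact absurd hH hA
    · refine ⟨σ, eq_of_sInter hS hGS fun H' hH' => ?_⟩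
      rcases hSf H' hH' with rfl | ⟨σ', rfl⟩ | ⟨i, ε, rfl⟩
      · exact absurd hH' hA
      · by_contra hne
        have : ∃ i, σ i ≠ σ' i := by
          by_contra hcon
          push Not at hcon
          exact hne (by rw [funext hcon])
        obtain ⟨i, hi⟩ := this
        refine hflat i 0 fun q hq => ?_
        have h1 := ((mem_facetB.1 (hsub _ hH hq)).1 i).2
        have h2 := ((mem_facetB.1 (hsub _ hH' hq)).1 i).2
        rw [unit_eq_neg_of_ne hi] at h2
        rcases Int.units_eq_one_or (σ i) with h3 | h3 <;> rw [h3] at h1 h2 <;>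
          push_cast at h1 h2 <;> linarith
      · exact absurd hH' (hC _ _)
    · exact absurd hH (hC _ _)

/-- A horosphere contains no point together with two points of which it is the midpoint. -/
theorem image_facetC_not_horospheric {i : Fin d} {ε : ℤˣ} {ψ : HSpace d ≃ᵢ HSpace d} {h : ℝ}
    {G : Set (HSpace d)} (hG : ψ '' G = facetC i ε) : ¬ ∀ q ∈ G, q.t = h := by
  intro hh
  -- The heights `1`, `6 / 5`, `36 / 25` are in geometric progression, so the second point is the
  -- midpoint of the others. On a horosphere `dsq` is a multiple of the squared Euclidean distance,
  -- so `121 / 900` would be at most `4 * (1 / 30) = 120 / 900`.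
  have hmem : ∀ t (ht : 0 < t), 1 ≤ t → t ≤ 2 →
      ψ.symm (pt (Pi.single i ((ε : ℤ) : ℝ)) t ht) ∈ G := by
    intro t ht h1 h2
    rw [← mem_image_iso, hG]
    exact ⟨⟨fun j => abs_single_le (abs_unit ε).le, h1, h2⟩, by simp⟩
  have hd : ∀ p q : HSpace d, dsq (ψ.symm p) (ψ.symm q) = dsq p q := dsq_isometry ψ.symm.isometry
  have e1 := hmem 1 (by norm_num) (by norm_num) (by norm_num)
  have e2 := hmem (6 / 5) (by norm_num) (by norm_num) (by norm_num)
  have e3 := hmem (36 / 25) (by norm_num) (by norm_num) (by norm_num)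
  have d12 := hd (pt (Pi.single i ((ε : ℤ) : ℝ)) 1 (by norm_num))
      (pt (Pi.single i ((ε : ℤ) : ℝ)) (6 / 5) (by norm_num))
  have d23 := hd (pt (Pi.single i ((ε : ℤ) : ℝ)) (6 / 5) (by norm_num))
      (pt (Pi.single i ((ε : ℤ) : ℝ)) (36 / 25) (by norm_num))
  have d13 := hd (pt (Pi.single i ((ε : ℤ) : ℝ)) 1 (by norm_num))
      (pt (Pi.single i ((ε : ℤ) : ℝ)) (36 / 25) (by norm_num))
  generalize ψ.symm (pt (Pi.single i ((ε : ℤ) : ℝ)) 1 (by norm_num)) = a at *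
  generalize ψ.symm (pt (Pi.single i ((ε : ℤ) : ℝ)) (6 / 5) (by norm_num)) = b at *
  generalize ψ.symm (pt (Pi.single i ((ε : ℤ) : ℝ)) (36 / 25) (by norm_num)) = c at *
  have ha := hh a e1
  have hpos : 0 < h := ha ▸ a.pos
  simp only [dsq, pt_x, pt_t, sub_self, ha, hh b e2, hh c e3] at d12 d23 d13
  have key : ∑ k, (a.x k - c.x k) ^ 2 ≤ 2 * ∑ k, (a.x k - b.x k) ^ 2 + 2 * ∑ k, (b.x k - c.x k) ^ 2
      := by
    rw [Finset.mul_sum, Finset.mul_sum, ← Finset.sum_add_distrib]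
    refine Finset.sum_le_sum fun k _ => ?_
    nlinarith [sq_nonneg ((a.x k - b.x k) - (b.x k - c.x k))]
  generalize ∑ k, (a.x k - c.x k) ^ 2 = A at *
  generalize ∑ k, (a.x k - b.x k) ^ 2 = B at *
  generalize ∑ k, (b.x k - c.x k) ^ 2 = C at *
  norm_num at d12 d23 d13
  rw [div_eq_iff (by positivity)] at d12 d23 d13
  nlinarith [mul_pos hpos hpos]

/-- A c-facet contains a vertical geodesic segment, so its preimage lies in no horospheric facet. If
it lies in a c-facet, conjugating the reflection in that facet by `ψ` gives the reflection in the
target. Thus all c-facets through `G` have the same reflection and coincide. -/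
theorem eq_facetC_of_image {i : Fin d} {ε : ℤˣ} {ψ : HSpace d ≃ᵢ HSpace d} {G : Set (HSpace d)}
    (hG : IsProtoFace G) (h : ψ '' G = facetC i ε) : ∃ j δ, G = facetC j δ := by
  obtain ⟨⟨p, hp⟩, S, hS, hSf, hGS⟩ := hG
  have hsub : ∀ H ∈ S, G ⊆ H := fun H hH => hGS ▸ Set.sInter_subset_of_mem hH
  have hC : ∀ H ∈ S, ∃ j δ, H = facetC j δ := by
    intro H hH
    rcases hSf H hH with rfl | ⟨σ, rfl⟩ | h
    · exact absurd (fun q hq => (mem_facetA.1 (hsub _ hH hq)).2) (image_facetC_not_horospheric h)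
    · exact absurd (fun q hq => (mem_facetB.1 (hsub _ hH hq)).2) (image_facetC_not_horospheric h)
    · exact h
  have hconj : ∀ j (δ : ℤˣ), facetC j δ ∈ S →
      (ψ.symm.trans (refl j ((δ : ℤ) : ℝ))).trans ψ = refl i ((ε : ℤ) : ℝ) := by
    intro j δ hj
    refine (eq_id_or_eq_refl (ε := ε) fun q hq => ?_).resolve_left fun hid => ?_
    · have h1 : refl j ((δ : ℤ) : ℝ) (ψ.symm q) = ψ.symm q :=
        refl_eq_self_iff.2 (hsub _ hj (mem_image_iso.1 (h ▸ hq))).2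
      simp [h1]
    · refine refl_ne_id j ((δ : ℤ) : ℝ) ?_
      ext1 q
      have h2 := DFunLike.congr_fun hid (ψ q)
      simpa using h2
  obtain ⟨H, hH⟩ := id hS
  obtain ⟨j, δ, rfl⟩ := hC H hH
  refine ⟨j, δ, eq_of_sInter hS hGS fun H' hH' => ?_⟩
  obtain ⟨j', δ', rfl⟩ := hC H' hH'
  have hjj : j = j' := by
    by_contra hne
    have h1 := (hconj j δ hH).trans (hconj j' δ' hH').symm
    have h2 := DFunLike.congr_fun h1 (ψ (pt (fun _ => 0) 1 one_pos))
    simp only [IsometryEquiv.trans_apply, IsometryEquiv.symm_apply_apply,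
      EmbeddingLike.apply_eq_iff_eq] at h2
    have h3 := congrArg (fun q : HSpace d => q.x j) h2
    simp only [refl_x_self, refl_x_of_ne hne, pt_x] at h3
    have := unit_sq δ
    nlinarith
  subst hjj
  have h1 := (hsub _ hH hp).2
  have h2 := (hsub _ hH' hp).2
  rw [unit_cast_injective (h1.symm.trans h2)]

theorem image_prototile_stdIso (π : Equiv.Perm (Fin d)) (s : Fin d → ℤˣ) :
    stdIso π s 0 0 '' prototile d = prototile d := by
  ext p
  rw [mem_image_iso]
  simp only [prototile, Set.mem_ofPred_eq, stdIso_symm_x, stdIso_symm_t]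
  simp only [zpow_zero, inv_one, one_mul, Pi.zero_apply, sub_zero, abs_mul, abs_unit]
  refine and_congr ⟨fun h i => ?_, fun h i => h _⟩ Iff.rfl
  simpa using h (π i)

/-- A c-facet is a copy of the prototile of one dimension less, to which `stabilizer_prototile`
applies; this is why that result is about distance-preserving maps of the prototile alone. For `m =
0` the facet is a segment, which can be reversed. -/
theorem exists_stdIso_of_facetC_aux {m : ℕ} (hm : 0 < m) {ψ : HSpace (m + 1) ≃ᵢ HSpace (m + 1)}
    {i j : Fin (m + 1)} {ε δ : ℤˣ} (h : ψ '' facetC j δ = facetC i ε) :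
    ∃ π s, ∀ q ∈ facetC j δ, ψ q = stdIso π s 0 0 q := by
  let ins : HSpace m → HSpace (m + 1) :=
    fun p => pt (j.insertNth ((δ : ℤ) : ℝ) (fun k => p.x k)) p.t p.pos
  let f : HSpace m → HSpace m :=
    fun p => pt (fun k => (ψ (ins p)).x (i.succAbove k)) (ψ (ins p)).t (ψ (ins p)).pos
  have hins : ∀ p ∈ prototile m, ins p ∈ facetC j δ := by
    rintro p ⟨h1, h2⟩
    refine ⟨⟨fun k => ?_, h2⟩, by simp [ins]⟩
    simp only [ins, pt_x]
    cases k using j.succAboveCases with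
    | x => simp [abs_unit]
    | p k => simpa using h1 k
  have hψ : ∀ q ∈ facetC j δ, ψ q ∈ facetC i ε := fun q hq => h ▸ Set.mem_image_of_mem ψ hq
  have hf : ∀ p ∈ prototile m, ∀ q ∈ prototile m, dsq (f p) (f q) = dsq p q := by
    intro p hp q hq
    have h1 := dsq_isometry ψ.isometry (ins p) (ins q)
    have h2 := (hψ _ (hins p hp)).2
    have h3 := (hψ _ (hins q hq)).2
    rw [dsq, dsq, Fin.sum_univ_succAbove _ i, Fin.sum_univ_succAbove _ j, h2, h3] at h1
    simpa [dsq, f, ins] using h1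
  have hmem : ∀ p ∈ prototile m, f p ∈ prototile m := by
    intro p hp
    have h1 := (hψ _ (hins p hp)).1
    exact ⟨fun k => h1.1 _, h1.2⟩
  obtain ⟨π, s, hs⟩ := stabilizer_prototile hm f hf hmem
  -- The permutation is extended by `i ↦ j`, with the sign `ε * δ` that turns the constant
  -- coordinate `δ` into `ε`.
  refine ⟨((finSuccEquiv' i).trans (Equiv.optionCongr π)).trans (finSuccEquiv' j).symm,
    i.insertNth (ε * δ) s, fun q hq => ?_⟩
  obtain ⟨hq1, hq2⟩ := hq
  let p : HSpace m := pt (fun k => q.x (j.succAbove k)) q.t q.pos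
  have hp : p ∈ prototile m := ⟨fun k => hq1.1 _, hq1.2⟩
  have hpq : ins p = q := by
    refine ext' (fun k => ?_) rfl
    cases k using j.succAboveCases with
    | x => simp [ins, hq2]
    | p k => simp [ins, p]
  obtain ⟨h1, h2⟩ := hs p hp
  simp only [f, hpq, pt_x, pt_t, p] at h1 h2
  refine ext' (fun k => ?_) (by simp [h2])
  cases k using i.succAboveCases with
  | x =>
    rw [(hψ q ⟨hq1, hq2⟩).2]
    simp only [stdIso_x, Equiv.trans_apply, finSuccEquiv'_at, Equiv.optionCongr_apply,
      Option.map_none, finSuccEquiv'_symm_none, hq2, Fin.insertNth_apply_same]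
    push_cast
    simp [mul_assoc, unit_mul_self]
  | p k => simp [h1]

/-- An isometry between aside facets that respects, for `d = 1`, the orientation agrees with a
signed permutation of the coordinates. -/
theorem exists_stdIso_of_facetC {ψ : HSpace d ≃ᵢ HSpace d} {i j : Fin d} {ε δ : ℤˣ}
    (h : ψ '' facetC j δ = facetC i ε)
    (h1 : d = 1 → ψ '' (facetC j δ ∩ facetA d) = facetC i ε ∩ facetA d) :
    ∃ π s, ∀ q ∈ facetC j δ, ψ q = stdIso π s 0 0 q := by
  obtain rfl | hd := eq_or_ne d 1
  · refine ⟨1, fun _ => ε * δ, fun q hq => ?_⟩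
    obtain rfl := Subsingleton.elim i 0
    obtain rfl := Subsingleton.elim j 0
    let A : HSpace 1 := pt (fun _ => ((δ : ℤ) : ℝ)) 2 two_pos
    have hA : A ∈ facetC 0 δ := ⟨⟨fun _ => (abs_unit δ).le, by simp [A], by simp [A]⟩, rfl⟩
    have h2 : ψ A ∈ facetC 0 ε ∩ facetA 1 := h1 rfl ▸ Set.mem_image_of_mem ψ
      ⟨hA, mem_facetA.2 ⟨fun _ => (abs_unit δ).le, rfl⟩⟩
    have h3 : ψ q ∈ facetC 0 ε := h ▸ Set.mem_image_of_mem ψ hq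
    have h4 := dsq_isometry ψ.isometry q A
    have h5 := q.pos
    have h6 := (ψ q).pos
    have h7 := h2.2.2
    simp only [dsq, Finset.univ_unique, Finset.sum_singleton, Fin.default_eq_zero, h3.2, h2.1.2,
      hq.2, h7, A, pt_x, pt_t, sub_self, Fin.isValue] at h4
    rw [div_eq_div_iff (by positivity) (by positivity)] at h4
    -- A point at the given distance from the end `A` of height 2 has height `q.t` or `4 / q.t`; the
    -- latter lies in the prototile only for `q.t = 2`, where the two agree.
    have h8 : ((ψ q).t - q.t) * ((ψ q).t * q.t - 4) = 0 := by linarith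
    have h9 : (ψ q).t = q.t := by
      rcases mul_eq_zero.1 h8 with h9 | h9
      · linarith
      · have := hq.1.2.2
        have := h3.1.2.2
        nlinarith
    refine ext' (fun k => ?_) (by simp [h9])
    obtain rfl := Subsingleton.elim k 0
    rw [h3.2, stdIso_x, Equiv.Perm.one_apply, hq.2]
    push_cast
    simp [mul_assoc, unit_mul_self]
  · obtain ⟨m, rfl⟩ := Nat.exists_eq_succ_of_ne_zero (Fin.pos i).ne'
    exact exists_stdIso_of_facetC_aux (by omega) h

/-- Precomposing `ψ` with the inverse of a signed permutation, which preserves the prototile, gives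
an isometry that fixes the facet pointwise: the identity or the reflection. -/
theorem image_prototile_of_facetC {ψ : HSpace d ≃ᵢ HSpace d} {i j : Fin d} {ε δ : ℤˣ}
    (h : ψ '' facetC j δ = facetC i ε)
    (h1 : d = 1 → ψ '' (facetC j δ ∩ facetA d) = facetC i ε ∩ facetA d) :
    ψ '' prototile d = prototile d ∨
      ψ '' prototile d = refl i ((ε : ℤ) : ℝ) '' prototile d := by
  obtain ⟨π, s, hs⟩ := exists_stdIso_of_facetC h h1
  set Ψ := stdIso π s 0 0
  have h2 : ∀ q ∈ facetC i ε, (Ψ.symm.trans ψ) q = q := by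
    intro q hq
    obtain ⟨r, hr, rfl⟩ := h ▸ hq
    rw [hs r hr]
    simp [hs r hr]
  have h3 : ψ '' prototile d = (Ψ.symm.trans ψ) '' prototile d := by
    conv_rhs => rw [← image_prototile_stdIso π s, ← Set.image_comp]
    congr 1
    funext p
    simp [Ψ]
  rw [h3]
  rcases eq_id_or_eq_refl h2 with h4 | h4
  · left; rw [h4]; ext; simp
  · right; rw [h4]

section
variable (π : Equiv.Perm (Fin d)) (s : Fin d → ℤˣ)

theorem stdIso_image_facetA : stdIso π s 0 0 '' facetA d = facetA d := by
  ext p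
  rw [mem_image_iso, facetA, Set.mem_sep_iff, Set.mem_sep_iff, ← mem_image_iso,
    image_prototile_stdIso, stdIso_symm_t]
  simp

theorem stdIso_image_facetB (σ : Fin d → ℤˣ) :
    stdIso π s 0 0 '' facetB σ = facetB fun i => s i * σ (π i) := by
  ext p
  rw [mem_image_iso, facetB, facetB, Set.mem_sep_iff, Set.mem_sep_iff, ← mem_image_iso,
    image_prototile_stdIso, stdIso_symm_t]
  refine and_congr Iff.rfl (and_congr (by simp) ⟨fun h i => ?_, fun h i => ?_⟩)
  · have := h (π i)
    rw [stdIso_symm_x] at this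
    simp only [Equiv.symm_apply_apply, zpow_zero, inv_one, one_mul, Pi.zero_apply, sub_zero] at this
    push_cast
    linarith
  · have := h (π.symm i)
    rw [stdIso_symm_x]
    simp only [Equiv.apply_symm_apply, zpow_zero, inv_one, one_mul, Pi.zero_apply, sub_zero]
      at this ⊢
    push_cast at this
    linarith

theorem stdIso_image_facetC (i : Fin d) (ε : ℤˣ) :
    stdIso π s 0 0 '' facetC i ε = facetC (π.symm i) (s (π.symm i) * ε) := by
  ext p
  rw [mem_image_iso, facetC, facetC, Set.mem_sep_iff, Set.mem_sep_iff, ← mem_image_iso,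
    image_prototile_stdIso, stdIso_symm_x]
  refine and_congr Iff.rfl ?_
  simp only [zpow_zero, inv_one, one_mul, Pi.zero_apply, sub_zero]
  push_cast
  have := unit_mul_self (s (π.symm i))
  constructor <;> intro h
  · rw [← h]; linear_combination (-p.x (π.symm i)) * this
  · rw [h]; linear_combination ((ε : ℤ) : ℝ) * this

theorem isProtoFacet_stdIso {H : Set (HSpace d)} (h : IsProtoFacet H) :
    IsProtoFacet (stdIso π s 0 0 '' H) := by
  rcases h with rfl | ⟨σ, rfl⟩ | ⟨i, ε, rfl⟩
  · exact Or.inl (stdIso_image_facetA π s)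
  · exact Or.inr (Or.inl ⟨_, stdIso_image_facetB π s σ⟩)
  · exact Or.inr (Or.inr ⟨_, _, stdIso_image_facetC π s i ε⟩)

end

/-- The isometry in `IsFace` may be any self-map of the prototile, but these are signed permutations
and permute the facets. -/
theorem isProtoFace_of_isFace (hd : 0 < d) {F : Set (HSpace d)} (h : IsFace (prototile d) F) :
    IsProtoFace F := by
  obtain ⟨φ, hφ, G, ⟨hne, S, hS, hSf, rfl⟩, rfl⟩ := h
  obtain ⟨π, s, rfl⟩ := eq_stdIso_of_prototile hd hφ
  refine ⟨hne.image _, (stdIso π s 0 0 '' ·) '' S, hS.image _, ?_, ?_⟩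
  · rintro _ ⟨H, hH, rfl⟩
    exact isProtoFacet_stdIso π s (hSf H hH)
  · ext p
    rw [mem_image_iso]
    simp only [Set.mem_sInter, Set.forall_mem_image, mem_image_iso]

/-- A point that lies on one facet only identifies the face. The centres below are such points. -/
theorem IsProtoFace.eq_of_mem {F H : Set (HSpace d)} (hF : IsProtoFace F) {p : HSpace d}
    (hp : p ∈ F) (h : ∀ G, IsProtoFacet G → p ∈ G → G = H) : F = H := by
  obtain ⟨_, S, hS, hSf, rfl⟩ := hF
  exact eq_of_sInter hS rfl fun G hG => h G (hSf G hG) (Set.mem_sInter.1 hp G hG)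

/-- The centre of `facetA`. -/
def centerA (d : ℕ) : HSpace d := pt (fun _ => 0) 2 two_pos

/-- The centre of `facetB σ`. -/
def centerB (σ : Fin d → ℤˣ) : HSpace d := pt (fun i => ((σ i : ℤ) : ℝ) / 2) 1 one_pos

/-- A relatively interior point of `facetC i ε`. -/
def centerC (i : Fin d) (ε : ℤˣ) : HSpace d := pt (Pi.single i ((ε : ℤ) : ℝ)) (3 / 2) (by norm_num)

theorem eq_facetA_of_mem {F : Set (HSpace d)} (hF : IsProtoFace F) (hp : centerA d ∈ F) :
    F = facetA d := by
  refine hF.eq_of_mem hp fun G hG hpG => ?_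
  rcases hG with rfl | ⟨σ, rfl⟩ | ⟨i, ε, rfl⟩
  · rfl
  · have := hpG.2.1
    simp [centerA] at this
  · have h1 : (0 : ℝ) = ((ε : ℤ) : ℝ) := hpG.2
    have := unit_sq ε
    rw [← h1] at this
    norm_num at this

theorem eq_facetB_of_mem {F : Set (HSpace d)} {σ : Fin d → ℤˣ} (hF : IsProtoFace F)
    (hp : centerB σ ∈ F) : F = facetB σ := by
  refine hF.eq_of_mem hp fun G hG hpG => ?_
  rcases hG with rfl | ⟨σ', rfl⟩ | ⟨i, ε, rfl⟩
  · have := hpG.2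
    simp [centerB] at this
  · congr 1
    funext i
    by_contra hne
    have h1 := hpG.2.2 i
    rw [← neg_eq_iff_eq_neg.2 (unit_eq_neg_of_ne hne)] at h1
    simp only [centerB, pt_x] at h1
    push_cast at h1
    have := unit_sq (σ i)
    linarith
  · have h1 : ((σ i : ℤ) : ℝ) / 2 = ((ε : ℤ) : ℝ) := hpG.2
    have := unit_sq ε
    have := unit_sq (σ i)
    rw [← h1] at *
    linarith

theorem eq_facetC_of_mem {F : Set (HSpace d)} {i : Fin d} {ε : ℤˣ} (hF : IsProtoFace F)
    (hp : centerC i ε ∈ F) : F = facetC i ε := by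
  refine hF.eq_of_mem hp fun G hG hpG => ?_
  rcases hG with rfl | ⟨σ', rfl⟩ | ⟨j, δ, rfl⟩
  · have := hpG.2
    norm_num [centerC] at this
  · have := hpG.2.1
    norm_num [centerC] at this
  · have h1 := hpG.2
    simp only [centerC, pt_x] at h1
    by_cases hj : j = i
    · subst hj
      rw [Pi.single_eq_same] at h1
      rw [unit_cast_injective h1]
    · rw [Pi.single_eq_of_ne hj] at h1
      have := unit_sq δ
      rw [← h1] at this
      norm_num at this

/-- By rigidity `G` is horospheric. If it is the a-facet, then `ψ` is a signed permutation and the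
tile is the prototile itself, so `G` is a b-facet and `ψ` inverts some `down` up to a signed
permutation. -/
theorem image_prototile_of_facetA (hd : 0 < d) {ψ : HSpace d ≃ᵢ HSpace d} {G : Set (HSpace d)}
    (hG : IsProtoFace G) (h : ψ '' G = facetA d) (hne : ψ '' prototile d ≠ prototile d) :
    ∃ σ, ψ '' prototile d = (down σ).symm '' prototile d := by
  rcases (Rigid.of_image (h ▸ rigid_facetA hd)).horospheric hG with rfl | ⟨σ, rfl⟩
  · obtain ⟨π, s, rfl⟩ := eq_stdIso_of_facetA hd h
    exact absurd (image_prototile_stdIso π s) hne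
  · rw [← down_facetA, ← Set.image_comp] at h
    obtain ⟨π, s, hπ⟩ := eq_stdIso_of_facetA hd (ψ := (down σ).trans ψ) h
    refine ⟨fun i => s i * σ (π i), ?_⟩
    have h2 : ψ = ((down σ).symm).trans (stdIso π s 0 0) := by
      rw [← hπ]; ext1 p; simp
    have h3 : ψ = (stdIso π s 0 0).trans (down fun i => s i * σ (π i)).symm := by
      rw [h2]
      ext1 p
      refine ext' (fun i => ?_) ?_
      · simp only [IsometryEquiv.trans_apply, stdIso_x, down_symm_x, zpow_zero, one_mul,
          Pi.zero_apply, add_zero]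
        push_cast; ring
      · simp [down_symm_t]
    rw [h3, show ⇑((stdIso π s 0 0).trans (down fun i => s i * σ (π i)).symm) =
      (down fun i => s i * σ (π i)).symm ∘ stdIso π s 0 0 from rfl, Set.image_comp,
      image_prototile_stdIso]

theorem image_interior_iso (ψ : HSpace d ≃ᵢ HSpace d) (A : Set (HSpace d)) :
    ψ '' interior A = interior (ψ '' A) := ψ.toHomeomorph.image_interior A

theorem image_closed_iso (ψ : HSpace d ≃ᵢ HSpace d) {A : Set (HSpace d)} (h : IsClosed A) :
    IsClosed (ψ '' A) := ψ.toHomeomorph.isClosed_image.2 h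

theorem image_symm_image (ψ : HSpace d ≃ᵢ HSpace d) (A : Set (HSpace d)) :
    ψ.symm '' (ψ '' A) = A := by
  rw [← Set.image_comp, show ⇑ψ.symm ∘ ⇑ψ = id from funext fun p => by simp, Set.image_id]

theorem image_image_symm (ψ : HSpace d ≃ᵢ HSpace d) (A : Set (HSpace d)) :
    ψ '' (ψ.symm '' A) = A := by
  rw [← Set.image_comp, show ⇑ψ ∘ ⇑ψ.symm = id from funext fun p => by simp, Set.image_id]

theorem image_trans (φ ψ : HSpace d ≃ᵢ HSpace d) (A : Set (HSpace d)) :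
    (φ.trans ψ) '' A = ψ '' (φ '' A) := Set.image_comp ψ φ A

/-- If `G` were a b-facet, then `ψ`, conjugated to a self-map of the a-facet, would preserve
heights; the new tile would lie on the same side of the horosphere as the prototile and overlap it.
-/
theorem image_prototile_of_facetB (hd : 0 < d) {ψ : HSpace d ≃ᵢ HSpace d} {G : Set (HSpace d)}
    {σ : Fin d → ℤˣ} (hG : IsProtoFace G) (h : ψ '' G = facetB σ)
    (hdis : Disjoint (interior (prototile d)) (interior (ψ '' prototile d))) :
    ψ '' prototile d = down σ '' prototile d := by
  rcases (Rigid.of_image (h ▸ rigid_facetB hd σ)).horospheric hG with rfl | ⟨σ', rfl⟩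
  · have h1 : (ψ.trans (down σ).symm) '' facetA d = facetA d := by
      rw [image_trans, h, ← down_facetA, image_symm_image]
    obtain ⟨π, s, hπ⟩ := eq_stdIso_of_facetA hd h1
    have h2 := image_prototile_stdIso π s
    rw [← hπ, image_trans] at h2
    rw [← h2, image_image_symm, h2]
  · exfalso
    have h1 : (((down σ').trans ψ).trans (down σ).symm) '' facetA d = facetA d := by
      rw [image_trans, image_trans, down_facetA, h, ← down_facetA, image_symm_image]
    obtain ⟨π, s, hπ⟩ := eq_stdIso_of_facetA hd h1
    have hint : ∀ σ : Fin d → ℤˣ,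
        pt (fun i => ((σ i : ℤ) : ℝ) / 2) (3 / 2) (by norm_num) ∈ interior (prototile d) := by
      intro σ
      refine mem_interior_prototile (fun i => ?_) (by norm_num) (by norm_num)
      rw [pt_x, abs_div, abs_unit]; norm_num
    refine Set.disjoint_left.1 hdis (hint σ) ?_
    rw [← image_interior_iso]
    refine ⟨_, hint σ', ?_⟩
    have h2 := DFunLike.congr_fun hπ (pt (fun _ => 0) 3 (by norm_num))
    simp only [IsometryEquiv.trans_apply] at h2
    have h3 : down σ' (pt (fun _ => 0) 3 (by norm_num)) =
        pt (fun i => ((σ' i : ℤ) : ℝ) / 2) (3 / 2) (by norm_num) :=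
      ext' (fun i => by simp [down_x]) (by simp [down_t])
    rw [h3] at h2
    rw [← (down σ).symm.injective.eq_iff, h2]
    exact ext' (fun i => by simp [down_symm_x]; ring) (by simp [down_symm_t]; norm_num)

/-! ### Local finiteness and existence of neighbours -/

theorem dist_prototile_le {p q : HSpace d} (hp : p ∈ prototile d) (hq : q ∈ prototile d) :
    dist p q ≤ 1 + (4 * d + 1) / 2 := by
  have h1 : dist p q ≤ Real.cosh (dist p q) :=
    (Real.self_le_sinh_iff.2 dist_nonneg).trans (Real.sinh_lt_cosh _).le
  have h2 : dsq p q ≤ 4 * d + 1 := by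
    have h3 : ∑ i, (p.x i - q.x i) ^ 2 ≤ 4 * d := by
      calc ∑ i, (p.x i - q.x i) ^ 2 ≤ ∑ _i : Fin d, (4 : ℝ) :=
            Finset.sum_le_sum fun i _ => sub_sq_le_four (hp.1 i) (hq.1 i)
        _ = 4 * d := by simp [mul_comm]
    obtain ⟨_, hp1, hp2⟩ := hp
    obtain ⟨_, hq1, hq2⟩ := hq
    have h4 : (p.t - q.t) ^ 2 ≤ 1 := by nlinarith
    rw [dsq, div_le_iff₀ (mul_pos p.pos q.pos)]
    have h5 : 1 ≤ p.t * q.t := one_le_mul_of_one_le_of_one_le hp1 hq1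
    have h6 : (0 : ℝ) ≤ 4 * d + 1 := by positivity
    nlinarith
  rw [cosh_dist_eq_dsq] at h1
  linarith

/-- The tilings are locally finite. -/
theorem IsBTiling.finite_inter_ball {𝒯 : Set (Set (HSpace d))} (h : IsBTiling 𝒯) (p : HSpace d) :
    {T ∈ 𝒯 | (T ∩ Metric.ball p 1).Nonempty}.Finite := by
  classical
  let O : HSpace d := pt (fun _ => 0) (3 / 2) (by norm_num)
  have hO : O ∈ interior (prototile d) :=
    mem_interior_prototile (by simp [O]) (by norm_num [O]) (by norm_num [O])
  obtain ⟨r, hr, hball⟩ := Metric.isOpen_iff.1 isOpen_interior O hO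
  set R : ℝ := 1 + (4 * d + 1) / 2
  have hc : ∀ T, ∃ φ : HSpace d ≃ᵢ HSpace d, T ∈ 𝒯 → φ '' prototile d = T := by
    intro T
    by_cases hT : T ∈ 𝒯
    · obtain ⟨φ, hφ⟩ := h.congruent T hT
      exact ⟨φ, fun _ => hφ⟩
    · exact ⟨IsometryEquiv.refl _, fun h => absurd h hT⟩
  choose φ hφ using hc
  -- Tiles that meet the ball have their inner points `φ T O` in a compact ball. Each such point is
  -- assigned a nearby point of a finite `r / 2`-net; two tiles with the same net point would
  -- overlap, since each contains the `r`-ball about its inner point.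
  obtain ⟨t, ht, hcov⟩ := Metric.totallyBounded_iff.1
    (isCompact_closedBall p (1 + R)).totallyBounded (r / 2) (half_pos hr)
  have hy : ∀ T, ∃ y, T ∈ {T ∈ 𝒯 | (T ∩ Metric.ball p 1).Nonempty} →
      y ∈ t ∧ dist (φ T O) y < r / 2 := by
    intro T
    by_cases hT : T ∈ {T ∈ 𝒯 | (T ∩ Metric.ball p 1).Nonempty}
    · obtain ⟨hT1, q, hqT, hqb⟩ := id hT
      rw [← hφ T hT1] at hqT
      obtain ⟨q', hq', rfl⟩ := hqT
      have h1 : dist (φ T O) (φ T q') ≤ R := by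
        rw [(φ T).dist_eq]; exact dist_prototile_le (interior_subset hO) hq'
      have h2 : φ T O ∈ Metric.closedBall p (1 + R) := by
        rw [Metric.mem_closedBall]
        have := dist_triangle (φ T O) (φ T q') p
        have := Metric.mem_ball.1 hqb
        linarith
      obtain ⟨y, hy, hy2⟩ := Set.mem_iUnion₂.1 (hcov h2)
      exact ⟨y, fun _ => ⟨hy, hy2⟩⟩
    · exact ⟨p, fun h => absurd h hT⟩
  choose y hy using hy
  refine Set.Finite.of_injOn (f := y) (fun T hT => (hy T hT).1) (fun T hT T' hT' hyy => ?_) ht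
  by_contra hne
  have h1 := (hy T hT).2
  have h2 := (hy T' hT').2
  rw [← hyy] at h2
  have h3 : dist (φ T' O) (φ T O) < r := by
    have := dist_triangle_right (φ T' O) (φ T O) (y T)
    linarith
  have h4 : φ T' O ∈ interior T := by
    rw [← hφ T hT.1, ← image_interior_iso, mem_image_iso]
    refine hball ?_
    rw [Metric.mem_ball, ← (φ T).dist_eq]
    simpa using h3
  have h5 : φ T' O ∈ interior T' := by
    have h6 := image_interior_iso (φ T') (prototile d)
    rw [hφ T' hT'.1] at h6
    rw [← h6]
    exact ⟨O, hO, rfl⟩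
  exact Set.disjoint_left.1 (h.nonoverlap hT.1 hT'.1 hne) h4 h5

theorem IsBTiling.closed {𝒯 : Set (Set (HSpace d))} (h : IsBTiling 𝒯) {T : Set (HSpace d)}
    (hT : T ∈ 𝒯) : IsClosed T := by
  obtain ⟨φ, rfl⟩ := h.congruent T hT
  exact image_closed_iso φ closed_prototile

/-- By local finiteness the union of the other tiles near `p` is closed. If it missed `p`, then `T`
alone would cover a neighbourhood of `p`. -/
theorem IsBTiling.exists_other_tile {𝒯 : Set (Set (HSpace d))} (h : IsBTiling 𝒯)
    {T : Set (HSpace d)} {p : HSpace d} (hp : p ∈ closure Tᶜ) :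
    ∃ T' ∈ 𝒯, T' ≠ T ∧ p ∈ T' := by
  by_contra! hcon
  have hfin := (h.finite_inter_ball p).subset
    (Set.sdiff_subset (s := {T ∈ 𝒯 | (T ∩ Metric.ball p 1).Nonempty}) (t := {T}))
  have hcl : IsClosed (⋃₀ ({T ∈ 𝒯 | (T ∩ Metric.ball p 1).Nonempty} \ {T})) := by
    rw [Set.sUnion_eq_biUnion]
    exact hfin.isClosed_biUnion fun T' hT' => h.closed hT'.1.1
  have hp1 : p ∈ (⋃₀ ({T ∈ 𝒯 | (T ∩ Metric.ball p 1).Nonempty} \ {T}))ᶜ := by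
    rintro ⟨T', ⟨hT', hne⟩, hpT'⟩
    exact hcon T' hT'.1 hne hpT'
  obtain ⟨q, ⟨hq1, hq2⟩, hq3⟩ := mem_closure_iff.1 hp _ (hcl.isOpen_compl.inter Metric.isOpen_ball)
    ⟨hp1, Metric.mem_ball_self one_pos⟩
  obtain ⟨T', hT', hqT'⟩ : q ∈ ⋃₀ 𝒯 := h.cover ▸ Set.mem_univ q
  refine hq1 ⟨T', ⟨⟨hT', q, hqT', hq2⟩, ?_⟩, hqT'⟩
  rintro rfl
  exact hq3 hqT'

theorem mem_closure_compl {A : Set (HSpace d)} {p : HSpace d} (w : Fin d → ℝ) (a : ℝ)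
    (h : ∀ δ : ℝ, 0 < δ →
      pt (fun i => p.x i + δ * w i) (p.t * Real.exp (a * δ)) (mul_pos p.pos (Real.exp_pos _)) ∉ A) :
    p ∈ closure Aᶜ := by
  refine mem_closure_iff.2 fun U hU hpU => ?_
  obtain ⟨ε, hε, hU'⟩ := exists_pos_of_isOpen hU hpU w a
  exact ⟨_, hU' (ε / 2) (by rw [abs_of_pos (half_pos hε)]; exact half_lt_self hε),
    h _ (half_pos hε)⟩

theorem centerA_mem_closure : centerA d ∈ closure (prototile d)ᶜ := by
  refine mem_closure_compl 0 1 fun δ hδ hmem => ?_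
  have h1 := hmem.2.2
  have h2 := Real.one_lt_exp_iff.2 hδ
  simp only [pt_t, centerA, one_mul] at h1
  linarith

theorem centerB_mem_closure (σ : Fin d → ℤˣ) : centerB σ ∈ closure (prototile d)ᶜ := by
  refine mem_closure_compl 0 (-1) fun δ hδ hmem => ?_
  have h1 := hmem.2.1
  have h2 : Real.exp (-1 * δ) < 1 := Real.exp_lt_one_iff.2 (by linarith)
  simp only [pt_t, centerB, one_mul] at h1
  linarith

theorem centerC_mem_closure (i : Fin d) (ε : ℤˣ) : centerC i ε ∈ closure (prototile d)ᶜ := by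
  refine mem_closure_compl (Pi.single i ((ε : ℤ) : ℝ)) 0 fun δ hδ hmem => ?_
  have h1 := hmem.1 i
  simp only [pt_x, centerC, Pi.single_eq_same] at h1
  rw [← one_add_mul, abs_mul, abs_unit, mul_one, abs_of_pos (by linarith)] at h1
  linarith

theorem centerA_mem : centerA d ∈ prototile d :=
  ⟨by simp [centerA], by simp [centerA], by simp [centerA]⟩

theorem centerB_mem (σ : Fin d → ℤˣ) : centerB σ ∈ prototile d := by
  refine ⟨fun i => ?_, by simp [centerB], by simp [centerB]⟩
  rw [centerB, pt_x, abs_div, abs_unit]; norm_num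

theorem centerC_mem (i : Fin d) (ε : ℤˣ) : centerC i ε ∈ prototile d :=
  ⟨fun j => abs_single_le (abs_unit ε).le, by norm_num [centerC], by norm_num [centerC]⟩

section
variable {𝒯 : Set (Set (HSpace d))}

theorem IsBTiling.exists_neighbour (h : IsBTiling 𝒯) (h0 : prototile d ∈ 𝒯) (hd : 0 < d)
    {p : HSpace d} (hp : p ∈ closure (prototile d)ᶜ) (hp' : p ∈ prototile d) :
    ∃ (ψ : HSpace d ≃ᵢ HSpace d) (G : Set (HSpace d)), ψ '' prototile d ∈ 𝒯 ∧
      ψ '' prototile d ≠ prototile d ∧ IsProtoFace G ∧ IsProtoFace (ψ '' G) ∧ p ∈ ψ '' G := by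
  obtain ⟨T', hT', hne, hpT'⟩ := h.exists_other_tile hp
  obtain ⟨h1, ψ, hψ, G, hG, h2⟩ := h.faceToFace h0 hT' hne.symm ⟨p, hp', hpT'⟩
  have h3 := isProtoFace_of_isFace hd h1
  rw [← h2] at h3
  exact ⟨ψ, G, hψ ▸ hT', hψ ▸ hne, hG, h3, h2 ▸ ⟨hp', hpT'⟩⟩

theorem IsBTiling.above_mem (h : IsBTiling 𝒯) (h0 : prototile d ∈ 𝒯) (hd : 0 < d) :
    ∃ σ : Fin d → ℤˣ, (down σ).symm '' prototile d ∈ 𝒯 := by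
  obtain ⟨ψ, G, hT, hne, hG, hF, hp⟩ := h.exists_neighbour h0 hd centerA_mem_closure centerA_mem
  obtain ⟨σ, hσ⟩ := image_prototile_of_facetA hd hG (eq_facetA_of_mem hF hp) hne
  exact ⟨σ, hσ ▸ hT⟩

theorem IsBTiling.below_mem (h : IsBTiling 𝒯) (h0 : prototile d ∈ 𝒯) (hd : 0 < d)
    (σ : Fin d → ℤˣ) : down σ '' prototile d ∈ 𝒯 := by
  obtain ⟨ψ, G, hT, hne, hG, hF, hp⟩ :=
    h.exists_neighbour h0 hd (centerB_mem_closure σ) (centerB_mem σ)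
  exact image_prototile_of_facetB hd hG (eq_facetB_of_mem hF hp) (h.nonoverlap h0 hT hne.symm) ▸ hT

theorem IsBTiling.aside_mem (h : IsBTiling 𝒯) (h0 : prototile d ∈ 𝒯) (i : Fin d) (ε : ℤˣ) :
    refl i ((ε : ℤ) : ℝ) '' prototile d ∈ 𝒯 := by
  obtain ⟨ψ, G, hT, hne, hG, hF, hp⟩ :=
    h.exists_neighbour h0 (Fin.pos i) (centerC_mem_closure i ε) (centerC_mem i ε)
  have hC := eq_facetC_of_mem hF hp
  obtain ⟨j, δ, rfl⟩ := eq_facetC_of_image hG hC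
  -- For `d = 1` the orientation condition, applied to `ψ` and the identity, excludes the reversal
  -- of the edge.
  have h1 := image_prototile_of_facetC hC fun hd1 => by
    have h2 := h.oriented hd1 ψ (IsometryEquiv.refl _) hT (by
      convert h0; ext; simp) j δ i ε (by rw [hC]; ext; simp)
    rw [h2]; ext; simp
  exact h1.resolve_left hne ▸ hT

end

/-! ### Images of tilings, and tiles in standard position -/

theorem IsFace.image {T F : Set (HSpace d)} (h : IsFace T F) (κ : HSpace d ≃ᵢ HSpace d) :
    IsFace (κ '' T) (κ '' F) := by
  obtain ⟨φ, rfl, G, hG, rfl⟩ := h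
  exact ⟨φ.trans κ, image_trans _ _ _, G, hG, image_trans _ _ _⟩

/-- The image of a set of tiles under an isometry. -/
def mapTiling (κ : HSpace d ≃ᵢ HSpace d) (𝒯 : Set (Set (HSpace d))) : Set (Set (HSpace d)) :=
  (fun T => κ '' T) '' 𝒯

theorem mem_mapTiling {κ : HSpace d ≃ᵢ HSpace d} {𝒯 : Set (Set (HSpace d))} {T : Set (HSpace d)} :
    T ∈ mapTiling κ 𝒯 ↔ κ.symm '' T ∈ 𝒯 := by
  constructor
  · rintro ⟨T', hT', rfl⟩
    rwa [image_symm_image]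
  · intro h
    exact ⟨_, h, image_image_symm κ T⟩

theorem image_mem_mapTiling {κ : HSpace d ≃ᵢ HSpace d} {𝒯 : Set (Set (HSpace d))}
    {T : Set (HSpace d)} : κ '' T ∈ mapTiling κ 𝒯 ↔ T ∈ 𝒯 := by
  rw [mem_mapTiling, image_symm_image]

theorem mapTiling_symm (κ : HSpace d ≃ᵢ HSpace d) (𝒯 : Set (Set (HSpace d))) :
    mapTiling κ (mapTiling κ.symm 𝒯) = 𝒯 := by
  ext T
  rw [mem_mapTiling, image_mem_mapTiling]

theorem IsBTiling.map {𝒯 : Set (Set (HSpace d))} (h : IsBTiling 𝒯) (κ : HSpace d ≃ᵢ HSpace d) :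
    IsBTiling (mapTiling κ 𝒯) where
  congruent := by
    rintro _ ⟨T, hT, rfl⟩
    obtain ⟨φ, rfl⟩ := h.congruent T hT
    exact ⟨φ.trans κ, image_trans _ _ _⟩
  cover := by
    refine Set.eq_univ_of_forall fun p => ?_
    obtain ⟨T, hT, hp⟩ : κ.symm p ∈ ⋃₀ 𝒯 := h.cover ▸ Set.mem_univ _
    exact ⟨κ '' T, ⟨T, hT, rfl⟩, mem_image_iso.2 hp⟩
  nonoverlap := by
    rintro _ ⟨T, hT, rfl⟩ _ ⟨T', hT', rfl⟩ hne
    rw [← image_interior_iso, ← image_interior_iso, Set.disjoint_image_iff κ.injective]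
    exact h.nonoverlap hT hT' fun hh => hne (by rw [hh])
  faceToFace := by
    rintro _ ⟨T, hT, rfl⟩ _ ⟨T', hT', rfl⟩ hne hn
    simp only [← Set.image_inter κ.injective] at hn ⊢
    obtain ⟨h1, h2⟩ := h.faceToFace hT hT' (fun hh => hne (by rw [hh])) hn.of_image
    exact ⟨h1.image κ, h2.image κ⟩
  oriented := by
    intro hd φ ψ hφ hψ i ε j δ hC
    have := h.oriented hd (φ.trans κ.symm) (ψ.trans κ.symm)
      (by rw [image_trans]; exact mem_mapTiling.1 hφ)
          (by rw [image_trans]; exact mem_mapTiling.1 hψ)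
      i ε j δ (by rw [image_trans, image_trans, hC])
    rw [image_trans, image_trans] at this
    exact κ.symm.injective.image_injective this

/-- The tile with centre `c` and lower height `2 ^ n`. -/
def box (c : Fin d → ℝ) (n : ℤ) : Set (HSpace d) := stdIso 1 1 c n '' prototile d

theorem two_zpow_succ (n : ℤ) : (2 : ℝ) ^ (n + 1) = 2 * 2 ^ n := by
  rw [zpow_add_one₀ two_ne_zero, mul_comm]

theorem two_zpow_pred (n : ℤ) : (2 : ℝ) ^ (n - 1) = 2 ^ n / 2 := by
  rw [zpow_sub_one₀ two_ne_zero, div_eq_mul_inv]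

theorem mem_box {c : Fin d → ℝ} {n : ℤ} {p : HSpace d} :
    p ∈ box c n ↔ (∀ i, |p.x i - c i| ≤ 2 ^ n) ∧ 2 ^ n ≤ p.t ∧ p.t ≤ 2 ^ (n + 1) := by
  have h2 : (0 : ℝ) < 2 ^ n := by positivity
  rw [box, mem_image_iso, prototile, Set.mem_ofPred_eq, stdIso_symm_t, two_zpow_succ]
  refine and_congr (forall_congr' fun i => ?_) (and_congr ?_ ?_)
  · rw [stdIso_symm_x]
    simp only [show (1 : Equiv.Perm (Fin d)).symm = 1 from rfl, Equiv.Perm.one_apply, Pi.one_apply,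
      Units.val_one, Int.cast_one, one_mul, abs_mul, abs_inv, abs_of_pos h2]
    rw [inv_mul_le_iff₀ h2, mul_one]
  · rw [le_inv_mul_iff₀ h2, mul_one]
  · rw [inv_mul_le_iff₀ h2, mul_comm]

theorem prototile_eq_box : prototile d = box (fun _ => 0) 0 := by
  ext p
  rw [mem_box]
  simp [prototile]

section
variable {𝒯 : Set (Set (HSpace d))}

theorem IsBTiling.normalize (h : IsBTiling 𝒯) {c : Fin d → ℝ} {n : ℤ} (hc : box c n ∈ 𝒯) :
    IsBTiling (mapTiling (stdIso 1 1 c n).symm 𝒯) ∧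
      prototile d ∈ mapTiling (stdIso 1 1 c n).symm 𝒯 :=
  ⟨h.map _, mem_mapTiling.2 hc⟩

theorem IsBTiling.box_above_mem (h : IsBTiling 𝒯) (hd : 0 < d) {c : Fin d → ℝ} {n : ℤ}
    (hc : box c n ∈ 𝒯) :
    ∃ σ : Fin d → ℤˣ, box (fun i => c i - 2 ^ n * ((σ i : ℤ) : ℝ)) (n + 1) ∈ 𝒯 := by
  obtain ⟨h1, h2⟩ := h.normalize hc
  obtain ⟨σ, hσ⟩ := h1.above_mem h2 hd
  refine ⟨σ, ?_⟩
  rw [mem_mapTiling, ← image_trans] at hσ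
  convert hσ using 1
  rw [box]
  congr 1
  funext p
  refine ext' (fun i => ?_) ?_
  · simp [down_symm_x, two_zpow_succ]; ring
  · simp [down_symm_t, two_zpow_succ]; ring

theorem IsBTiling.box_below_mem (h : IsBTiling 𝒯) (hd : 0 < d) {c : Fin d → ℝ} {n : ℤ}
    (hc : box c n ∈ 𝒯) (σ : Fin d → ℤˣ) :
    box (fun i => c i + 2 ^ (n - 1) * ((σ i : ℤ) : ℝ)) (n - 1) ∈ 𝒯 := by
  obtain ⟨h1, h2⟩ := h.normalize hc
  have hσ := h1.below_mem h2 hd σ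
  rw [mem_mapTiling, ← image_trans] at hσ
  convert hσ using 1
  rw [box]
  congr 1
  funext p
  refine ext' (fun i => ?_) ?_
  · simp [down_x, two_zpow_pred]; ring
  · simp [down_t, two_zpow_pred]; ring

/-- The prototile is symmetric in each coordinate, so its mirror image is also a translate. Hence
each layer is a lattice of translates. -/
theorem image_refl_prototile (i : Fin d) (ε : ℤˣ) : refl i ((ε : ℤ) : ℝ) '' prototile d =
    box (Pi.single i (2 * ((ε : ℤ) : ℝ))) 0 := by
  rw [box, ← image_prototile_stdIso 1 (Function.update 1 i (-1)), ← image_trans]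
  conv_lhs => rw [← image_prototile_stdIso 1 (Function.update 1 i (-1))]
  rw [← image_trans, image_prototile_stdIso]
  have e1 : (stdIso 1 (Function.update 1 i (-1)) 0 0).trans (refl i ((ε : ℤ) : ℝ)) =
    stdIso 1 1 (Pi.single i (2 * ((ε : ℤ) : ℝ))) 0 := by
    ext1 p
    refine ext' (fun j => ?_) ?_
    · by_cases hj : j = i
      · subst hj; simp [refl_x_self]; ring
      · simp [refl_x_of_ne hj, hj]
    · simp
  rw [e1, image_trans, image_prototile_stdIso]

theorem IsBTiling.box_aside_mem (h : IsBTiling 𝒯) {c : Fin d → ℝ} {n : ℤ}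
    (hc : box c n ∈ 𝒯) (i : Fin d) (ε : ℤˣ) :
    box (fun j => c j + (Pi.single i (2 ^ (n + 1) * ((ε : ℤ) : ℝ)) : Fin d → ℝ) j) n ∈ 𝒯 := by
  obtain ⟨h1, h2⟩ := h.normalize hc
  have hσ := h1.aside_mem h2 i ε
  rw [image_refl_prototile, mem_mapTiling, box, ← image_trans] at hσ
  convert hσ using 1
  rw [box]
  congr 1
  funext p
  refine ext' (fun j => ?_) ?_
  · by_cases hj : j = i
    · subst hj; simp [two_zpow_succ]; ring
    · simp [hj]
  · simp

end

/-! ### Every tiling comes from nested grids -/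

/-- The tile of height `2 ^ n` with index `z` in the cubic grid through the vertex `a n`. -/
def cell (a : ℤ → Fin d → ℝ) (n : ℤ) (z : Fin d → ℤ) : Set (HSpace d) :=
  box (fun i => a n i + 2 ^ (n + 1) * z i + 2 ^ n) n

/-- The tiling given by one cubic grid for every layer. -/
def gridTiling (a : ℤ → Fin d → ℝ) : Set (Set (HSpace d)) := {T | ∃ n z, T = cell a n z}

/-- Each grid is a coarsening of the grid in the layer below. -/
def Compatible (a : ℤ → Fin d → ℝ) : Prop :=
  ∀ n i, ∃ m : ℤ, a (n + 1) i = a n i + 2 ^ (n + 1) * m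

section
variable {a : ℤ → Fin d → ℝ}

theorem mem_cell {n : ℤ} {z : Fin d → ℤ} {p : HSpace d} :
    p ∈ cell a n z ↔ (∀ i, a n i + 2 ^ (n + 1) * z i ≤ p.x i ∧
      p.x i ≤ a n i + 2 ^ (n + 1) * (z i + 1)) ∧ 2 ^ n ≤ p.t ∧ p.t ≤ 2 ^ (n + 1) := by
  rw [cell, mem_box]
  refine and_congr (forall_congr' fun i => ?_) Iff.rfl
  rw [two_zpow_succ, abs_le]
  constructor <;> rintro ⟨h1, h2⟩ <;> constructor <;> linarith

theorem cell_mem (n : ℤ) (z : Fin d → ℤ) : cell a n z ∈ gridTiling a := ⟨n, z, rfl⟩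

theorem exists_level {t : ℝ} (ht : 0 < t) : ∃ n : ℤ, (2 : ℝ) ^ n ≤ t ∧ t ≤ 2 ^ (n + 1) := by
  obtain ⟨n, hn⟩ := exists_mem_Ico_zpow ht one_lt_two
  exact ⟨n, hn.1, hn.2.le⟩

theorem floor_spec (b x : ℝ) {w : ℝ} (hw : 0 < w) :
    b + w * (⌊(x - b) / w⌋ : ℤ) ≤ x ∧ x < b + w * ((⌊(x - b) / w⌋ : ℤ) + 1) := by
  have h1 := Int.floor_le ((x - b) / w)
  have h2 := Int.lt_floor_add_one ((x - b) / w)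
  rw [le_div_iff₀ hw] at h1
  rw [div_lt_iff₀ hw] at h2
  constructor <;> linarith

theorem exists_cell (a : ℤ → Fin d → ℝ) (p : HSpace d) : ∃ n z, p ∈ cell a n z := by
  obtain ⟨n, hn⟩ := exists_level p.pos
  refine ⟨n, fun i => ⌊(p.x i - a n i) / 2 ^ (n + 1)⌋, mem_cell.2 ⟨fun i => ?_, hn⟩⟩
  have h := floor_spec (a n i) (p.x i) (w := 2 ^ (n + 1)) (by positivity)
  exact ⟨h.1, h.2.le⟩

end

theorem prototile_subset_closure : prototile d ⊆ closure (interior (prototile d)) := by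
  intro p hp
  refine mem_closure_iff.2 fun U hU hpU => ?_
  have hp0 := p.pos
  -- The curve runs towards the inner point with horizontal coordinates `0` and height `3 / 2`,
  -- linearly in the coordinates and in the logarithm of the height.
  obtain ⟨ε, hε, hU'⟩ := exists_pos_of_isOpen hU hpU (fun i => -p.x i)
    (Real.log (3 / 2) - Real.log p.t)
  set δ := min (ε / 2) (1 / 2) with hδ
  have hδ0 : 0 < δ := lt_min (half_pos hε) (by norm_num)
  have hδ1 : δ ≤ 1 / 2 := min_le_right _ _
  refine ⟨_, hU' δ ?_, mem_interior_prototile (fun i => ?_) ?_ ?_⟩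
  · rw [abs_of_pos hδ0]
    have := min_le_left (ε / 2) (1 / 2)
    linarith
  · rw [pt_x, show p.x i + δ * -p.x i = (1 - δ) * p.x i by ring, abs_mul, abs_of_pos (by linarith)]
    have := hp.1 i
    have := abs_nonneg (p.x i)
    nlinarith
  all_goals
    have h1 : 0 ≤ Real.log p.t := Real.log_nonneg hp.2.1
    have h2 : Real.log p.t ≤ Real.log 2 := Real.log_le_log hp0 hp.2.2
    have h3 : 0 < Real.log (3 / 2) := Real.log_pos (by norm_num)
    have h4 : Real.log (3 / 2) < Real.log 2 := Real.log_lt_log (by norm_num) (by norm_num)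
    have h5 : p.t * Real.exp ((Real.log (3 / 2) - Real.log p.t) * δ) =
        Real.exp ((1 - δ) * Real.log p.t + δ * Real.log (3 / 2)) := by
      conv_lhs => rw [← Real.exp_log hp0, ← Real.exp_add, Real.log_exp]
      congr 1; ring
    rw [pt_t, h5]
  · exact Real.one_lt_exp_iff.2 (by nlinarith)
  · conv_rhs => rw [← Real.exp_log two_pos]
    exact Real.exp_lt_exp.2 (by nlinarith)

theorem forall_lattice {P : (Fin d → ℤ) → Prop} (h0 : P 0)
    (h : ∀ z, P z → ∀ i (ε : ℤˣ), P (z + Pi.single i (ε : ℤ))) (z : Fin d → ℤ) : P z := by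
  classical
  have h1 : ∀ z, P z → ∀ i (k : ℤ), P (z + Pi.single i k) := by
    intro z hz i k
    induction k using Int.induction_on with
    | zero => simpa using hz
    | succ k ih =>
      have := h _ ih i 1
      rwa [add_assoc, ← Pi.single_add] at this
    | pred k ih =>
      have := h _ ih i (-1)
      rwa [add_assoc, ← Pi.single_add] at this
  have h2 : ∀ s : Finset (Fin d), P (∑ i ∈ s, Pi.single i (z i)) := by
    intro s
    induction s using Finset.induction_on with
    | empty => simpa using h0
    | insert i s hi ih =>
      rw [Finset.sum_insert hi, add_comm]
      exact h1 _ ih i _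
  have := h2 Finset.univ
  rwa [Finset.univ_sum_single] at this

/-- Every B-tiling is congruent to one given by a sequence of grids. -/
theorem IsBTiling.eq_gridTiling {𝒯 : Set (Set (HSpace d))} (h : IsBTiling 𝒯) (hd : 0 < d)
    (h0 : prototile d ∈ 𝒯) : ∃ a : ℤ → Fin d → ℝ, Compatible a ∧ 𝒯 = gridTiling a := by
  -- Here `u` is the corner of least coordinates of a tile. The corner of its parent is the same or
  -- one mesh further to the left in each coordinate, depending on the half of the parent in which
  -- the tile lies.
  have step : ∀ (m : ℕ) (u : Fin d → ℝ), box (fun i => u i + 2 ^ (m : ℤ)) m ∈ 𝒯 →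
      ∃ u' : Fin d → ℝ, box (fun i => u' i + 2 ^ ((m + 1 : ℕ) : ℤ)) ((m + 1 : ℕ) : ℤ) ∈ 𝒯 ∧
        ∀ i, ∃ b : ℤ, u' i = u i + 2 ^ ((m : ℤ) + 1) * b := by
    intro m u hu
    obtain ⟨σ, hσ⟩ := h.box_above_mem hd hu
    refine ⟨fun i => u i - 2 ^ (m : ℤ) * (1 + ((σ i : ℤ) : ℝ)), ?_, fun i => ?_⟩
    · rw [Nat.cast_succ]
      convert hσ using 2
      funext i
      rw [two_zpow_succ]; ring
    · rcases Int.units_eq_one_or (σ i) with h1 | h1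
      · refine ⟨-1, ?_⟩
        simp only [h1, two_zpow_succ]; push_cast; ring
      · refine ⟨0, ?_⟩
        simp only [h1]; push_cast; ring
  choose! f hf1 hf2 using step
  let u : ℕ → Fin d → ℝ := fun m => Nat.rec (fun _ => -1) (fun m v => f m v) m
  have hu : ∀ m : ℕ, box (fun i => u m i + 2 ^ (m : ℤ)) m ∈ 𝒯 := by
    intro m
    induction m with
    | zero => simpa [u, prototile_eq_box] using h0
    | succ m ih => exact hf1 m (u m) ih
  -- In the layers below the prototile one vertex serves all grids, because the corner of a tile is
  -- also the corner of one of its children.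
  refine ⟨fun n => u n.toNat, ?_, ?_⟩
  · intro n i
    rcases le_or_gt 0 n with hn | hn
    · obtain ⟨m, rfl⟩ := Int.eq_ofNat_of_zero_le hn
      obtain ⟨b, hb⟩ := hf2 m (u m) (hu m) i
      exact ⟨b, hb⟩
    · refine ⟨0, ?_⟩
      simp only [Int.toNat_of_nonpos hn.le, Int.toNat_of_nonpos (show n + 1 ≤ 0 by omega)]
      simp
  set a : ℤ → Fin d → ℝ := fun n => u n.toNat with ha
  have hlat : ∀ n, cell a n 0 ∈ 𝒯 → ∀ z, cell a n z ∈ 𝒯 := by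
    intro n hn z
    refine forall_lattice (P := fun z => cell a n z ∈ 𝒯) hn (fun z hz i ε => ?_) z
    have := h.box_aside_mem hz i ε
    rw [cell]
    convert this using 2
    funext j
    by_cases hj : j = i
    · subst hj; simp; ring
    · simp [hj]
  have hup : ∀ m : ℕ, ∀ z, cell a m z ∈ 𝒯 := by
    intro m
    refine hlat _ ?_
    have := hu m
    rw [cell]
    convert this using 2
    simp [ha]
  have hdown : ∀ m : ℕ, ∀ z, cell a (-m) z ∈ 𝒯 := by
    intro m
    induction m with
    | zero => simpa using hup 0
    | succ m ih =>
      refine hlat _ ?_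
      have := h.box_below_mem hd (ih 0) (fun _ => -1)
      have e : (-((m + 1 : ℕ) : ℤ)) = -(m : ℤ) - 1 := by push_cast; ring
      rw [e, cell]
      convert this using 2
      funext i
      have e2 : a (-(m : ℤ) - 1) = a (-m) := by
        simp only [ha]
        rw [Int.toNat_of_nonpos (by omega), Int.toNat_of_nonpos (by omega)]
      rw [e2, two_zpow_pred]
      simp; ring
  have hsub : gridTiling a ⊆ 𝒯 := by
    rintro _ ⟨n, z, rfl⟩
    rcases le_total 0 n with hn | hn
    · obtain ⟨m, rfl⟩ := Int.eq_ofNat_of_zero_le hn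
      exact hup m z
    · obtain ⟨m, hm⟩ := Int.eq_ofNat_of_zero_le (neg_nonneg.2 hn)
      obtain rfl : n = -(m : ℤ) := by omega
      exact hdown m z
  refine Set.Subset.antisymm (fun T hT => ?_) hsub
  obtain ⟨φ, hφ⟩ := h.congruent T hT
  let O : HSpace d := pt (fun _ => 0) (3 / 2) (by norm_num)
  have hO : O ∈ interior (prototile d) :=
    mem_interior_prototile (by simp [O]) (by norm_num [O]) (by norm_num [O])
  have hO' : φ O ∈ interior T := by
    rw [← hφ, ← image_interior_iso]; exact ⟨O, hO, rfl⟩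
  obtain ⟨n, z, hnz⟩ := exists_cell a (φ O)
  have h1 : φ O ∈ closure (interior (cell a n z)) := by
    rw [cell, box, ← image_interior_iso]
    obtain ⟨q, hq, hq'⟩ := hnz
    rw [← hq']
    exact image_closure_subset_closure_image (stdIso 1 1 _ n).continuous
      ⟨q, prototile_subset_closure hq, rfl⟩
  obtain ⟨q, hq1, hq2⟩ := mem_closure_iff.1 h1 _ isOpen_interior hO'
  -- A cell is contained in the closure of its interior, so an open set that meets the cell meets
  -- its interior; a further tile would overlap the cell.
  have : T = cell a n z := by
    by_contra hne
    exact Set.disjoint_left.1 (h.nonoverlap hT (hsub (cell_mem n z)) hne) hq1 hq2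
  exact this ▸ cell_mem n z

/-! ### Nested grids give B-tilings -/

theorem interior_level_x (i : Fin d) (c : ℝ) : interior {p : HSpace d | p.x i = c} = ∅ := by
  refine Set.eq_empty_of_forall_notMem fun p hp => ?_
  obtain ⟨ε, hε, h⟩ := exists_pos_of_isOpen isOpen_interior hp (fun _ => 1) 0
  have h0 := interior_subset hp
  have h1 := interior_subset (h (ε / 2) (by rw [abs_of_pos (half_pos hε)]; exact half_lt_self hε))
  simp only [Set.mem_ofPred_eq, pt_x, mul_one] at h0 h1
  linarith

theorem interior_level_t (c : ℝ) : interior {p : HSpace d | p.t = c} = ∅ := by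
  refine Set.eq_empty_of_forall_notMem fun p hp => ?_
  obtain ⟨ε, hε, h⟩ := exists_pos_of_isOpen isOpen_interior hp (fun _ => 1) 1
  have h0 := interior_subset hp
  have h1 := interior_subset (h (ε / 2) (by rw [abs_of_pos (half_pos hε)]; exact half_lt_self hε))
  simp only [Set.mem_ofPred_eq, pt_t, one_mul] at h0 h1
  have h2 := Real.one_lt_exp_iff.2 (half_pos hε)
  have h3 := p.pos
  nlinarith

theorem isProtoFace_of {F : Set (HSpace d)} (hne : F.Nonempty) (S : Set (Set (HSpace d)))
    (hS : S.Nonempty) (hSf : ∀ G ∈ S, IsProtoFacet G) (h : ∀ p, p ∈ F ↔ ∀ G ∈ S, p ∈ G) :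
    IsProtoFace F :=
  ⟨hne, S, hS, hSf, Set.ext fun p => (h p).trans Set.mem_sInter.symm⟩

/-- This and the next two lemmas cover all intersections of grid cells: c-facets alone, or together
with the a-facet or with one b-facet. Only here must `I` be nonempty, as otherwise the set is the
whole prototile. -/
theorem isProtoFace_aside {I : Set (Fin d)} (hI : I.Nonempty) (ε : Fin d → ℤˣ) :
    IsProtoFace {q ∈ prototile d | ∀ i ∈ I, q.x i = ((ε i : ℤ) : ℝ)} := by
  refine isProtoFace_of ⟨pt (fun i => ((ε i : ℤ) : ℝ)) 1 one_pos,
    ⟨fun i => (abs_unit _).le, by simp, by simp⟩, fun i _ => rfl⟩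
    ((fun i => facetC i (ε i)) '' I) (hI.image _) ?_ fun q => ?_
  · rintro _ ⟨i, _, rfl⟩
    exact Or.inr (Or.inr ⟨i, ε i, rfl⟩)
  · rw [Set.forall_mem_image]
    obtain ⟨i, hi⟩ := hI
    exact ⟨fun h j hj => ⟨h.1, h.2 j hj⟩, fun h => ⟨(h hi).1, fun j hj => (h hj).2⟩⟩

theorem isProtoFace_lower (I : Set (Fin d)) (ε : Fin d → ℤˣ) :
    IsProtoFace {q ∈ prototile d | q.t = 2 ∧ ∀ i ∈ I, q.x i = ((ε i : ℤ) : ℝ)} := by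
  refine isProtoFace_of ⟨pt (fun i => ((ε i : ℤ) : ℝ)) 2 two_pos,
    ⟨fun i => (abs_unit _).le, by simp, by simp⟩, rfl, fun i _ => rfl⟩
    (insert (facetA d) ((fun i => facetC i (ε i)) '' I)) (Set.insert_nonempty _ _) ?_ fun q => ?_
  · rintro _ (rfl | ⟨i, _, rfl⟩)
    · exact Or.inl rfl
    · exact Or.inr (Or.inr ⟨i, ε i, rfl⟩)
  · rw [Set.forall_mem_insert, Set.forall_mem_image]
    exact ⟨fun h => ⟨⟨h.1, h.2.1⟩, fun j hj => ⟨h.1, h.2.2 j hj⟩⟩,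
      fun h => ⟨h.1.1, h.1.2, fun j hj => (h.2 hj).2⟩⟩

theorem isProtoFace_upper (I : Set (Fin d)) (σ : Fin d → ℤˣ) :
    IsProtoFace {q ∈ prototile d | q.t = 1 ∧ (∀ i, 0 ≤ q.x i * ((σ i : ℤ) : ℝ)) ∧
      ∀ i ∈ I, q.x i = ((σ i : ℤ) : ℝ)} := by
  refine isProtoFace_of ⟨pt (fun i => ((σ i : ℤ) : ℝ)) 1 one_pos,
    ⟨fun i => (abs_unit _).le, by simp, by simp⟩, rfl,
      fun i => by simp [unit_mul_self], fun i _ => rfl⟩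
    (insert (facetB σ) ((fun i => facetC i (σ i)) '' I)) (Set.insert_nonempty _ _) ?_ fun q => ?_
  · rintro _ (rfl | ⟨i, _, rfl⟩)
    · exact Or.inr (Or.inl ⟨σ, rfl⟩)
    · exact Or.inr (Or.inr ⟨i, σ i, rfl⟩)
  · rw [Set.forall_mem_insert, Set.forall_mem_image]
    exact ⟨fun h => ⟨⟨h.1, h.2.1, h.2.2.1⟩, fun j hj => ⟨h.1, h.2.2.2 j hj⟩⟩,
      fun h => ⟨h.1.1, h.1.2.1, h.1.2.2, fun j hj => (h.2 hj).2⟩⟩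

theorem image_sep_eq_inter {κ : HSpace d ≃ᵢ HSpace d} {Q : HSpace d → Prop} {T' : Set (HSpace d)}
    (h : ∀ q ∈ prototile d, κ q ∈ T' ↔ Q q) :
    κ '' {q ∈ prototile d | Q q} = κ '' prototile d ∩ T' := by
  ext p
  rw [Set.mem_inter_iff, mem_image_iso, mem_image_iso, Set.mem_sep_iff]
  refine and_congr_right fun hp => ?_
  rw [← h _ hp]; simp

section
variable {a : ℤ → Fin d → ℝ}

/-- The standard isometry that maps the prototile to a cell. -/
def cellIso (a : ℤ → Fin d → ℝ) (n : ℤ) (z : Fin d → ℤ) : HSpace d ≃ᵢ HSpace d :=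
  stdIso 1 1 (fun i => a n i + 2 ^ (n + 1) * z i + 2 ^ n) n

theorem cellIso_image (n : ℤ) (z : Fin d → ℤ) : cellIso a n z '' prototile d = cell a n z := rfl

theorem cellIso_x (n : ℤ) (z : Fin d → ℤ) (q : HSpace d) (i : Fin d) :
    (cellIso a n z q).x i = a n i + 2 ^ n * (2 * z i + 1 + q.x i) := by
  simp [cellIso, two_zpow_succ]; ring

theorem cellIso_t (n : ℤ) (z : Fin d → ℤ) (q : HSpace d) : (cellIso a n z q).t = 2 ^ n * q.t := rfl

theorem cellIso_mem_cell {n : ℤ} {z z' : Fin d → ℤ} {q : HSpace d} (hq : q ∈ prototile d) :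
    cellIso a n z q ∈ cell a n z' ↔ ∀ i, 2 * (z' i : ℝ) ≤ 2 * z i + 1 + q.x i ∧
      2 * (z i : ℝ) + 1 + q.x i ≤ 2 * z' i + 2 := by
  have h2 : (0 : ℝ) < 2 ^ n := by positivity
  rw [mem_cell, cellIso_t, two_zpow_succ, mul_comm (2 : ℝ) (2 ^ n)]
  have h3 : 2 ^ n ≤ 2 ^ n * q.t ∧ 2 ^ n * q.t ≤ 2 ^ n * 2 :=
    ⟨le_mul_of_one_le_right h2.le hq.2.1, mul_le_mul_of_nonneg_left hq.2.2 h2.le⟩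
  simp only [h3, and_true, cellIso_x]
  refine forall_congr' fun i => and_congr ?_ ?_
  · rw [add_le_add_iff_left, mul_assoc, mul_le_mul_iff_right₀ h2]
  · rw [add_le_add_iff_left, two_zpow_succ, mul_comm (2 : ℝ) (2 ^ n), mul_assoc,
      mul_le_mul_iff_right₀ h2, mul_add, mul_one]

theorem isFace_inter_same {n : ℤ} {z z' : Fin d → ℤ} (hz : z ≠ z')
    (hne : (cell a n z ∩ cell a n z').Nonempty) : IsFace (cell a n z) (cell a n z ∩ cell a n z') :=
        by
  obtain ⟨p, hp, hp'⟩ := hne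
  rw [← cellIso_image] at hp
  obtain ⟨q, hq, rfl⟩ := hp
  rw [cellIso_mem_cell hq] at hp'
  have hk : ∀ i, ∃ ε : ℤˣ, z i ≠ z' i → z' i = z i + ε := by
    intro i
    obtain ⟨h1, h2⟩ := hp' i
    have h3 := abs_le.1 (hq.1 i)
    have h4 : z' i ≤ z i + 1 := by
      have : (z' i : ℝ) ≤ z i + 1 := by linarith
      exact_mod_cast this
    have h5 : z i ≤ z' i + 1 := by
      have : (z i : ℝ) ≤ z' i + 1 := by linarith
      exact_mod_cast this
    -- Where the indices agree the sign is an arbitrary `-1`, which is not used.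
    rcases lt_or_ge (z i) (z' i) with h6 | h6
    · exact ⟨1, fun _ => by push_cast; omega⟩
    · exact ⟨-1, fun _ => by push_cast; omega⟩
  choose ε hε using hk
  refine ⟨cellIso a n z, rfl, _, isProtoFace_aside (I := {i | z i ≠ z' i}) ?_ ε,
    image_sep_eq_inter fun q hq => ?_⟩
  · by_contra hcon
    refine hz (funext fun i => ?_)
    by_contra h
    exact hcon ⟨i, h⟩
  · rw [cellIso_mem_cell hq]
    refine forall_congr' fun i => ?_
    have h3 := abs_le.1 (hq.1 i)
    by_cases hi : z i = z' i
    · simp only [Set.mem_ofPred_eq, hi]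
      refine iff_of_true ⟨by linarith, by linarith⟩ fun h => absurd rfl h
    · have h4 := hε i hi
      have h5 : (z' i : ℝ) = z i + ((ε i : ℤ) : ℝ) := by exact_mod_cast h4
      simp only [Set.mem_ofPred_eq, ne_eq, hi, not_false_eq_true, forall_const, h5]
      rcases Int.units_eq_one_or (ε i) with h6 | h6 <;> rw [h6] <;> push_cast
      · exact ⟨fun h => by linarith, fun h => ⟨by linarith, by linarith⟩⟩
      · exact ⟨fun h => by linarith, fun h => ⟨by linarith, by linarith⟩⟩

/-- The position of the tile `cell a n z` relative to the tile `cell a (n + 1) w` in the direction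
of the `i`-th coordinate is given by an integer `k i`, which is `0` or `-1` if one is above the
other. -/
theorem exists_position (ha : Compatible a) (n : ℤ) (z w : Fin d → ℤ) :
    ∃ k : Fin d → ℤ, ∀ i, a (n + 1) i + 2 ^ (n + 1 + 1) * w i =
      a n i + 2 ^ (n + 1) * (z i + k i : ℝ) := by
  choose m hm using ha
  refine ⟨fun i => m n i + 2 * w i - z i, fun i => ?_⟩
  rw [hm, two_zpow_succ (n + 1)]
  push_cast; ring

variable {n : ℤ} {z w k : Fin d → ℤ}

theorem cellIso_mem_above
    (hk : ∀ i, a (n + 1) i + 2 ^ (n + 1 + 1) * w i = a n i + 2 ^ (n + 1) * (z i + k i : ℝ))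
    {q : HSpace d} (hq : q ∈ prototile d) :
    cellIso a n z q ∈ cell a (n + 1) w ↔ q.t = 2 ∧ ∀ i, 2 * (k i : ℝ) ≤ 1 + q.x i ∧
      1 + q.x i ≤ 2 * k i + 4 := by
  have h2 : (0 : ℝ) < 2 ^ n := by positivity
  rw [mem_cell, cellIso_t, and_comm]
  have ht := hq.2.2
  refine and_congr ?_ (forall_congr' fun i => ?_)
  · rw [two_zpow_succ (n + 1), two_zpow_succ]
    constructor
    · rintro ⟨h, _⟩
      have : 0 ≤ 2 ^ n * (q.t - 2) := by linarith
      have := nonneg_of_mul_nonneg_right this h2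
      linarith
    · intro h
      rw [h]
      constructor <;> linarith
  · have h4 := hk i
    rw [cellIso_x]
    have e1 : a (n + 1) i + 2 ^ (n + 1 + 1) * (w i : ℝ) = a n i + 2 ^ n * (2 * z i + 2 * k i) := by
      rw [h4, two_zpow_succ]; ring
    have e2 : a (n + 1) i + 2 ^ (n + 1 + 1) * ((w i : ℝ) + 1) =
        a n i + 2 ^ n * (2 * z i + (2 * k i + 4)) := by
      rw [mul_add, ← add_assoc, h4, two_zpow_succ (n + 1), two_zpow_succ]; ring
    rw [e1, e2, add_le_add_iff_left, add_le_add_iff_left, mul_le_mul_iff_right₀ h2,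
      mul_le_mul_iff_right₀ h2, add_assoc, add_le_add_iff_left, add_le_add_iff_left]

theorem cellIso_mem_below
    (hk : ∀ i, a (n + 1) i + 2 ^ (n + 1 + 1) * w i = a n i + 2 ^ (n + 1) * (z i + k i : ℝ))
    {q : HSpace d} (hq : q ∈ prototile d) :
    cellIso a (n + 1) w q ∈ cell a n z ↔ q.t = 1 ∧ ∀ i, 0 ≤ k i + 1 + q.x i ∧
      k i + 1 + q.x i ≤ 1 := by
  have h2 : (0 : ℝ) < 2 ^ (n + 1) := by positivity
  rw [mem_cell, cellIso_t, and_comm]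
  have ht := hq.2.1
  refine and_congr ?_ (forall_congr' fun i => ?_)
  · constructor
    · rintro ⟨_, h⟩
      have : 0 ≤ 2 ^ (n + 1) * (1 - q.t) := by linarith
      have := nonneg_of_mul_nonneg_right this h2
      linarith
    · intro h
      rw [h, two_zpow_succ]
      have : (0 : ℝ) < 2 ^ n := by positivity
      constructor <;> linarith
  · have h4 := hk i
    rw [two_zpow_succ (n + 1)] at h4
    have e1 : (cellIso a (n + 1) w q).x i = a n i + 2 ^ (n + 1) * (z i + (k i + 1 + q.x i)) := by
      rw [cellIso_x]; linear_combination h4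
    rw [e1, add_le_add_iff_left, add_le_add_iff_left, mul_le_mul_iff_right₀ h2,
      mul_le_mul_iff_right₀ h2, add_le_add_iff_left]
    simp

/-- The intersection of tiles in consecutive layers in terms of both tiles. -/
theorem inter_above
    (hk : ∀ i, a (n + 1) i + 2 ^ (n + 1 + 1) * w i = a n i + 2 ^ (n + 1) * (z i + k i : ℝ))
    (hk1 : ∀ i, -2 ≤ k i ∧ k i ≤ 1) :
    ∃ σ : Fin d → ℤˣ,
      cellIso a n z '' {q ∈ prototile d | q.t = 2 ∧
        ∀ i ∈ {i | k i = 1 ∨ k i = -2}, q.x i = (((-σ i : ℤˣ) : ℤ) : ℝ)} =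
          cell a n z ∩ cell a (n + 1) w ∧
      cellIso a (n + 1) w '' {q ∈ prototile d | q.t = 1 ∧ (∀ i, 0 ≤ q.x i * ((σ i : ℤ) : ℝ)) ∧
        ∀ i ∈ {i | k i = 1 ∨ k i = -2}, q.x i = ((σ i : ℤ) : ℝ)} =
          cell a (n + 1) w ∩ cell a n z := by
  -- For `k i = 0` or `k i = -1` the lower tile occupies the left or right half of the upper one in
  -- coordinate `i`; for `k i = 1` or `k i = -2` the two only touch, on the left or right side of
  -- the upper one. The sign records that half or side.
  refine ⟨fun i => if 0 ≤ k i then -1 else 1, image_sep_eq_inter fun q hq => ?_,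
    image_sep_eq_inter fun q hq => ?_⟩
  · rw [cellIso_mem_above hk hq]
    refine and_congr_right fun _ => forall_congr' fun i => ?_
    have h3 := abs_le.1 (hq.1 i)
    obtain ⟨h4, h5⟩ := hk1 i
    have h6 : k i = -2 ∨ k i = -1 ∨ k i = 0 ∨ k i = 1 := by omega
    rcases h6 with h6 | h6 | h6 | h6 <;> simp [h6] <;> (try constructor) <;> intros <;>
      (try constructor) <;> linarith
  · rw [cellIso_mem_below hk hq]
    refine and_congr_right fun _ => ?_
    rw [← forall_and]
    refine forall_congr' fun i => ?_
    have h3 := abs_le.1 (hq.1 i)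
    obtain ⟨h4, h5⟩ := hk1 i
    have h6 : k i = -2 ∨ k i = -1 ∨ k i = 0 ∨ k i = 1 := by omega
    rcases h6 with h6 | h6 | h6 | h6 <;> simp [h6] <;> (try constructor) <;> intros <;>
      (try constructor) <;> linarith

theorem isFace_inter_above (ha : Compatible a) (n : ℤ) (z w : Fin d → ℤ)
    (hne : (cell a n z ∩ cell a (n + 1) w).Nonempty) :
    IsFace (cell a n z) (cell a n z ∩ cell a (n + 1) w) ∧
      IsFace (cell a (n + 1) w) (cell a n z ∩ cell a (n + 1) w) := by
  obtain ⟨k, hk⟩ := exists_position ha n z w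
  obtain ⟨p, hp, hp'⟩ := hne
  rw [← cellIso_image] at hp
  obtain ⟨q, hq, rfl⟩ := hp
  rw [cellIso_mem_above hk hq] at hp'
  obtain ⟨σ, h1, h2⟩ := inter_above hk fun i => by
    obtain ⟨h1, h2⟩ := hp'.2 i
    have h3 := abs_le.1 (hq.1 i)
    have h4 : (-2 : ℝ) ≤ k i := by linarith
    have h5 : (k i : ℝ) ≤ 1 := by linarith
    exact ⟨by exact_mod_cast h4, by exact_mod_cast h5⟩
  refine ⟨⟨cellIso a n z, rfl, _, isProtoFace_lower _ _, h1⟩,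
    ⟨cellIso a (n + 1) w, rfl, _, isProtoFace_upper _ _, h2.trans (Set.inter_comm _ _)⟩⟩

theorem exists_of_image_prototile (hd : 0 < d) {φ : HSpace d ≃ᵢ HSpace d} {n : ℤ} {z : Fin d → ℤ}
    (h : φ '' prototile d = cell a n z) :
    ∃ π s, φ = (stdIso π s 0 0).trans (cellIso a n z) := by
  obtain ⟨π, s, hs⟩ := eq_stdIso_of_prototile hd (φ := φ.trans (cellIso a n z).symm) (by
    rw [image_trans, h, ← cellIso_image, image_symm_image])
  refine ⟨π, s, ?_⟩
  rw [← hs]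
  ext1 p
  simp

/-- Two isometries of the prototile onto one cell differ by a signed permutation, which preserves
heights; so the a-end of a c-edge is its higher end for every presentation of the tile. -/
theorem level_of_image_prototile (hd : 0 < d) {φ : HSpace d ≃ᵢ HSpace d}
    (h : φ '' prototile d ∈ gridTiling a) : ∃ n : ℤ, ∀ q, (φ q).t = 2 ^ n * q.t := by
  obtain ⟨n, z, hz⟩ := h
  obtain ⟨π, s, rfl⟩ := exists_of_image_prototile hd hz
  exact ⟨n, fun q => by simp [cellIso_t]⟩

theorem image_facetC_inter {φ : HSpace d ≃ᵢ HSpace d} {n : ℤ} (h : ∀ q, (φ q).t = 2 ^ n * q.t)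
    (i : Fin d) (ε : ℤˣ) :
    φ '' (facetC i ε ∩ facetA d) = {p ∈ φ '' facetC i ε | p.t = 2 ^ (n + 1)} := by
  ext p
  obtain ⟨q, rfl⟩ := φ.surjective p
  rw [φ.injective.mem_set_image, Set.mem_sep_iff, φ.injective.mem_set_image, h, two_zpow_succ,
    mul_comm, mul_left_inj' (by positivity)]
  exact and_congr_right fun hq => ⟨fun h => h.2, fun h => ⟨hq.1, h⟩⟩

theorem level_le {φ ψ : HSpace d ≃ᵢ HSpace d} {n m : ℤ} (h : ∀ q, (φ q).t = 2 ^ n * q.t)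
    (h' : ∀ q, (ψ q).t = 2 ^ m * q.t) {i j : Fin d} {ε δ : ℤˣ}
    (hC : φ '' facetC i ε = ψ '' facetC j δ) : n ≤ m := by
  let q : HSpace d := pt (Pi.single i ((ε : ℤ) : ℝ)) 2 two_pos
  have hq : q ∈ facetC i ε :=
    ⟨⟨fun j => abs_single_le (abs_unit ε).le, by simp [q], by simp [q]⟩, by simp [q]⟩
  obtain ⟨r, hr, hr'⟩ := hC ▸ Set.mem_image_of_mem φ hq
  have h1 := h q
  rw [← hr', h'] at h1
  have h2 : r.t ≤ 2 := hr.1.2.2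
  have h3 : (2 : ℝ) ^ m * r.t ≤ 2 ^ m * 2 := mul_le_mul_of_nonneg_left h2 (by positivity)
  rw [h1] at h3
  exact (zpow_le_zpow_iff_right₀ one_lt_two).1 (le_of_mul_le_mul_right h3 two_pos)

theorem eq_of_mem_cell_of_lt {n n' : ℤ} (hn : n < n') {z z' : Fin d → ℤ} {p : HSpace d}
    (hp : p ∈ cell a n z) (hp' : p ∈ cell a n' z') : n' = n + 1 ∧ p.t = 2 ^ (n + 1) := by
  have h1 := (mem_cell.1 hp).2.2
  have h2 := (mem_cell.1 hp').2.1
  have h3 : n' ≤ n + 1 := (zpow_le_zpow_iff_right₀ (one_lt_two (α := ℝ))).1 (h2.trans h1)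
  obtain rfl : n' = n + 1 := by omega
  exact ⟨rfl, le_antisymm h1 h2⟩

theorem gridTiling_faceToFace (ha : Compatible a) {n n' : ℤ} {z z' : Fin d → ℤ}
    (hne : cell a n z ≠ cell a n' z') (hn : (cell a n z ∩ cell a n' z').Nonempty) :
    IsFace (cell a n z) (cell a n z ∩ cell a n' z') ∧
      IsFace (cell a n' z') (cell a n z ∩ cell a n' z') := by
  obtain ⟨p, hp, hp'⟩ := id hn
  rcases lt_trichotomy n n' with h | rfl | h
  · obtain ⟨rfl, _⟩ := eq_of_mem_cell_of_lt h hp hp'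
    exact isFace_inter_above ha n z z' hn
  · have hz : z ≠ z' := fun h => hne (by rw [h])
    refine ⟨isFace_inter_same hz hn, ?_⟩
    rw [Set.inter_comm] at hn ⊢
    exact isFace_inter_same hz.symm hn
  · obtain ⟨rfl, _⟩ := eq_of_mem_cell_of_lt h hp' hp
    rw [Set.inter_comm] at hn ⊢
    exact (isFace_inter_above ha n' z' z hn).symm

theorem cell_inter_subset_of_lt {n : ℤ} {z z' : Fin d → ℤ} {i : Fin d} (h : z i < z' i) :
    cell a n z ∩ cell a n z' ⊆ {p | p.x i = a n i + 2 ^ (n + 1) * z' i} := by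
  rintro p ⟨hp, hp'⟩
  have h1 := ((mem_cell.1 hp).1 i).2
  have h2 := ((mem_cell.1 hp').1 i).1
  have h3 : (z i : ℝ) + 1 ≤ z' i := by exact_mod_cast h
  have h4 : (2 : ℝ) ^ (n + 1) * (z i + 1) ≤ 2 ^ (n + 1) * z' i :=
    mul_le_mul_of_nonneg_left h3 (by positivity)
  exact le_antisymm (by linarith) h2

theorem interior_cell_inter {n n' : ℤ} {z z' : Fin d → ℤ} (hne : cell a n z ≠ cell a n' z') :
    Disjoint (interior (cell a n z)) (interior (cell a n' z')) := by
  rw [Set.disjoint_iff_inter_eq_empty, ← interior_inter]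
  rcases lt_trichotomy n n' with h | rfl | h
  · exact Set.subset_eq_empty (interior_mono fun p hp => (eq_of_mem_cell_of_lt h hp.1 hp.2).2)
      (interior_level_t _)
  · have : ∃ i, z i ≠ z' i := by
      by_contra hcon
      push Not at hcon
      exact hne (by rw [funext hcon])
    obtain ⟨i, hi⟩ := this
    rcases lt_or_gt_of_ne hi with h | h
    · exact Set.subset_eq_empty (interior_mono (cell_inter_subset_of_lt h)) (interior_level_x _ _)
    · rw [Set.inter_comm]
      exact Set.subset_eq_empty (interior_mono (cell_inter_subset_of_lt h)) (interior_level_x _ _)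
  · exact Set.subset_eq_empty (interior_mono fun p hp => (eq_of_mem_cell_of_lt h hp.2 hp.1).2)
      (interior_level_t _)

theorem isBTiling_gridTiling (hd : 0 < d) (ha : Compatible a) : IsBTiling (gridTiling a) where
  congruent := by
    rintro _ ⟨n, z, rfl⟩
    exact ⟨cellIso a n z, rfl⟩
  cover := Set.eq_univ_of_forall fun p => by
    obtain ⟨n, z, h⟩ := exists_cell a p
    exact ⟨_, cell_mem n z, h⟩
  nonoverlap := by
    rintro _ ⟨n, z, rfl⟩ _ ⟨n', z', rfl⟩ hne
    exact interior_cell_inter hne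
  faceToFace := by
    rintro _ ⟨n, z, rfl⟩ _ ⟨n', z', rfl⟩ hne hn
    exact gridTiling_faceToFace ha hne hn
  oriented := by
    intro _ φ ψ hφ hψ i ε j δ hC
    -- A common c-facet forces equal layers, and then its part on the a-facet is the part of maximal
    -- height for both tiles.
    obtain ⟨n, hn⟩ := level_of_image_prototile hd hφ
    obtain ⟨m, hm⟩ := level_of_image_prototile hd hψ
    obtain rfl : n = m := le_antisymm (level_le hn hm hC) (level_le hm hn hC.symm)
    rw [image_facetC_inter hn, image_facetC_inter hm, hC]

end

/-! ### Walls and pools of a grid tiling -/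

theorem mem_pool {𝒯 : Set (Set (HSpace d))} {T T' : Set (HSpace d)} :
    T' ∈ pool 𝒯 T ↔ (horosphericGraph 𝒯).Reachable T T' := by
  classical
  constructor
  · rintro ⟨w, _⟩
    exact ⟨w⟩
  · rintro ⟨w⟩
    exact ⟨w.toPath, w.toPath.2⟩

theorem unit_ne_zero (s : ℤˣ) : ((s : ℤ) : ℝ) ≠ 0 := by
  intro h
  have := unit_sq s
  rw [h] at this
  norm_num at this

/-- The hyperplane `x i = p` is a union of facets in all layers. -/
def IsWall (a : ℤ → Fin d → ℝ) (i : Fin d) (p : ℝ) : Prop :=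
  ∀ n, ∃ m : ℤ, p = a n i + 2 ^ (n + 1) * m

/-- The product of closed half-lines, for the coordinates in `S`, and lines. -/
def orthant (S : Finset (Fin d)) (p : Fin d → ℝ) (σ : Fin d → ℤˣ) : Set (HSpace d) :=
  {q | ∀ i ∈ S, 0 ≤ ((σ i : ℤ) : ℝ) * (q.x i - p i)}

theorem exists_lt_two_zpow (r : ℝ) : ∃ n₀ : ℤ, ∀ n, n₀ ≤ n → r < 2 ^ n := by
  obtain ⟨m, hm⟩ := pow_unbounded_of_one_lt r one_lt_two
  refine ⟨m, fun n hn => hm.trans_le ?_⟩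
  rw [← zpow_natCast]
  exact zpow_le_zpow_right₀ one_le_two hn

theorem eq_of_grid {b w x y : ℝ} {m m' : ℤ} (hw : 0 < w) (hx : x = b + w * m)
    (hy : y = b + w * m') (h : |x - y| < w) : x = y := by
  have h1 : |((m - m' : ℤ) : ℝ)| < 1 := by
    have : x - y = w * ((m - m' : ℤ) : ℝ) := by rw [hx, hy]; push_cast; ring
    rw [this, abs_mul, abs_of_pos hw] at h
    by_contra hcon
    push Not at hcon
    nlinarith
  have h2 : |m - m'| < 1 := by exact_mod_cast h1
  have h3 : m = m' := by
    have := Int.abs_lt_one_iff.1 h2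
    omega
  rw [hx, hy, h3]

section
variable {a : ℤ → Fin d → ℝ}

/-- On a high enough level the mesh exceeds the distance of the two walls, both of which are grid
points. -/
theorem IsWall.unique {i : Fin d} {p q : ℝ} (hp : IsWall a i p) (hq : IsWall a i q) : p = q := by
  obtain ⟨n, hn⟩ := exists_lt_two_zpow |p - q|
  obtain ⟨m, hm⟩ := hp n
  obtain ⟨m', hm'⟩ := hq n
  exact eq_of_grid (by positivity) hm hm' (hn (n + 1) (by omega))

theorem Compatible.grid_mono (ha : Compatible a) {i : Fin d} {x : ℝ} {n N : ℤ} (h : n ≤ N)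
    (hx : ∃ m : ℤ, x = a N i + 2 ^ (N + 1) * m) : ∃ m : ℤ, x = a n i + 2 ^ (n + 1) * m := by
  induction N, h using Int.leInduction with
  | base => exact hx
  | succ N _ ih =>
    apply ih
    obtain ⟨m, rfl⟩ := hx
    obtain ⟨b, hb⟩ := ha N i
    refine ⟨b + 2 * m, ?_⟩
    rw [hb, two_zpow_succ (N + 1)]
    push_cast; ring

/-- The index of the half-open interval of length `2 ^ (n + 1)` that contains `x i`. -/
def floorIdx (a : ℤ → Fin d → ℝ) (n : ℤ) (x : Fin d → ℝ) (i : Fin d) : ℤ :=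
  ⌊(x i - a n i) / 2 ^ (n + 1)⌋

theorem floorIdx_spec (n : ℤ) (x : Fin d → ℝ) (i : Fin d) :
    a n i + 2 ^ (n + 1) * (floorIdx a n x i : ℝ) ≤ x i ∧
      x i < a n i + 2 ^ (n + 1) * ((floorIdx a n x i : ℝ) + 1) :=
  floor_spec _ _ (by positivity)

theorem lt_of_two_zpow_mul_lt {n : ℤ} {b : ℝ} {m m' : ℤ}
    (h : b + 2 ^ n * (m : ℝ) < b + 2 ^ n * m') : m < m' := by
  have h1 : (2 : ℝ) ^ n * m < 2 ^ n * m' := by linarith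
  exact_mod_cast lt_of_mul_lt_mul_left h1 (by positivity)

theorem floorIdx_eq {n : ℤ} {x : Fin d → ℝ} {i : Fin d} {z : ℤ}
    (h1 : a n i + 2 ^ (n + 1) * (z : ℝ) ≤ x i) (h2 : x i < a n i + 2 ^ (n + 1) * ((z : ℝ) + 1)) :
    floorIdx a n x i = z := by
  obtain ⟨h3, h4⟩ := floorIdx_spec (a := a) n x i
  have h5 : floorIdx a n x i < z + 1 := lt_of_two_zpow_mul_lt (n := n + 1) (b := a n i) (by
    push_cast; linarith)
  have h6 : z < floorIdx a n x i + 1 := lt_of_two_zpow_mul_lt (n := n + 1) (b := a n i) (by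
    push_cast; linarith)
  omega

theorem floorIdx_position (ha : Compatible a) (n : ℤ) (x : Fin d → ℝ) :
    ∃ k : Fin d → ℤ, (∀ i, a (n + 1) i + 2 ^ (n + 1 + 1) * (floorIdx a (n + 1) x i : ℝ) =
      a n i + 2 ^ (n + 1) * (floorIdx a n x i + k i : ℝ)) ∧ ∀ i, k i = 0 ∨ k i = -1 := by
  obtain ⟨k, hk⟩ := exists_position ha n (floorIdx a n x) (floorIdx a (n + 1) x)
  refine ⟨k, hk, fun i => ?_⟩
  obtain ⟨h1, h2⟩ := floorIdx_spec (a := a) n x i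
  obtain ⟨h3, h4⟩ := floorIdx_spec (a := a) (n + 1) x i
  have h5 := hk i
  have h6 : floorIdx a n x i + k i < floorIdx a n x i + 1 :=
    lt_of_two_zpow_mul_lt (n := n + 1) (b := a n i) (by push_cast; linarith)
  have h7 : floorIdx a n x i < floorIdx a n x i + k i + 2 :=
    lt_of_two_zpow_mul_lt (n := n + 1) (b := a n i) (by
      rw [two_zpow_succ (n + 1)] at h4 h5
      push_cast; linarith)
  omega

theorem floorIdx_succ_eq (ha : Compatible a) {n : ℤ} {x y : Fin d → ℝ} {i : Fin d}
    (h : floorIdx a n x i = floorIdx a n y i) :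
    floorIdx a (n + 1) x i = floorIdx a (n + 1) y i := by
  obtain ⟨k, hk, hk1⟩ := floorIdx_position ha n x
  obtain ⟨h3, h4⟩ := floorIdx_spec (a := a) n y i
  refine (floorIdx_eq ?_ ?_).symm
  · rw [hk, h]
    have : (k i : ℝ) ≤ 0 := by rcases hk1 i with h | h <;> simp [h]
    have : (2 : ℝ) ^ (n + 1) * k i ≤ 0 := mul_nonpos_of_nonneg_of_nonpos (by positivity) this
    linarith
  · rw [mul_add, ← add_assoc, hk, h, two_zpow_succ (n + 1)]
    have : (-1 : ℝ) ≤ k i := by rcases hk1 i with h | h <;> simp [h]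
    have : (2 : ℝ) ^ (n + 1) * (-1) ≤ 2 ^ (n + 1) * k i :=
      mul_le_mul_of_nonneg_left this (by positivity)
    linarith

/-- If the intervals never agree and `x i < y i`, then the left end `e n` of the interval of `y i`
lies in `(x i, y i]` for every `n`. As soon as the mesh exceeds `y i - x i`, nestedness makes `e n`
constant, and this constant is a wall between the two numbers. Equality persists on higher levels by
`floorIdx_succ_eq`. -/
theorem eventually_floorIdx_eq (ha : Compatible a) {x y : Fin d → ℝ} {i : Fin d}
    (h : ∀ p, IsWall a i p → ((p ≤ x i ↔ p ≤ y i))) :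
    ∀ᶠ n in atTop, floorIdx a n x i = floorIdx a n y i := by
  suffices hs : ∃ n, floorIdx a n x i = floorIdx a n y i by
    obtain ⟨n, hn⟩ := hs
    refine eventually_atTop.2 ⟨n, fun N hN => ?_⟩
    induction N, hN using Int.leInduction with
    | base => exact hn
    | succ N _ ih => exact floorIdx_succ_eq ha ih
  by_contra! hcon
  wlog hxy : x i < y i generalizing x y
  · rcases lt_or_eq_of_le (not_lt.1 hxy) with h1 | h1
    · exact this (x := y) (y := x) (fun p hp => (h p hp).symm) (fun n => (hcon n).symm) h1
    · refine hcon 0 ?_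
      rw [floorIdx, floorIdx, h1]
  let e : ℤ → ℝ := fun n => a n i + 2 ^ (n + 1) * (floorIdx a n y i : ℝ)
  have he : ∀ n, x i < e n ∧ e n ≤ y i := by
    intro n
    obtain ⟨h1, h2⟩ := floorIdx_spec (a := a) n x i
    obtain ⟨h3, h4⟩ := floorIdx_spec (a := a) n y i
    refine ⟨?_, h3⟩
    have h5 : floorIdx a n x i < floorIdx a n y i + 1 :=
      lt_of_two_zpow_mul_lt (n := n + 1) (b := a n i) (by push_cast; linarith)
    have h6 : floorIdx a n x i + 1 ≤ floorIdx a n y i := by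
      have := hcon n
      omega
    have h7 : (floorIdx a n x i : ℝ) + 1 ≤ floorIdx a n y i := by exact_mod_cast h6
    have h8 : (2 : ℝ) ^ (n + 1) * (floorIdx a n x i + 1) ≤ 2 ^ (n + 1) * floorIdx a n y i :=
      mul_le_mul_of_nonneg_left h7 (by positivity)
    exact h2.trans_le (by simp only [e]; linarith)
  obtain ⟨n₀, hn₀⟩ := exists_lt_two_zpow (y i - x i)
  have hconst : ∀ n, n₀ ≤ n → e n = e n₀ := by
    intro n hn
    obtain ⟨m, hm⟩ := ha.grid_mono hn ⟨floorIdx a n y i, (rfl : e n = _)⟩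
    refine eq_of_grid (by positivity) hm (rfl : e n₀ = _) ?_
    have := hn₀ (n₀ + 1) (by omega)
    rw [abs_lt]
    constructor <;> linarith [he n, he n₀]
  have hwall : IsWall a i (e n₀) := by
    intro n
    rcases le_total n₀ n with hn | hn
    · exact ⟨_, (hconst n hn).symm⟩
    · exact ha.grid_mono hn ⟨_, rfl⟩
  have h1 := (h _ hwall).2 (he n₀).2
  linarith [(he n₀).1]

theorem cell_adj (ha : Compatible a) (n : ℤ) (x : Fin d → ℝ) :
    (horosphericGraph (gridTiling a)).Adj (cell a n (floorIdx a n x))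
      (cell a (n + 1) (floorIdx a (n + 1) x)) := by
  obtain ⟨k, hk, hk1⟩ := floorIdx_position ha n x
  refine ⟨cell_mem _ _, cell_mem _ _, fun h => ?_, ?_⟩
  · have h1 : cellIso a n (floorIdx a n x) (pt (fun _ => 0) 1 one_pos) ∈
        cell a (n + 1) (floorIdx a (n + 1) x) := by
      rw [← h, ← cellIso_image]
      exact Set.mem_image_of_mem _ ⟨by simp, by simp, by simp⟩
    have h2 := (mem_cell.1 h1).2.1
    rw [cellIso_t, two_zpow_succ, pt_t] at h2
    have : (0 : ℝ) < 2 ^ n := by positivity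
    linarith
  -- With `k i` in `{0, -1}` no coordinate merely touches, so the intersection is the full a-facet
  -- of one cell and a full b-facet of the other.
  · obtain ⟨σ, h1, h2⟩ := inter_above hk fun i => by rcases hk1 i with h | h <;> simp [h]
    have hI : {i | k i = 1 ∨ k i = -2} = ∅ := by
      refine Set.eq_empty_of_forall_notMem fun i hi => ?_
      rcases hk1 i with h | h <;> simp [h] at hi
    simp only [hI, Set.mem_empty_iff_false, false_implies, implies_true, and_true] at h1 h2
    refine ⟨_, ⟨cellIso a n (floorIdx a n x), rfl, Or.inl h1⟩,
      ⟨cellIso a (n + 1) (floorIdx a (n + 1) x), rfl, Or.inr ⟨σ, ?_⟩⟩⟩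
    rw [Set.inter_comm]
    exact h2

theorem cell_reachable (ha : Compatible a) {n N : ℤ} (h : n ≤ N) (x : Fin d → ℝ) :
    (horosphericGraph (gridTiling a)).Reachable (cell a n (floorIdx a n x))
      (cell a N (floorIdx a N x)) := by
  induction N, h using Int.leInduction with
  | base => exact SimpleGraph.Reachable.refl _
  | succ N _ ih => exact ih.trans (cell_adj ha N x).reachable

/-- The lower corner of a cell. -/
def corner (a : ℤ → Fin d → ℝ) (n : ℤ) (z : Fin d → ℤ) (i : Fin d) : ℝ := a n i + 2 ^ (n + 1) * z i

/-- With half-open intervals this corner belongs to its own cell, even when it lies on a wall, so it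
can represent the tile in the ascent through the layers. -/
theorem floorIdx_corner (n : ℤ) (z : Fin d → ℤ) : floorIdx a n (corner a n z) = z := by
  funext i
  refine floorIdx_eq le_rfl ?_
  have : (0 : ℝ) < 2 ^ (n + 1) := by positivity
  rw [corner]
  linarith

/-- The two sides of a wall. -/
theorem wall_le_corner {S : Finset (Fin d)} {p : Fin d → ℝ} {σ : Fin d → ℤˣ} {n : ℤ}
    {z : Fin d → ℤ} (h : cell a n z ⊆ orthant S p σ) {i : Fin d} (hi : i ∈ S) :
    p i ≤ corner a n z i ↔ σ i = 1 := by
  have h0 : (0 : ℝ) < 2 ^ n := by positivity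
  have hmem : ∀ ε : ℤˣ, cellIso a n z (pt (fun _ => ((ε : ℤ) : ℝ)) 1 one_pos) ∈ cell a n z :=
    fun ε => Set.mem_image_of_mem _ ⟨fun j => (abs_unit ε).le, by simp, by simp⟩
  have h1 := h (hmem (-1)) i hi
  have h2 := h (hmem 1) i hi
  rw [cellIso_x, pt_x] at h1 h2
  rw [corner, two_zpow_succ]
  rcases Int.units_eq_one_or (σ i) with h3 | h3 <;> rw [h3] at h1 h2 ⊢ <;> push_cast at h1 h2
  · refine iff_of_true (by linarith) rfl
  · refine iff_of_false (by linarith) (by decide)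

variable {S : Finset (Fin d)} {p : Fin d → ℝ}

theorem exists_orthant (hS : ∀ i ∈ S, IsWall a i (p i)) (n : ℤ) (z : Fin d → ℤ) :
    ∃ σ, cell a n z ⊆ orthant S p σ := by
  refine ⟨fun i => if p i ≤ corner a n z i then 1 else -1, fun q hq i hi => ?_⟩
  obtain ⟨h1, h2⟩ := (mem_cell.1 hq).1 i
  obtain ⟨m, hm⟩ := hS i hi n
  beta_reduce
  split_ifs with h
  · rw [corner] at h
    push_cast; linarith
  · rw [not_le, corner, hm] at h
    have h3 : z i + 1 ≤ m := lt_of_two_zpow_mul_lt h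
    have h4 : (z i : ℝ) + 1 ≤ m := by exact_mod_cast h3
    have h5 : (2 : ℝ) ^ (n + 1) * (z i + 1) ≤ 2 ^ (n + 1) * m :=
      mul_le_mul_of_nonneg_left h4 (by positivity)
    push_cast; linarith

/-- No wall separates the representing corners, so the ascending chains of the two tiles meet in a
common ancestor. -/
theorem reachable_of_orthant (ha : Compatible a) (hS : ∀ i p', IsWall a i p' → i ∈ S ∧ p' = p i)
    {σ : Fin d → ℤˣ} {n n' : ℤ} {z z' : Fin d → ℤ} (h : cell a n z ⊆ orthant S p σ)
    (h' : cell a n' z' ⊆ orthant S p σ) :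
    (horosphericGraph (gridTiling a)).Reachable (cell a n z) (cell a n' z') := by
  have h1 : ∀ᶠ N in atTop, ∀ i, floorIdx a N (corner a n z) i = floorIdx a N (corner a n' z') i :=
      by
    refine eventually_all.2 fun i => eventually_floorIdx_eq ha fun p' hp' => ?_
    obtain ⟨hi, rfl⟩ := hS i p' hp'
    rw [wall_le_corner h hi, wall_le_corner h' hi]
  obtain ⟨N, hN, hNn, hNn'⟩ :=
      (h1.and ((eventually_ge_atTop n).and (eventually_ge_atTop n'))).exists
  have h2 := cell_reachable ha hNn (corner a n z)
  have h3 := cell_reachable ha hNn' (corner a n' z')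
  rw [floorIdx_corner] at h2 h3
  rw [funext hN] at h2
  exact h2.trans h3.symm

theorem orthant_congr {σ σ' : Fin d → ℤˣ} (h : ∀ i ∈ S, σ i = σ' i) :
    orthant S p σ = orthant S p σ' := by
  ext q
  refine forall₂_congr fun i hi => ?_
  rw [h i hi]

/-- A horospheric facet of a cell is not contained in a wall. -/
theorem exists_ne_of_facet (hd : 0 < d) {T F : Set (HSpace d)} (hT : T ∈ gridTiling a)
    (h : IsHorosphericFacet T F) (i : Fin d) (c : ℝ) : ∃ q ∈ F, q.x i ≠ c := by
  obtain ⟨φ, hφ, hF⟩ := h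
  obtain ⟨n, z, rfl⟩ := hT
  obtain ⟨π, s, rfl⟩ := exists_of_image_prototile hd hφ
  have key : ∀ q q' : HSpace d, q.x (π i) ≠ q'.x (π i) →
      ((stdIso π s 0 0).trans (cellIso a n z) q).x i ≠ c ∨
      ((stdIso π s 0 0).trans (cellIso a n z) q').x i ≠ c := by
    intro q q' hq
    by_contra! hcon
    apply hq
    have h1 := hcon.1.trans hcon.2.symm
    have h2 : (2 : ℝ) ^ n ≠ 0 := by positivity
    simp only [IsometryEquiv.trans_apply, cellIso_x, stdIso_x, zpow_zero, one_mul, Pi.zero_apply,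
      add_zero] at h1
    have h3 := mul_left_cancel₀ h2 (add_left_cancel h1)
    have h4 := add_left_cancel h3
    linear_combination ((s i : ℤ) : ℝ) * h4 - (q.x (π i) - q'.x (π i)) * unit_sq (s i)
  rcases hF with rfl | ⟨σ, rfl⟩
  · rcases key (pt (fun _ => 1) 2 two_pos) (pt (fun _ => -1) 2 two_pos) (by norm_num) with h | h
    · exact ⟨_, Set.mem_image_of_mem _ (mem_facetA.2 ⟨by simp, rfl⟩), h⟩
    · exact ⟨_, Set.mem_image_of_mem _ (mem_facetA.2 ⟨by simp, rfl⟩), h⟩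
  · rcases key (pt (fun _ => 0) 1 one_pos) (pt (fun i => ((σ i : ℤ) : ℝ)) 1 one_pos)
      (unit_ne_zero (σ (π i))).symm with h | h
    · exact ⟨_, Set.mem_image_of_mem _ (mem_facetB.2 ⟨by simp, rfl⟩), h⟩
    · exact ⟨_, Set.mem_image_of_mem _ (mem_facetB.2
        ⟨fun i => ⟨(abs_unit _).le, by simp [unit_mul_self]⟩, rfl⟩), h⟩

theorem isHorosphericFacet_subset {T F : Set (HSpace d)} (h : IsHorosphericFacet T F) : F ⊆ T := by
  obtain ⟨φ, rfl, rfl | ⟨σ, rfl⟩⟩ := h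
  · exact Set.image_mono facetA_subset
  · exact Set.image_mono fun _ h => h.1

/-- For each wall the common facet has a point off it, and at this point the signs of the two tiles
must agree. -/
theorem subset_orthant_of_adj (hd : 0 < d) (hS : ∀ i ∈ S, IsWall a i (p i)) {σ : Fin d → ℤˣ}
    {T T' : Set (HSpace d)} (hadj : (horosphericGraph (gridTiling a)).Adj T T')
    (h : T ⊆ orthant S p σ) : T' ⊆ orthant S p σ := by
  obtain ⟨hT, hT', _, F, hF, hF'⟩ := hadj
  obtain ⟨n', z', rfl⟩ := id hT'
  obtain ⟨σ', hσ'⟩ := exists_orthant hS n' z'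
  rwa [orthant_congr (σ' := σ')]
  intro i hi
  obtain ⟨q, hq, hqp⟩ := exists_ne_of_facet hd hT hF i (p i)
  have h1 := h (isHorosphericFacet_subset hF hq) i hi
  have h2 := hσ' (isHorosphericFacet_subset hF' hq) i hi
  by_contra hne
  rw [unit_eq_neg_of_ne hne] at h2
  push_cast at h2
  rcases mul_eq_zero.1 (le_antisymm (by linarith) h1) with h3 | h3
  · have := unit_sq (σ i)
    rw [h3] at this
    norm_num at this
  · exact hqp (by linarith)

/-- The tiles in an orthant. -/
def tilesIn (a : ℤ → Fin d → ℝ) (S : Finset (Fin d)) (p : Fin d → ℝ) (σ : Fin d → ℤˣ) :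
    Set (Set (HSpace d)) := {T ∈ gridTiling a | T ⊆ orthant S p σ}

theorem pool_gridTiling (hd : 0 < d) (ha : Compatible a) (hS : ∀ i ∈ S, IsWall a i (p i))
    (hS' : ∀ i p', IsWall a i p' → i ∈ S ∧ p' = p i) {σ : Fin d → ℤˣ} {T : Set (HSpace d)}
    (hT : T ∈ tilesIn a S p σ) : pool (gridTiling a) T = tilesIn a S p σ := by
  ext T'
  rw [mem_pool]
  constructor
  · rintro ⟨w⟩
    induction w with
    | nil => exact hT
    | cons hadj w ih => exact ih ⟨hadj.2.1, subset_orthant_of_adj hd hS hadj hT.2⟩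
  · rintro ⟨⟨n', z', rfl⟩, h'⟩
    obtain ⟨⟨n, z, rfl⟩, h⟩ := hT
    exact reachable_of_orthant ha hS' h h'

theorem support_tilesIn (hS : ∀ i ∈ S, IsWall a i (p i)) (σ : Fin d → ℤˣ) :
    support (tilesIn a S p σ) = orthant S p σ := by
  refine Set.Subset.antisymm (Set.sUnion_subset fun T hT => hT.2) fun q hq => ?_
  obtain ⟨n, hn⟩ := exists_level q.pos
  have hz : ∀ i, ∃ z : ℤ, a n i + 2 ^ (n + 1) * (z : ℝ) ≤ q.x i ∧
      q.x i ≤ a n i + 2 ^ (n + 1) * ((z : ℝ) + 1) ∧ (i ∈ S → ∀ y : ℝ,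
        a n i + 2 ^ (n + 1) * (z : ℝ) ≤ y → y ≤ a n i + 2 ^ (n + 1) * ((z : ℝ) + 1) →
        0 ≤ ((σ i : ℤ) : ℝ) * (y - p i)) := by
    intro i
    have hw : (0 : ℝ) < 2 ^ (n + 1) := by positivity
    obtain ⟨h1, h2⟩ := floor_spec (a n i) (q.x i) hw
    by_cases hi : i ∈ S
    · obtain ⟨m, hm⟩ := hS i hi n
      have h3 := hq i hi
      rcases Int.units_eq_one_or (σ i) with h4 | h4
      · refine ⟨_, h1, h2.le, fun _ y hy _ => ?_⟩
        simp only [h4, hm, Units.val_one, Int.cast_one, one_mul] at h3 ⊢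
        have h5 : m < ⌊(q.x i - a n i) / 2 ^ (n + 1)⌋ + 1 :=
          lt_of_two_zpow_mul_lt (n := n + 1) (b := a n i) (by push_cast; linarith)
        have h6 : (m : ℝ) ≤ ⌊(q.x i - a n i) / 2 ^ (n + 1)⌋ := by
          exact_mod_cast (by omega : m ≤ ⌊(q.x i - a n i) / 2 ^ (n + 1)⌋)
        have h7 := mul_le_mul_of_nonneg_left h6 hw.le
        linarith
      · have h3' : q.x i ≤ a n i + 2 ^ (n + 1) * m := by
          simp only [h4, hm] at h3
          push_cast at h3
          linarith
        -- On the wall itself the floor selects the interval to the right, the wrong side for the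
        -- sign `-1`; the interval with index `m - 1` ends at the wall and replaces it.
        by_cases h8 : q.x i = a n i + 2 ^ (n + 1) * m
        · refine ⟨m - 1, by push_cast; linarith, by push_cast; linarith, fun _ y _ hy => ?_⟩
          simp only [h4, hm]
          push_cast at hy ⊢
          linarith
        · have h9 := lt_of_le_of_ne h3' h8
          refine ⟨_, h1, h2.le, fun _ y _ hy => ?_⟩
          have h5 : ⌊(q.x i - a n i) / 2 ^ (n + 1)⌋ < m :=
            lt_of_two_zpow_mul_lt (n := n + 1) (b := a n i) (by linarith)
          have h6 : (⌊(q.x i - a n i) / 2 ^ (n + 1)⌋ : ℝ) + 1 ≤ m := by exact_mod_cast h5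
          have h7 := mul_le_mul_of_nonneg_left h6 hw.le
          simp only [h4, hm]
          push_cast
          linarith
    · exact ⟨_, h1, h2.le, fun h => absurd h hi⟩
  choose z hz1 hz2 hz3 using hz
  refine ⟨cell a n z, ⟨cell_mem n z, fun r hr i hi => ?_⟩, mem_cell.2 ⟨fun i => ⟨hz1 i, hz2 i⟩, hn⟩⟩
  obtain ⟨h1, h2⟩ := (mem_cell.1 hr).1 i
  exact hz3 i hi _ h1 h2

theorem orthant_nonempty (S : Finset (Fin d)) (p : Fin d → ℝ) (σ : Fin d → ℤˣ) :
    (orthant S p σ).Nonempty := ⟨pt p 1 one_pos, fun i _ => by simp⟩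

theorem pools_gridTiling (hd : 0 < d) (ha : Compatible a) (hS : ∀ i ∈ S, IsWall a i (p i))
    (hS' : ∀ i p', IsWall a i p' → i ∈ S ∧ p' = p i) :
    pools (gridTiling a) = Set.range (tilesIn a S p) := by
  ext P
  constructor
  · rintro ⟨_, ⟨n, z, rfl⟩, rfl⟩
    obtain ⟨σ, hσ⟩ := exists_orthant hS n z
    exact ⟨σ, (pool_gridTiling hd ha hS hS' ⟨cell_mem n z, hσ⟩).symm⟩
  · rintro ⟨σ, rfl⟩
    obtain ⟨q, hq⟩ := orthant_nonempty S p σ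
    rw [← support_tilesIn hS] at hq
    obtain ⟨T, hT, _⟩ := hq
    exact ⟨T, hT.1, (pool_gridTiling hd ha hS hS' hT).symm⟩

theorem tilesIn_eq_iff (hS : ∀ i ∈ S, IsWall a i (p i)) {σ σ' : Fin d → ℤˣ} :
    tilesIn a S p σ = tilesIn a S p σ' ↔ ∀ i ∈ S, σ i = σ' i := by
  constructor
  · intro h i hi
    have h1 : pt (fun i => p i + ((σ i : ℤ) : ℝ)) 1 one_pos ∈ orthant S p σ := fun i _ => by
      simp [unit_mul_self]
    rw [← support_tilesIn hS, h, support_tilesIn hS] at h1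
    have h2 := h1 i hi
    by_contra hne
    rw [unit_eq_neg_of_ne hne] at h2
    simp only [pt_x, add_sub_cancel_left] at h2
    push_cast at h2
    linarith [unit_mul_self (σ i)]
  · intro h
    rw [tilesIn, tilesIn, orthant_congr h]

theorem encard_pools_gridTiling (hd : 0 < d) (ha : Compatible a) (hS : ∀ i ∈ S, IsWall a i (p i))
    (hS' : ∀ i p', IsWall a i p' → i ∈ S ∧ p' = p i) :
    (pools (gridTiling a)).encard = 2 ^ S.card := by
  classical
  -- Signs outside `S` have no effect, so the pools are counted by sign functions on `S`, extended
  -- by `1`.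
  have h1 : Set.range (tilesIn a S p) = Set.range fun τ : S → ℤˣ =>
      tilesIn a S p fun i => if h : i ∈ S then τ ⟨i, h⟩ else 1 := by
    ext P
    constructor
    · rintro ⟨σ, rfl⟩
      refine ⟨fun i => σ i, (tilesIn_eq_iff hS).2 fun i hi => ?_⟩
      simp [hi]
    · rintro ⟨τ, rfl⟩
      exact ⟨_, rfl⟩
  have h2 : Function.Injective fun τ : S → ℤˣ =>
      tilesIn a S p fun i => if h : i ∈ S then τ ⟨i, h⟩ else 1 := by
    intro τ τ' h
    funext ⟨i, hi⟩
    have := (tilesIn_eq_iff hS).1 h i hi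
    simpa [hi] using this
  rw [pools_gridTiling hd ha hS hS', h1, ← Set.image_univ, h2.encard_image, Set.encard_univ,
    ENat.card_eq_coe_fintype_card]
  simp

theorem exists_walls (a : ℤ → Fin d → ℝ) : ∃ (S : Finset (Fin d)) (p : Fin d → ℝ),
    (∀ i ∈ S, IsWall a i (p i)) ∧ ∀ i p', IsWall a i p' → i ∈ S ∧ p' = p i := by
  classical
  have h : ∀ i, ∃ p, (∃ p', IsWall a i p') → IsWall a i p := by
    intro i
    by_cases hi : ∃ p', IsWall a i p'
    · exact ⟨hi.choose, fun _ => hi.choose_spec⟩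
    · exact ⟨0, fun h => absurd h hi⟩
  choose p hp using h
  refine ⟨Finset.univ.filter fun i => ∃ p', IsWall a i p', p, fun i hi => ?_, fun i p' hp' => ?_⟩
  · exact hp i (Finset.mem_filter.1 hi).2
  · exact ⟨Finset.mem_filter.2 ⟨Finset.mem_univ i, p', hp'⟩, hp'.unique (hp i ⟨p', hp'⟩)⟩

end

/-! ### Invariance of the assertions under isometries -/

section Transport

variable (κ : HSpace d ≃ᵢ HSpace d) {𝒯 : Set (Set (HSpace d))}

theorem IsHorosphericFacet.image {T F : Set (HSpace d)} (h : IsHorosphericFacet T F) :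
    IsHorosphericFacet (κ '' T) (κ '' F) := by
  obtain ⟨φ, rfl, h⟩ := h
  refine ⟨φ.trans κ, image_trans _ _ _, ?_⟩
  rcases h with rfl | ⟨σ, rfl⟩
  · exact Or.inl (image_trans _ _ _)
  · exact Or.inr ⟨σ, image_trans _ _ _⟩

theorem adj_map {T T' : Set (HSpace d)} (h : (horosphericGraph 𝒯).Adj T T') :
    (horosphericGraph (mapTiling κ 𝒯)).Adj (κ '' T) (κ '' T') := by
  obtain ⟨h1, h2, h3, F, hF, hF'⟩ := h
  exact ⟨image_mem_mapTiling.2 h1, image_mem_mapTiling.2 h2,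
    fun h => h3 (κ.injective.image_injective h), _, hF.image κ, hF'.image κ⟩

theorem reachable_map {T T' : Set (HSpace d)} (h : (horosphericGraph 𝒯).Reachable T T') :
    (horosphericGraph (mapTiling κ 𝒯)).Reachable (κ '' T) (κ '' T') :=
  h.map (⟨fun T => κ '' T, adj_map κ⟩ : horosphericGraph 𝒯 →g horosphericGraph (mapTiling κ 𝒯))

theorem mapTiling_symm' (𝒯 : Set (Set (HSpace d))) : mapTiling κ.symm (mapTiling κ 𝒯) = 𝒯 :=
  mapTiling_symm κ.symm 𝒯

theorem pool_map (T : Set (HSpace d)) :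
    pool (mapTiling κ 𝒯) (κ '' T) = mapTiling κ (pool 𝒯 T) := by
  ext T'
  rw [mem_mapTiling, mem_pool, mem_pool]
  constructor
  · intro h
    have := reachable_map κ.symm h
    rwa [mapTiling_symm', image_symm_image] at this
  · intro h
    have := reachable_map κ h
    rwa [image_image_symm] at this

theorem pools_map (𝒯 : Set (Set (HSpace d))) :
    pools (mapTiling κ 𝒯) = mapTiling κ '' pools 𝒯 := by
  ext P
  constructor
  · rintro ⟨_, ⟨T, hT, rfl⟩, rfl⟩
    exact ⟨_, ⟨T, hT, rfl⟩, (pool_map κ T).symm⟩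
  · rintro ⟨_, ⟨T, hT, rfl⟩, rfl⟩
    exact ⟨_, ⟨T, hT, rfl⟩, (pool_map κ T).symm⟩

theorem mapTiling_injective : Function.Injective (mapTiling κ) :=
  κ.injective.image_injective.image_injective

theorem encard_pools_map (𝒯 : Set (Set (HSpace d))) :
    (pools (mapTiling κ 𝒯)).encard = (pools 𝒯).encard := by
  rw [pools_map, (mapTiling_injective κ).encard_image]

theorem support_map (P : Set (Set (HSpace d))) : support (mapTiling κ P) = κ '' support P := by
  rw [support, support, mapTiling, Set.image_sUnion]

theorem Congruent.symm {A B : Set (HSpace d)} (h : Congruent A B) : Congruent B A := by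
  obtain ⟨φ, rfl⟩ := h
  exact ⟨φ.symm, image_symm_image φ A⟩

theorem Congruent.trans {A B C : Set (HSpace d)} (h : Congruent A B) (h' : Congruent B C) :
    Congruent A C := by
  obtain ⟨φ, rfl⟩ := h
  obtain ⟨ψ, rfl⟩ := h'
  exact ⟨φ.trans ψ, image_trans _ _ _⟩

theorem TilewiseCongruent.map {P P' : Set (Set (HSpace d))} (h : TilewiseCongruent P P') :
    TilewiseCongruent (mapTiling κ P) (mapTiling κ P') := by
  obtain ⟨φ, rfl⟩ := h
  refine ⟨(κ.symm.trans φ).trans κ, ?_⟩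
  rw [mapTiling, mapTiling, Set.image_image, Set.image_image]
  refine Set.image_congr fun T _ => ?_
  rw [image_trans, image_trans, image_symm_image]

theorem image_bisector (a b : HSpace d) :
    κ '' {p | dist p a = dist p b} = {p | dist p (κ a) = dist p (κ b)} := by
  ext p
  obtain ⟨q, rfl⟩ := κ.surjective p
  rw [κ.injective.mem_set_image, Set.mem_ofPred_eq, Set.mem_ofPred_eq, κ.dist_eq, κ.dist_eq]

theorem image_halfSpace (a b : HSpace d) : κ '' halfSpace a b = halfSpace (κ a) (κ b) := by
  ext p
  obtain ⟨q, rfl⟩ := κ.surjective p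
  rw [κ.injective.mem_set_image, halfSpace, halfSpace, Set.mem_ofPred_eq, Set.mem_ofPred_eq,
    κ.dist_eq, κ.dist_eq]

theorem IsHyperplane.image {h : Set (HSpace d)} (hh : IsHyperplane h) : IsHyperplane (κ '' h) := by
  obtain ⟨a, b, hab, rfl⟩ := hh
  exact ⟨κ a, κ b, κ.injective.ne hab, image_bisector κ a b⟩

theorem OnOneSide.image {h A : Set (HSpace d)} (hh : OnOneSide h A) :
    OnOneSide (κ '' h) (κ '' A) := by
  obtain ⟨a, b, hab, rfl, hA⟩ := hh
  exact ⟨κ a, κ b, κ.injective.ne hab, image_bisector κ a b,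
    image_halfSpace κ a b ▸ Set.image_mono hA⟩

theorem Separates.image {h A A' : Set (HSpace d)} (hh : Separates h A A') :
    Separates (κ '' h) (κ '' A) (κ '' A') := by
  obtain ⟨a, b, hab, rfl, hA, hA'⟩ := hh
  exact ⟨κ a, κ b, κ.injective.ne hab, image_bisector κ a b,
    image_halfSpace κ a b ▸ Set.image_mono hA, image_halfSpace κ b a ▸ Set.image_mono hA'⟩

theorem Orthogonal.image {h h' : Set (HSpace d)} (hh : Orthogonal h h') :
    Orthogonal (κ '' h) (κ '' h') := by
  obtain ⟨hne, ρ, hρ, hρ'⟩ := hh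
  refine ⟨fun h => hne (κ.injective.image_injective h), (κ.symm.trans ρ).trans κ, fun p => ?_, ?_⟩
  · rw [mem_image_iso, ← hρ, IsometryEquiv.trans_apply, IsometryEquiv.trans_apply,
      ← κ.symm.injective.eq_iff, IsometryEquiv.symm_apply_apply]
  · rw [image_trans, image_trans, image_symm_image, hρ']

theorem IsPlane.image {m : ℕ} {L : Set (HSpace d)} (h : IsPlane m L) : IsPlane m (κ '' L) := by
  obtain ⟨S, φ, hS, rfl⟩ := h
  exact ⟨S, φ.trans κ, hS, image_trans _ _ _⟩

/-- The supports of the pools of `𝒯` share an `m`-plane and are separated by `k` pairwise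
orthogonal hyperplanes through it. -/
def PoolsShareAxis (m k : ℕ) (𝒯 : Set (Set (HSpace d))) : Prop :=
  ∃ L : Set (HSpace d), IsPlane m L ∧ (⋂ P ∈ pools 𝒯, support P) = L ∧
    ∃ h : Fin k → Set (HSpace d),
      (∀ j, IsHyperplane (h j)) ∧
      (∀ i j, i ≠ j → Orthogonal (h i) (h j)) ∧
      (∀ j, ∀ P ∈ pools 𝒯, OnOneSide (h j) (support P)) ∧
      (∀ P ∈ pools 𝒯, ∀ P' ∈ pools 𝒯, P ≠ P' → ∃ j, Separates (h j) (support P) (support P')) ∧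
      L = ⋂ j, h j

theorem PoolsShareAxis.map {m k : ℕ} (h : PoolsShareAxis m k 𝒯) :
    PoolsShareAxis m k (mapTiling κ 𝒯) := by
  obtain ⟨L, hL, hL', h, h1, h2, h3, h4, h5⟩ := h
  refine ⟨κ '' L, hL.image κ, ?_, fun j => κ '' h j, fun j => (h1 j).image κ,
    fun i j hij => (h2 i j hij).image κ, ?_, ?_, ?_⟩
  · rw [pools_map, Set.biInter_image, ← hL']
    simp only [support_map]
    rw [Set.image_iInter₂ κ.bijective]
  · rw [pools_map]
    rintro j _ ⟨P, hP, rfl⟩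
    rw [support_map]
    exact (h3 j P hP).image κ
  · rw [pools_map]
    rintro _ ⟨P, hP, rfl⟩ _ ⟨P', hP', rfl⟩ hne
    obtain ⟨j, hj⟩ := h4 P hP P' hP' fun h => hne (by rw [h])
    refine ⟨j, ?_⟩
    rw [support_map, support_map]
    exact hj.image κ
  · rw [h5, Set.image_iInter κ.bijective]

end Transport

/-! ### Congruence of pools and the separating hyperplanes -/

theorem image_eq_of_mem_iff {φ : HSpace d ≃ᵢ HSpace d} {A B : Set (HSpace d)}
    (h : ∀ q, φ q ∈ B ↔ q ∈ A) : φ '' A = B := by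
  ext p
  obtain ⟨q, rfl⟩ := φ.surjective p
  rw [φ.injective.mem_set_image, h]

/-- Orthants with the same number of bounding hyperplanes are congruent. -/
theorem congruent_orthant {S S' : Finset (Fin d)} (hS : S.card = S'.card) (p p' : Fin d → ℝ)
    (σ σ' : Fin d → ℤˣ) : Congruent (orthant S p σ) (orthant S' p' σ') := by
  classical
  obtain ⟨π, hπ⟩ : ∃ π : Equiv.Perm (Fin d), ∀ i, π i ∈ S ↔ i ∈ S' := by
    let e : {i // i ∈ S'} ≃ {i // i ∈ S} := Finset.equivOfCardEq hS.symm
    refine ⟨e.extendSubtype, fun i => ⟨fun h => ?_, fun h => e.extendSubtype_mem i h⟩⟩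
    by_contra hcon
    exact e.extendSubtype_not_mem i hcon h
  refine ⟨stdIso π (fun i => σ' i * σ (π i))
    (fun i => p' i - ((σ' i : ℤ) : ℝ) * ((σ (π i) : ℤ) : ℝ) * p (π i)) 0,
    image_eq_of_mem_iff fun q => ?_⟩
  have h1 : ∀ i, ((σ' i : ℤ) : ℝ) * ((stdIso π (fun i => σ' i * σ (π i))
      (fun i => p' i - ((σ' i : ℤ) : ℝ) * ((σ (π i) : ℤ) : ℝ) * p (π i)) 0 q).x i - p' i) =
      ((σ (π i) : ℤ) : ℝ) * (q.x (π i) - p (π i)) := by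
    intro i
    rw [stdIso_x]
    push_cast
    rw [zpow_zero]
    linear_combination (((σ (π i) : ℤ) : ℝ) * (q.x (π i) - p (π i))) * unit_mul_self (σ' i)
  simp only [orthant, Set.mem_ofPred_eq, h1]
  constructor
  · intro h i hi
    have := h (π.symm i) ((hπ _).1 (by simpa using hi))
    simpa using this
  · intro h i hi
    exact h (π i) ((hπ i).2 hi)

section
variable {a : ℤ → Fin d → ℝ} {S : Finset (Fin d)} {p : Fin d → ℝ}

/-- The composition of the reflections in the walls of the coordinates with `s i = -1`. -/
def wallRefl (p : Fin d → ℝ) (s : Fin d → ℤˣ) : HSpace d ≃ᵢ HSpace d :=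
  stdIso 1 s (fun i => (1 - ((s i : ℤ) : ℝ)) * p i) 0

theorem wallRefl_x (s : Fin d → ℤˣ) (q : HSpace d) (i : Fin d) :
    (wallRefl p s q).x i = p i + ((s i : ℤ) : ℝ) * (q.x i - p i) := by
  simp [wallRefl]; ring

theorem wallRefl_t (s : Fin d → ℤˣ) (q : HSpace d) : (wallRefl p s q).t = q.t := by
  simp [wallRefl]

theorem wallRefl_wallRefl (s : Fin d → ℤˣ) (q : HSpace d) :
    wallRefl p s (wallRefl p s q) = q := by
  refine ext' (fun i => ?_) (by rw [wallRefl_t, wallRefl_t])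
  rw [wallRefl_x, wallRefl_x]
  linear_combination (q.x i - p i) * unit_mul_self (s i)

/-- Reflection in one of its own points preserves a one-dimensional grid, and a wall is a grid point
on all levels simultaneously. -/
theorem wallRefl_cell (hS : ∀ i ∈ S, IsWall a i (p i)) {s : Fin d → ℤˣ} (hs : ∀ i, i ∉ S → s i = 1)
    (n : ℤ) (z : Fin d → ℤ) : wallRefl p s '' cell a n z ∈ gridTiling a := by
  have hz : ∀ i, ∃ w : ℤ, ∀ x : ℝ,
      (a n i + 2 ^ (n + 1) * (w : ℝ) ≤ p i + ((s i : ℤ) : ℝ) * (x - p i) ∧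
      p i + ((s i : ℤ) : ℝ) * (x - p i) ≤ a n i + 2 ^ (n + 1) * ((w : ℝ) + 1)) ↔
      a n i + 2 ^ (n + 1) * (z i : ℝ) ≤ x ∧ x ≤ a n i + 2 ^ (n + 1) * ((z i : ℝ) + 1) := by
    intro i
    rcases Int.units_eq_one_or (s i) with h | h
    · refine ⟨z i, fun x => ?_⟩
      rw [h]
      simp
    · have hi : i ∈ S := by
        by_contra hi
        rw [hs i hi] at h
        exact absurd h (by decide)
      obtain ⟨m, hm⟩ := hS i hi n
      -- Reflection in `m` turns the index interval from `z i` to `z i + 1` around, so its new left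
      -- end is `2 * m - (z i + 1)`.
      refine ⟨2 * m - z i - 1, fun x => ?_⟩
      rw [h, hm]
      push_cast
      constructor <;> rintro ⟨h1, h2⟩ <;> constructor <;> linarith
  choose w hw using hz
  refine ⟨n, w, image_eq_of_mem_iff fun q => ?_⟩
  rw [mem_cell, mem_cell, wallRefl_t]
  simp only [wallRefl_x, hw]

theorem wallRefl_orthant {s σ σ' : Fin d → ℤˣ} (h : ∀ i ∈ S, s i = σ i * σ' i) :
    wallRefl p s '' orthant S p σ = orthant S p σ' := by
  refine image_eq_of_mem_iff fun q => forall₂_congr fun i hi => ?_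
  rw [wallRefl_x, h i hi]
  push_cast
  have : ((σ' i : ℤ) : ℝ) * (p i + ((σ i : ℤ) : ℝ) * ((σ' i : ℤ) : ℝ) * (q.x i - p i) - p i) =
      ((σ i : ℤ) : ℝ) * (q.x i - p i) := by
    linear_combination (((σ i : ℤ) : ℝ) * (q.x i - p i)) * unit_mul_self (σ' i)
  rw [this]

theorem tilewiseCongruent_tilesIn (hS : ∀ i ∈ S, IsWall a i (p i)) (σ σ' : Fin d → ℤˣ) :
    TilewiseCongruent (tilesIn a S p σ) (tilesIn a S p σ') := by
  classical
  set s : Fin d → ℤˣ := fun i => if i ∈ S then σ i * σ' i else 1 with hs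
  have hs0 : ∀ i, i ∉ S → s i = 1 := fun i hi => by simp [hs, hi]
  have hs1 : ∀ i ∈ S, s i = σ i * σ' i := fun i hi => by simp [hs, hi]
  have hs2 : ∀ i ∈ S, s i = σ' i * σ i := fun i hi => by rw [hs1 i hi, mul_comm]
  refine ⟨wallRefl p s, Set.Subset.antisymm ?_ fun T hT => ⟨wallRefl p s '' T, ?_, ?_⟩⟩
  · rintro _ ⟨_, ⟨⟨n, z, rfl⟩, h⟩, rfl⟩
    exact ⟨wallRefl_cell hS hs0 n z, wallRefl_orthant hs1 ▸ Set.image_mono h⟩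
  · obtain ⟨⟨n, z, rfl⟩, h⟩ := hT
    exact ⟨wallRefl_cell hS hs0 n z, wallRefl_orthant hs2 ▸ Set.image_mono h⟩
  · simp only [Set.image_image, wallRefl_wallRefl, Set.image_id']

/-- A point next to the hyperplane `x i = c`. -/
def beside (i : Fin d) (c : ℝ) (ε : ℤˣ) : HSpace d :=
  pt (Pi.single i (c + ((ε : ℤ) : ℝ))) 1 one_pos

theorem dsq_beside (i : Fin d) (c : ℝ) (ε : ℤˣ) (q : HSpace d) :
    dsq q (beside i c ε) = (∑ j, q.x j ^ 2 - 2 * c * q.x i + c ^ 2 + 1 + (q.t - 1) ^ 2 -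
      2 * (((ε : ℤ) : ℝ) * (q.x i - c))) / q.t := by
  rw [dsq, beside]
  simp only [pt_x, pt_t, sum_sub_single_sq, mul_one]
  congr 1
  linear_combination unit_sq ε

theorem dist_beside_le {i : Fin d} {c : ℝ} {ε : ℤˣ} {q : HSpace d} :
    dist q (beside i c ε) ≤ dist q (beside i c (-ε)) ↔ 0 ≤ ((ε : ℤ) : ℝ) * (q.x i - c) := by
  rw [dist_le_dist_iff, dsq_beside, dsq_beside, div_le_div_iff_of_pos_right q.pos]
  push_cast
  constructor <;> intro h <;> linarith

theorem beside_ne (i : Fin d) (c : ℝ) (ε : ℤˣ) : beside i c ε ≠ beside i c (-ε) := by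
  intro h
  have := congrArg (fun q : HSpace d => q.x i) h
  simp only [beside, pt_x, Pi.single_eq_same] at this
  push_cast at this
  have := unit_sq ε
  nlinarith

/-- This links vertical hyperplanes to the definition by bisectors; with the sign free, either side
can be put nearer to the first point. -/
theorem level_eq_bisector (i : Fin d) (c : ℝ) (ε : ℤˣ) :
    {q : HSpace d | q.x i = c} = {q | dist q (beside i c ε) = dist q (beside i c (-ε))} := by
  ext q
  have h1 := dist_beside_le (i := i) (c := c) (ε := ε) (q := q)
  have h2 := dist_beside_le (i := i) (c := c) (ε := -ε) (q := q)
  rw [neg_neg] at h2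
  rw [Set.mem_ofPred_eq, Set.mem_ofPred_eq,
    le_antisymm_iff (a := dist q (beside i c ε)), h1, h2]
  push_cast
  constructor
  · intro h; rw [h]; simp
  · rintro ⟨h3, h4⟩
    have h5 : ((ε : ℤ) : ℝ) * (q.x i - c) = 0 := by linarith
    have h6 := unit_mul_self ε
    linear_combination ((ε : ℤ) : ℝ) * h5 - (q.x i - c) * h6

theorem poolsShareAxis_gridTiling (hd : 0 < d) (ha : Compatible a)
    (hS : ∀ i ∈ S, IsWall a i (p i)) (hS' : ∀ i p', IsWall a i p' → i ∈ S ∧ p' = p i) :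
    PoolsShareAxis (d - S.card + 1) S.card (gridTiling a) := by
  let e : Fin S.card ≃ S := S.equivFin.symm
  have hcard : S.card ≤ d := by simpa using S.card_le_univ
  refine ⟨{q | ∀ i ∈ S, q.x i = p i}, ⟨S, stdIso 1 1 p 0, by omega, ?_⟩, ?_,
    fun j => {q | q.x (e j) = p (e j)}, fun j => ?_, fun i j hij => ?_, fun j P hP => ?_,
    fun P hP P' hP' hne => ?_, ?_⟩
  · refine image_eq_of_mem_iff fun q => forall₂_congr fun i _ => ?_
    simp
  · rw [pools_gridTiling hd ha hS hS', Set.biInter_range]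
    simp only [support_tilesIn hS]
    ext q
    simp only [Set.mem_iInter, orthant, Set.mem_ofPred_eq]
    constructor
    · intro h i hi
      -- Two opposite orthants already force equality in all coordinates of `S`.
      have h1 := h 1 i hi
      have h2 := h (-1) i hi
      simp only [Pi.one_apply, Pi.neg_apply] at h1 h2
      push_cast at h1 h2
      linarith
    · intro h σ i hi
      rw [h i hi]; simp
  · exact ⟨_, _, beside_ne _ _ 1, level_eq_bisector _ _ 1⟩
  · have hij' : (e i : Fin d) ≠ e j := fun h => hij (e.injective (Subtype.ext h))
    refine ⟨fun h => ?_, refl (e i) (p (e i)), fun q => refl_eq_self_iff, ?_⟩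
    · have h1 : pt (Pi.single (e i : Fin d) (p (e i)) + Pi.single (e j : Fin d) (p (e j) + 1)) 1
          one_pos ∈ {q : HSpace d | q.x (e i) = p (e i)} := by simp [hij']
      beta_reduce at h
      rw [h] at h1
      simp [hij'.symm] at h1
    · refine image_eq_of_mem_iff fun q => ?_
      rw [Set.mem_ofPred_eq, Set.mem_ofPred_eq, refl_x_of_ne hij'.symm]
  · rw [pools_gridTiling hd ha hS hS'] at hP
    obtain ⟨σ, rfl⟩ := hP
    rw [support_tilesIn hS]
    exact ⟨_, _, beside_ne _ _ (σ (e j)), level_eq_bisector _ _ _,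
      fun q hq => dist_beside_le.2 (hq _ (e j).2)⟩
  · rw [pools_gridTiling hd ha hS hS'] at hP hP'
    obtain ⟨σ, rfl⟩ := hP
    obtain ⟨σ', rfl⟩ := hP'
    rw [support_tilesIn hS, support_tilesIn hS]
    rw [Ne, tilesIn_eq_iff hS] at hne
    push Not at hne
    obtain ⟨i, hi, hne⟩ := hne
    have hj : (e (e.symm ⟨i, hi⟩) : Fin d) = i := by simp
    refine ⟨e.symm ⟨i, hi⟩, beside i (p i) (σ i), beside i (p i) (-σ i), beside_ne _ _ _, ?_,
      fun q hq => dist_beside_le.2 (hq i hi), fun q hq => ?_⟩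
    · beta_reduce
      rw [hj]; exact level_eq_bisector _ _ _
    · have h1 := hq i hi
      rw [unit_eq_neg_of_ne hne] at h1
      have h2 := dist_beside_le.2 h1
      rwa [neg_neg] at h2
  · ext q
    simp only [Set.mem_ofPred_eq, Set.mem_iInter]
    exact ⟨fun h j => h _ (e j).2, fun h i hi => by simpa using h (e.symm ⟨i, hi⟩)⟩

end

/-- Every B-tiling is the image of a grid tiling under an isometry. -/
theorem IsBTiling.exists_eq_map {𝒯 : Set (Set (HSpace d))} (h : IsBTiling 𝒯) (hd : 0 < d) :
    ∃ (κ : HSpace d ≃ᵢ HSpace d) (a : ℤ → Fin d → ℝ), Compatible a ∧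
      𝒯 = mapTiling κ (gridTiling a) := by
  obtain ⟨T, hT, _⟩ : pt (fun _ => 0) 1 one_pos ∈ ⋃₀ 𝒯 := h.cover ▸ Set.mem_univ _
  obtain ⟨φ, rfl⟩ := h.congruent T hT
  obtain ⟨a, ha, h1⟩ := (h.map φ.symm).eq_gridTiling hd (mem_mapTiling.2 hT)
  exact ⟨φ, a, ha, by rw [← h1, mapTiling_symm]⟩

/-! ### Tilings with a prescribed number of pools -/

/-- The grids with walls in exactly the first `k` coordinates. -/
def exampleGrid (d k : ℕ) (n : ℤ) (i : Fin d) : ℝ :=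
  if (i : ℕ) < k then 0 else 2 ^ (n + 1) * (((-1) ^ n.natAbs : ℤ) : ℝ) / 3

theorem neg_one_pow_natAbs_succ (n : ℤ) : ((-1) ^ (n + 1).natAbs : ℤ) = -(-1) ^ n.natAbs := by
  rcases Int.even_or_odd n with h | h
  · rw [(Int.natAbs_even.2 h).neg_one_pow, (Int.natAbs_odd.2 h.add_one).neg_one_pow]
  · rw [(Int.natAbs_odd.2 h).neg_one_pow, (Int.natAbs_even.2 h.add_one).neg_one_pow, neg_neg]

theorem compatible_exampleGrid (d k : ℕ) : Compatible (exampleGrid d k) := by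
  intro n i
  by_cases hi : (i : ℕ) < k
  · exact ⟨0, by simp [exampleGrid, hi]⟩
  -- Doubling the mesh and changing the sign shifts the vertex by a whole mesh, since `-2 / 3 = 1 /
  -- 3 - 1`.
  · refine ⟨-(-1) ^ n.natAbs, ?_⟩
    rw [exampleGrid, exampleGrid, if_neg hi, if_neg hi, neg_one_pow_natAbs_succ,
      two_zpow_succ (n + 1)]
    push_cast; ring

theorem isWall_exampleGrid_iff {k : ℕ} {i : Fin d} {p : ℝ} :
    IsWall (exampleGrid d k) i p ↔ (i : ℕ) < k ∧ p = 0 := by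
  have hcase : ∀ j : Fin d, (j : ℕ) < k → IsWall (exampleGrid d k) j 0 := fun j hj n =>
    ⟨0, by simp [exampleGrid, hj]⟩
  constructor
  · intro h
    have hi : (i : ℕ) < k := by
      by_contra hi
      obtain ⟨n, hn⟩ := exists_lt_two_zpow (3 * |p|)
      obtain ⟨m, hm⟩ := h n
      rw [exampleGrid, if_neg hi] at hm
      -- The integer factor is not divisible by 3, hence nonzero, so a wall would satisfy `3 * |p| ≥
      -- 2 ^ (n + 1)` for arbitrarily large `n`.
      have h1 : 3 * p = 2 ^ (n + 1) * (((-1) ^ n.natAbs + 3 * m : ℤ) : ℝ) := by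
        rw [hm]; push_cast; ring
      have h2 : ((-1) ^ n.natAbs + 3 * m : ℤ) ≠ 0 := by
        rcases neg_one_pow_eq_or ℤ n.natAbs with h | h <;> rw [h] <;> omega
      have h3 : (1 : ℝ) ≤ |(((-1) ^ n.natAbs + 3 * m : ℤ) : ℝ)| := by
        exact_mod_cast Int.one_le_abs h2
      have h4 := hn (n + 1) (by omega)
      rw [← abs_of_pos (three_pos (α := ℝ)), ← abs_mul, h1, abs_mul,
        abs_of_pos (by positivity : (0 : ℝ) < 2 ^ (n + 1))] at h4
      have h5 : (0 : ℝ) < 2 ^ (n + 1) := by positivity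
      nlinarith
    exact ⟨hi, h.unique (hcase i hi)⟩
  · rintro ⟨hi, rfl⟩
    exact hcase i hi

theorem encard_pools_exampleGrid (hd : 0 < d) {k : ℕ} (hk : k ≤ d) :
    (pools (gridTiling (exampleGrid d k))).encard = 2 ^ k := by
  classical
  rw [encard_pools_gridTiling hd (compatible_exampleGrid d k)
    (S := Finset.univ.filter fun i : Fin d => (i : ℕ) < k) (p := 0)]
  · congr 1
    rw [Fin.card_filter_val_lt, min_eq_right hk]
  · intro i hi
    exact isWall_exampleGrid_iff.2 ⟨(Finset.mem_filter.1 hi).2, rfl⟩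
  · intro i p' hp'
    obtain ⟨h1, h2⟩ := isWall_exampleGrid_iff.1 hp'
    exact ⟨Finset.mem_filter.2 ⟨Finset.mem_univ i, h1⟩, h2⟩

theorem eq_of_two_pow_eq {m k : ℕ} (h : (2 : ℕ∞) ^ m = 2 ^ k) : m = k := by
  have h1 : (2 : ℕ) ^ m = 2 ^ k := by exact_mod_cast h
  exact Nat.pow_right_injective le_rfl h1

end Boroczky

end

/-! ### The theorem, by transport from grid tilings -/

theorem mainTheorem2 (d : ℕ) (hd : 1 ≤ d) :
    (∀ 𝒯 : Set (Set (Boroczky.HSpace d)), Boroczky.IsBTiling 𝒯 →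
      ∃ k ≤ d, (Boroczky.pools 𝒯).encard = 2 ^ k) ∧
    (∀ k ≤ d, ∃ 𝒯 : Set (Set (Boroczky.HSpace d)), Boroczky.IsBTiling 𝒯 ∧
      (Boroczky.pools 𝒯).encard = 2 ^ k) ∧
    (∀ k ≤ d, ∀ 𝒯 𝒯' : Set (Set (Boroczky.HSpace d)),
      Boroczky.IsBTiling 𝒯 → (Boroczky.pools 𝒯).encard = 2 ^ k →
      Boroczky.IsBTiling 𝒯' → (Boroczky.pools 𝒯').encard = 2 ^ k →
      ∀ P ∈ Boroczky.pools 𝒯, ∀ P' ∈ Boroczky.pools 𝒯',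
        Boroczky.Congruent (Boroczky.support P) (Boroczky.support P')) ∧
    (∀ 𝒯 : Set (Set (Boroczky.HSpace d)), Boroczky.IsBTiling 𝒯 →
      ∀ P ∈ Boroczky.pools 𝒯, ∀ P' ∈ Boroczky.pools 𝒯, Boroczky.TilewiseCongruent P P') ∧
    (∀ k ≤ d, ∀ 𝒯 : Set (Set (Boroczky.HSpace d)),
      Boroczky.IsBTiling 𝒯 → (Boroczky.pools 𝒯).encard = 2 ^ k →
      ∃ L : Set (Boroczky.HSpace d), Boroczky.IsPlane (d - k + 1) L ∧
        (⋂ P ∈ Boroczky.pools 𝒯, Boroczky.support P) = L ∧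
        ∃ h : Fin k → Set (Boroczky.HSpace d),
          (∀ j, Boroczky.IsHyperplane (h j)) ∧
          (∀ i j, i ≠ j → Boroczky.Orthogonal (h i) (h j)) ∧
          (∀ j, ∀ P ∈ Boroczky.pools 𝒯, Boroczky.OnOneSide (h j) (Boroczky.support P)) ∧
          (∀ P ∈ Boroczky.pools 𝒯, ∀ P' ∈ Boroczky.pools 𝒯, P ≠ P' →
            ∃ j, Boroczky.Separates (h j) (Boroczky.support P) (Boroczky.support P')) ∧
          L = ⋂ j, h j) := by
  open Boroczky in
  refine ⟨fun 𝒯 h𝒯 => ?_, fun k hk => ?_, fun k _ 𝒯 𝒯' h𝒯 hk𝒯 h𝒯' hk𝒯' P hP P' hP' => ?_,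
    fun 𝒯 h𝒯 P hP P' hP' => ?_, fun k _ 𝒯 h𝒯 hk𝒯 => ?_⟩
  · obtain ⟨κ, a, ha, rfl⟩ := h𝒯.exists_eq_map hd
    obtain ⟨S, p, hS, hS'⟩ := exists_walls a
    exact ⟨S.card, by simpa using S.card_le_univ,
      (encard_pools_map κ _).trans (encard_pools_gridTiling hd ha hS hS')⟩
  · exact ⟨_, isBTiling_gridTiling hd (compatible_exampleGrid d k), encard_pools_exampleGrid hd hk⟩
  · obtain ⟨κ, a, ha, rfl⟩ := h𝒯.exists_eq_map hd
    obtain ⟨κ', a', ha', rfl⟩ := h𝒯'.exists_eq_map hd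
    obtain ⟨S, p, hS, hS1⟩ := exists_walls a
    obtain ⟨S', p', hS', hS1'⟩ := exists_walls a'
    rw [encard_pools_map, encard_pools_gridTiling hd ha hS hS1] at hk𝒯
    rw [encard_pools_map, encard_pools_gridTiling hd ha' hS' hS1'] at hk𝒯'
    rw [pools_map, pools_gridTiling hd ha hS hS1] at hP
    rw [pools_map, pools_gridTiling hd ha' hS' hS1'] at hP'
    obtain ⟨_, ⟨σ, rfl⟩, rfl⟩ := hP
    obtain ⟨_, ⟨σ', rfl⟩, rfl⟩ := hP'
    rw [support_map, support_map, support_tilesIn hS, support_tilesIn hS']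
    exact (Boroczky.Congruent.symm ⟨κ, rfl⟩).trans ((congruent_orthant
      (eq_of_two_pow_eq (hk𝒯.trans hk𝒯'.symm)) p p' σ σ').trans ⟨κ', rfl⟩)
  · obtain ⟨κ, a, ha, rfl⟩ := h𝒯.exists_eq_map hd
    obtain ⟨S, p, hS, hS'⟩ := exists_walls a
    rw [pools_map, pools_gridTiling hd ha hS hS'] at hP hP'
    obtain ⟨_, ⟨σ, rfl⟩, rfl⟩ := hP
    obtain ⟨_, ⟨σ', rfl⟩, rfl⟩ := hP'
    exact (tilewiseCongruent_tilesIn hS σ σ').map κ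
  · obtain ⟨κ, a, ha, rfl⟩ := h𝒯.exists_eq_map hd
    obtain ⟨S, p, hS, hS'⟩ := exists_walls a
    rw [encard_pools_map, encard_pools_gridTiling hd ha hS hS'] at hk𝒯
    obtain rfl := eq_of_two_pow_eq hk𝒯
    exact (poolsShareAxis_gridTiling hd ha hS hS').map κ
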